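/- **Setting.** Let $\Theta$ be a compact $d$-dimensional smooth Riemannian manifold without boundary (possibly disconnected, points of distinct components being at distance $+\infty$), $\mathcal F$ a real Hilbert space, $\lambda>0$, $\phi:\Theta\to\mathcal F$, $R:\mathcal F\to\mathbb R_+$. For a finite nonnegative Borel measure $\nu\in\mathcal M_+(\Theta)$ put $$f_\nu=\int_\Theta\phi\,d\nu,\qquad J(\nu)=R(f_\nu)+\lambda\,\nu(\Theta),\qquad J^\star=\inf_{\mathcal M_+(\Theta)}J,\qquad J'_\nu(\theta)=\langle\phi(\theta),\nabla R(f_\nu)\rangle+\lambda .$$ Assume: * (A1) $\phi$ and $R$ are twice Fréchet differentiable with locally Lipschitz second-order derivatives, and $\nabla R$ is bounded on the sublevel sets of $R$. * (A2) $\alpha,\beta>0$ (parameters of the conic metric). * (A3) $R$ is convex. * (A4) $J$ has a unique minimizer on $\mathcal M_+(\Theta)$, of the form $\nu^\star=\sum_{i=1}^{m}r_i^2\delta_{\theta_i}\neq0$ with $r_i>0$ and distinct $\theta_i$; put $f^\star=f_{\nu^\star}$. Fix normal coordinates around each $\theta_i$, on a geodesic ball of radius $\rho_i$ that is at most the injectivity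 radius at $\theta_i$; in them $\theta_i$ is the origin. Put $\bar\nabla\phi=(2\alpha\phi,\beta\nabla\phi)$, with components $j=0,\dots,d$, and define the matrices, with index set $\{1,\dots,m\}\times\{0,\dots,d\}$ for $K$ and $H$, $$K_{(i,j),(i',j')}=d^2R_{f^\star}\big(r_i\bar\nabla_j\phi(\theta_i),\,r_{i'}\bar\nabla_{j'}\phi(\theta_{i'})\big),\qquad H_i=\beta^2\nabla^2J'_{\nu^\star}(\theta_i)\in\mathbb R^{d\times d},$$ $H_{(i,j),(i',j')}=(H_i)_{j,j'}$ if $i=i'$ and $j,j'\ge1$, and $0$ otherwise. Let $D$ be the diagonal matrix with entry $1/\alpha$ at the indices $(i,0)$ and $1/\beta$ at the indices $(i,j)$, $j\ge1$. Assume: * (A5) $\nabla^2R(f^\star)$ is positive definite, $\sigma_{\min}(K)>0$, $\sigma_{\min}(H_i)>0$ for all $i$, and $J'_{\nu^\star}$ vanishes at no other points than $\theta_1,\dots,\theta_m$. A radius $\tau$ is *admissible* if $0<\tau<1$, $\tau<\rho_i$ for all $i$, and the balls $\Theta_i=\{\theta:\mathrm{dist}(\theta,\theta_i)<\tau\}$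 are pairwise disjoint. Then let $\Theta_0=\Theta\setminus\bigcup_i\Theta_i$, and for $\nu\in\mathcal M_+(\Theta)$ and $1\le i\le m$, in the normal coordinates at $\theta_i$, $$\bar r_i^2=\nu(\Theta_i),\quad \bar\theta_i=\frac1{\bar r_i^2}\int_{\Theta_i}\theta\,d\nu,\quad b_i=\Big(\frac{\bar r_i^2-r_i^2}{2\alpha r_i},\ \frac{\bar r_i^2}{\beta r_i}(\bar\theta_i-\theta_i)\Big),\quad \Sigma_i=\frac1{\bar r_i^2\beta^2}\int_{\Theta_i}(\theta-\bar\theta_i)(\theta-\bar\theta_i)^\top d\nu$$ (with $\bar\theta_i=\theta_i$ and $\Sigma_i=0$ if $\nu(\Theta_i)=0$), $b=(b_1,\dots,b_m)$. For a Borel set $A$ put $$\|g_\nu\|^2_{L^2(\nu|_A)}=\int_A\big(4\alpha|J'_\nu|^2+\beta\|\nabla J'_\nu\|_\theta^2\big)\,d\nu,\qquad \|g_\nu\|^2_{L^2(\nu)}=\|g_\nu\|^2_{L^2(\nu|_\Theta)} .$$ **Proposition (local expansion).** For every $J_{\max}\in\mathbb R$ there is a constant $C$, independent of $\tau$ and $\nu$,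 such that for every admissible $\tau$ and every $\nu\in\mathcal M_+(\Theta)$ with $J(\nu)\le J_{\max}$, writing $\Delta=J(\nu)-J^\star$, $$\Big|\,J(\nu)-J^\star-\Big(\tfrac12b^\top(K+H)b+\tfrac12\sum_{i=1}^mr_i^2\,\mathrm{tr}(\Sigma_iH_i)+\int_{\Theta_0}J'_{\nu^\star}\,d\nu\Big)\Big|\le C\big(\Delta\tau+\Delta^{3/2}\tau^{-6}\big)$$ and $$\Big|\,\tfrac12\|g_\nu\|^2_{L^2(\nu)}-\Big(\tfrac12b^\top(K+H)D(K+H)b+\tfrac12\sum_{i=1}^mr_i^2\,\tfrac1\beta\,\mathrm{tr}(\Sigma_iH_i^2)+\tfrac12\|g_\nu\|^2_{L^2(\nu|_{\Theta_0})}\Big)\Big|\le C\big(\Delta\tau+\Delta^{3/2}\tau^{-6}\big).$$ In particular, for $\alpha=\beta=1$ the main terms of the second expansion are $\tfrac12b^\top(K+H)^2b+\tfrac12\sum_ir_i^2\,\mathrm{tr}(\Sigma_iH_i^2)$. -/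

import Mathlib

open scoped Manifold ContDiff Matrix NNReal ENNReal RealInnerProductSpace
open MeasureTheory Bundle

noncomputable section

/-- The model space of a `d`-dimensional manifold. -/
abbrev Eucl (d : ℕ) : Type := EuclideanSpace ℝ (Fin d)

/-- `g` is twice Fréchet differentiable on the open set `U`, with locally Lipschitz second-order
derivative. -/
def IsC21On {E G : Type*} [NormedAddCommGroup E] [NormedSpace ℝ E]
    [NormedAddCommGroup G] [NormedSpace ℝ G] (g : E → G) (U : Set E) : Prop :=
  ContDiffOn ℝ 2 g U ∧ LocallyLipschitzOn U (fderiv ℝ (fderiv ℝ g))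

/-- A map on a manifold is twice differentiable with locally Lipschitz second-order derivative if
it is so when read in the charts of the manifold. -/
def IsC21Manifold (d : ℕ) {Θ G : Type*} [TopologicalSpace Θ] [ChartedSpace (Eucl d) Θ]
    [NormedAddCommGroup G] [NormedSpace ℝ G] (g : Θ → G) : Prop :=
  ∀ p : Θ, IsC21On (g ∘ (chartAt (Eucl d) p).symm) (chartAt (Eucl d) p).target

/-- The smallest singular value of the square matrix `A` is positive, i.e. `A` is bounded from
below for the Euclidean norm. -/
def SigmaMinPos {ι : Type*} [Fintype ι] [DecidableEq ι] (A : Matrix ι ι ℝ) : Prop :=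
  ∃ c : ℝ, 0 < c ∧ ∀ v : EuclideanSpace ℝ ι, c * ‖v‖ ≤ ‖Matrix.toEuclideanLin A v‖

section Riemannian

variable {d : ℕ} {Θ : Type*} [EMetricSpace Θ] [ChartedSpace (Eucl d) Θ]
  [IsManifold 𝓘(ℝ, Eucl d) ∞ Θ]
  [RiemannianBundle (fun p : Θ => TangentSpace 𝓘(ℝ, Eucl d) p)]

/-- The differential at `p` of a real function `f`, as a linear form on the tangent space. -/
def riemDiff (d : ℕ) {Θ : Type*} [EMetricSpace Θ] [ChartedSpace (Eucl d) Θ]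
    (f : Θ → ℝ) (p : Θ) : TangentSpace 𝓘(ℝ, Eucl d) p →L[ℝ] ℝ :=
  mfderiv 𝓘(ℝ, Eucl d) 𝓘(ℝ, ℝ) f p

instance (p : Θ) : FiniteDimensional ℝ (TangentSpace 𝓘(ℝ, Eucl d) p) :=
  inferInstanceAs (FiniteDimensional ℝ (Eucl d))

instance (p : Θ) : CompleteSpace (TangentSpace 𝓘(ℝ, Eucl d) p) :=
  FiniteDimensional.complete ℝ _

/-- The Riemannian gradient at `p` of a real function `f`: the tangent vector that represents the
differential of `f` at `p` for the metric of the tangent space. -/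
def riemGrad (d : ℕ) {Θ : Type*} [EMetricSpace Θ] [ChartedSpace (Eucl d) Θ]
    [IsManifold 𝓘(ℝ, Eucl d) ∞ Θ]
    [RiemannianBundle (fun p : Θ => TangentSpace 𝓘(ℝ, Eucl d) p)]
    (f : Θ → ℝ) (p : Θ) : TangentSpace 𝓘(ℝ, Eucl d) p :=
  (InnerProductSpace.toDual ℝ (TangentSpace 𝓘(ℝ, Eucl d) p)).symm (riemDiff d f p)

/-- `x` is a system of normal coordinates centred at `p`, on the geodesic ball of radius `ρ`: a
smooth diffeomorphism of that ball onto the Euclidean ball of radius `ρ`, centred at `p`, isometric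
to first order at `p`, and such that the rays from the origin are the minimizing geodesics with
unit speed that start from `p`. In other words, `x.symm` is the exponential map at `p` read in an
orthonormal frame of the tangent space, restricted to a ball on which it is a diffeomorphism;
the injectivity radius at `p` is the largest possible `ρ`. -/
structure IsNormalChart (p : Θ) (ρ : ℝ) (x : OpenPartialHomeomorph Θ (Eucl d)) : Prop where
  radius_pos : 0 < ρ
  source_eq : x.source = Metric.eball p (ENNReal.ofReal ρ)
  target_eq : x.target = Metric.ball 0 ρ
  map_center : x p = 0
  smooth : ContMDiffOn 𝓘(ℝ, Eucl d) 𝓘(ℝ, Eucl d) ∞ x x.source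
  smooth_symm : ContMDiffOn 𝓘(ℝ, Eucl d) 𝓘(ℝ, Eucl d) ∞ x.symm x.target
  isometric_center : ∀ v : Eucl d,
    ‖mfderiv 𝓘(ℝ, Eucl d) 𝓘(ℝ, Eucl d) x.symm (0 : Eucl d) v‖ = ‖v‖
  radial_geodesic : ∀ v : Eucl d, ‖v‖ = 1 → ∀ s ∈ Set.Ico 0 ρ, ∀ t ∈ Set.Ico 0 ρ,
    edist (x.symm (s • v)) (x.symm (t • v)) = ENNReal.ofReal |s - t|

end Riemannian

/-- The data of the problem: the feature map `φ`, the loss `R`, the regularization `lam`, the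
parameters `α`, `β` of the conic metric, the weights `r i` (square roots of the masses) and the
positions `θ i` of the atoms of the sparse measure `ν⋆`, and a coordinate system `x i` around each
`θ i`, of radius `ρ i`. This structure carries no hypothesis. -/
structure SparseProblem (d m : ℕ) (Θ F : Type*) [EMetricSpace Θ] [NormedAddCommGroup F] where
  φ : Θ → F
  R : F → ℝ
  lam : ℝ
  α : ℝ
  β : ℝ
  r : Fin m → ℝ
  θ : Fin m → Θ
  ρ : Fin m → ℝ
  x : Fin m → OpenPartialHomeomorph Θ (Eucl d)

namespace SparseProblem

variable {d m : ℕ} {Θ F : Type*} [EMetricSpace Θ] [MeasurableSpace Θ]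
  [NormedAddCommGroup F] [InnerProductSpace ℝ F]

/-- `f_ν = ∫ φ dν`. -/
def feat (P : SparseProblem d m Θ F) (ν : FiniteMeasure Θ) : F :=
  ∫ p, P.φ p ∂(ν : Measure Θ)

/-- `J(ν) = R(∫ φ dν) + λ ν(Θ)`. -/
def J (P : SparseProblem d m Θ F) (ν : FiniteMeasure Θ) : ℝ :=
  P.R (P.feat ν) + P.lam * (ν.mass : ℝ)

/-- `J⋆`, the infimum of `J` over the finite nonnegative measures. -/
def Jstar (P : SparseProblem d m Θ F) : ℝ := ⨅ ν : FiniteMeasure Θ, P.J ν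

/-- `ν⋆ = ∑ i, (r i)² δ_{θ i}`. -/
def νstar (P : SparseProblem d m Θ F) : FiniteMeasure Θ :=
  ∑ i, (P.r i ^ 2).toNNReal • (diracProba (P.θ i)).toFiniteMeasure

/-- `f⋆ = ∫ φ dν⋆`. -/
def fstar (P : SparseProblem d m Θ F) : F := P.feat P.νstar

/-- The first variation `J'_ν(θ) = ⟪φ(θ), ∇R(f_ν)⟫ + λ`. -/
def J' [CompleteSpace F] (P : SparseProblem d m Θ F) (ν : FiniteMeasure Θ) (p : Θ) : ℝ :=
  ⟪P.φ p, gradient P.R (P.feat ν)⟫ + P.lam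

/-- The quadratic form `⟨v, w⟩_{d²R_{f⋆}}` of the Hessian of `R` at `f⋆`. -/
def hessR (P : SparseProblem d m Θ F) (v w : F) : ℝ :=
  fderiv ℝ (fderiv ℝ P.R) P.fstar v w

/-- The components of `∇̄ φ(θ i) = (2α φ(θ i), β ∇φ(θ i))`, the gradient being read in the
coordinates `x i`; the index `0` is the one of the mass coordinate. -/
def gradBar (P : SparseProblem d m Θ F) (i : Fin m) : Fin (d + 1) → F :=
  Fin.cons ((2 * P.α) • P.φ (P.θ i)) fun j =>
    P.β • fderiv ℝ (P.φ ∘ (P.x i).symm) 0 (EuclideanSpace.single j 1)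

/-- The global kernel `K`. -/
def K (P : SparseProblem d m Θ F) : Matrix (Fin m × Fin (d + 1)) (Fin m × Fin (d + 1)) ℝ :=
  Matrix.of fun a b => P.hessR (P.r a.1 • P.gradBar a.1 a.2) (P.r b.1 • P.gradBar b.1 b.2)

/-- The local kernels `H i = β² ∇² J'_{ν⋆}(θ i)`, in the coordinates `x i`. -/
def Hloc [CompleteSpace F] (P : SparseProblem d m Θ F) (i : Fin m) :
    Matrix (Fin d) (Fin d) ℝ :=
  Matrix.of fun j k => P.β ^ 2 *
    fderiv ℝ (fderiv ℝ (P.J' P.νstar ∘ (P.x i).symm)) 0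
      (EuclideanSpace.single j 1) (EuclideanSpace.single k 1)

/-- The block-diagonal matrix `H` that gathers the local kernels, with value `0` at all the indices
of mass coordinates. -/
def H [CompleteSpace F] (P : SparseProblem d m Θ F) :
    Matrix (Fin m × Fin (d + 1)) (Fin m × Fin (d + 1)) ℝ :=
  Matrix.of fun a b =>
    if a.1 = b.1 then
      (Fin.cons 0 fun j => (Fin.cons 0 fun k => P.Hloc a.1 j k : Fin (d + 1) → ℝ) b.2 :
        Fin (d + 1) → ℝ) a.2
    else 0

/-- The diagonal matrix of the conic metric in the coordinates of `b`: `1/α` on the mass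
coordinates and `1/β` on the spatial coordinates. -/
def metricMat (P : SparseProblem d m Θ F) :
    Matrix (Fin m × Fin (d + 1)) (Fin m × Fin (d + 1)) ℝ :=
  Matrix.diagonal fun a => if a.2 = 0 then P.α⁻¹ else P.β⁻¹

/-- `Θ_i`, the open ball of radius `τ` around `θ i`. -/
def cell (P : SparseProblem d m Θ F) (τ : ℝ) (i : Fin m) : Set Θ :=
  Metric.eball (P.θ i) (ENNReal.ofReal τ)

/-- `Θ_0`, the complement of the balls. -/
def cell₀ (P : SparseProblem d m Θ F) (τ : ℝ) : Set Θ := (⋃ i, P.cell τ i)ᶜ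

/-- Admissible radii: positive, smaller than one, smaller than the radii of the normal coordinate
systems, and such that the sets `Θ_i` are pairwise disjoint. -/
def Admissible (P : SparseProblem d m Θ F) (τ : ℝ) : Prop :=
  0 < τ ∧ τ < 1 ∧ (∀ i, τ < P.ρ i) ∧ Pairwise fun i j => Disjoint (P.cell τ i) (P.cell τ j)

/-- The local mass `r̄_i² = ν(Θ_i)`. -/
def locMass (P : SparseProblem d m Θ F) (τ : ℝ) (ν : FiniteMeasure Θ) (i : Fin m) : ℝ :=
  ((ν (P.cell τ i) : ℝ≥0) : ℝ)

/-- The local mean, in the coordinates `x i`, in which `θ i` is the origin: the vector is thus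
`θ̄_i - θ_i`. It is `0`, i.e. `θ̄_i = θ_i`, if `ν(Θ_i) = 0`. -/
def locMean (P : SparseProblem d m Θ F) (τ : ℝ) (ν : FiniteMeasure Θ) (i : Fin m) : Eucl d :=
  (P.locMass τ ν i)⁻¹ • ∫ p in P.cell τ i, P.x i p ∂(ν : Measure Θ)

/-- The weighted biases `b = (b^r, b^θ)`. -/
def bias (P : SparseProblem d m Θ F) (τ : ℝ) (ν : FiniteMeasure Θ) :
    Fin m × Fin (d + 1) → ℝ := fun a =>
  (Fin.cons ((P.locMass τ ν a.1 - P.r a.1 ^ 2) / (2 * P.α * P.r a.1))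
    fun j => P.locMass τ ν a.1 / (P.β * P.r a.1) * P.locMean τ ν a.1 j : Fin (d + 1) → ℝ) a.2

/-- The weighted covariances `Σ_i` (equal to `0` if `ν(Θ_i) = 0`). -/
def locCov (P : SparseProblem d m Θ F) (τ : ℝ) (ν : FiniteMeasure Θ) (i : Fin m) :
    Matrix (Fin d) (Fin d) ℝ :=
  Matrix.of fun j k => (P.locMass τ ν i * P.β ^ 2)⁻¹ *
    ∫ p in P.cell τ i, (P.x i p j - P.locMean τ ν i j) * (P.x i p k - P.locMean τ ν i k)
      ∂(ν : Measure Θ)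

/-- `‖g_ν‖²_{L²(ν|_A)} = ∫_A (4α |J'_ν|² + β ‖∇J'_ν‖²) dν`. -/
def gradSq [CompleteSpace F] [ChartedSpace (Eucl d) Θ] [IsManifold 𝓘(ℝ, Eucl d) ∞ Θ]
    [RiemannianBundle (fun p : Θ => TangentSpace 𝓘(ℝ, Eucl d) p)]
    (P : SparseProblem d m Θ F) (ν : FiniteMeasure Θ) (A : Set Θ) : ℝ :=
  ∫ p in A, (4 * P.α * P.J' ν p ^ 2 + P.β * ‖riemGrad d (P.J' ν) p‖ ^ 2) ∂(ν : Measure Θ)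

/-- Regularity of `φ` and `R`, nonnegativity of `R`, and boundedness of `∇R` on the sublevel sets
of `R`. -/
structure A1 [CompleteSpace F] [ChartedSpace (Eucl d) Θ] (P : SparseProblem d m Θ F) : Prop where
  φ_reg : IsC21Manifold d P.φ
  R_reg : IsC21On P.R Set.univ
  R_nonneg : ∀ f, 0 ≤ P.R f
  gradR_bdd : ∀ c : ℝ, ∃ B : ℝ, ∀ f, P.R f ≤ c → ‖gradient P.R f‖ ≤ B

/-- The parameters of the conic metric are positive. -/
structure A2 (P : SparseProblem d m Θ F) : Prop where
  α_pos : 0 < P.α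
  β_pos : 0 < P.β

/-- The loss is convex. -/
def A3 (P : SparseProblem d m Θ F) : Prop := ConvexOn ℝ Set.univ P.R

/-- `ν⋆` is nonzero and is the unique global minimizer of `J`, with positive weights and distinct
positions. -/
structure A4 (P : SparseProblem d m Θ F) : Prop where
  isMin : ∀ ν, P.J P.νstar ≤ P.J ν
  unique : ∀ ν, P.J ν = P.J P.νstar → ν = P.νstar
  mass_pos : 0 < P.νstar.mass
  r_pos : ∀ i, 0 < P.r i
  θ_inj : Function.Injective P.θ

/-- Non-degeneracy of `ν⋆`: positive definiteness of `∇²R(f⋆)`, global curvature, local curvature,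
and strict slackness. -/
structure A5 [CompleteSpace F] (P : SparseProblem d m Θ F) : Prop where
  hessR_pos : ∀ v, v ≠ 0 → 0 < P.hessR v v
  K_pos : SigmaMinPos P.K
  H_pos : ∀ i, SigmaMinPos (P.Hloc i)
  slack : ∀ p, P.J' P.νstar p = 0 → ∃ i, p = P.θ i

end SparseProblem

end

/-!
# Local expansion of the objective and of its gradient norm around a sparse minimizer

Write `Δ = J(ν) - J⋆`, let `D(h) = R(f⋆ + h) - R(f⋆) - dR(f⋆) h` be the Bregman divergence of the
loss at `f⋆`, and `h = f_ν - f⋆`. As `J'_{ν⋆}` is nonnegative and vanishes at the atoms,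
`Δ = D(h) + ∫ J'_{ν⋆} dν` (`SparseProblem.gap_eq`), a sum of two nonnegative terms.

The first variation `J'_{ν⋆}` grows quadratically around the atoms and is bounded from below by a
multiple of `τ²` on `Θ_0`, uniformly in the admissible radius (`SparseProblem.exists_coercivity`).
Hence the second moments of `ν` around the atoms are `O(Δ)`, and `ν(Θ_0) = O(Δ / τ²)`. The Taylor
expansion of `φ` on the cells then gives `h = L b + O(Δ / τ²)`, where `L` is the linear map with
`⟨b, K b⟩ = d²R(f⋆)(L b, L b)` (`SparseProblem.isBigO_rem`).

Where `Δ > τ⁴`, the error `Δ^{3/2} τ⁻⁶` is at least one and it is enough that all the terms are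
bounded. Where `Δ ≤ τ⁴`, one has `Δ / τ² ≤ √Δ`, and the bound `D(h) ≤ Δ` together with the
nondegeneracy of `K` gives `b = O(√Δ)`. The Taylor expansion of `D` is valid only close to the
origin, but the convexity inequality `D(t h) ≤ t D(h)` brings any `h` there
(`exists_le_mul_of_bregman_le`, `SparseProblem.isBigO_bias`). It follows that `h`, the variation of
`dR` and the errors on the local masses are `O(√Δ)`, and that the local covariances are `O(Δ)`. In
the expansions of `D`, of `J'_{ν⋆}` and of the density of `‖g_ν‖²` on each cell
(`SparseProblem.exists_cell_expansion`, `SparseProblem.exists_gradDensity_sub_le`), every discarded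
term is then either `O(τ Δ)`, or the product of an `O(√Δ)` and an `O(Δ / τ²)`.

The bounds hold uniformly over the pairs `(τ, ν)`, and are written as `=O[𝓟 S]` for sets `S` of
pairs, so that the constants need not be tracked.
-/

section LocalExpansion

open Filter Topology Asymptotics

set_option linter.unusedSectionVars false

/-! ### Maps with quadratic remainders and Taylor estimates -/

section Taylor

variable {E G G' G'' : Type*} [NormedAddCommGroup E] [NormedSpace ℝ E]
  [NormedAddCommGroup G] [NormedSpace ℝ G] [NormedAddCommGroup G'] [NormedSpace ℝ G']
  [NormedAddCommGroup G''] [NormedSpace ℝ G'']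

/-- `f` agrees at `x` with the affine map of linear part `f'` up to a quadratic error. -/
def QuadApproxAt (f : E → G) (f' : E →L[ℝ] G) (x : E) : Prop :=
  (fun y => f y - f x - f' (y - x)) =O[𝓝 x] fun y => ‖y - x‖ ^ 2

/-- The mean value inequality for a derivative of order `n` at `x`. -/
lemma isBigO_sub_of_hasFDerivAt {g : E → G} {g' : E → E →L[ℝ] G} {x : E} {n : ℕ}
    (hg : ∀ᶠ y in 𝓝 x, HasFDerivAt g (g' y) y)
    (hO : g' =O[𝓝 x] fun y => ‖y - x‖ ^ n) :
    (fun y => g y - g x) =O[𝓝 x] fun y => ‖y - x‖ ^ (n + 1) := by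
  obtain ⟨C, hC⟩ := hO.bound
  obtain ⟨ε, hε, hball⟩ := Metric.eventually_nhds_iff_ball.1 (hg.and hC)
  refine IsBigO.of_bound C ?_
  filter_upwards [Metric.ball_mem_nhds x hε] with y hy
  have key : ‖g y - g x‖ ≤ (C * ‖y - x‖ ^ n) * ‖y - x‖ := by
    have hsub : ∀ z ∈ Metric.closedBall x ‖y - x‖, z ∈ Metric.ball x ε := fun z hz =>
      lt_of_le_of_lt (Metric.mem_closedBall.1 hz) (by rwa [← dist_eq_norm])
    refine Convex.norm_image_sub_le_of_norm_hasFDerivWithin_le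
      (s := Metric.closedBall x ‖y - x‖) (f' := g')
      (fun z hz => (hball z (hsub z hz)).1.hasFDerivWithinAt) (fun z hz => ?_)
      (convex_closedBall _ _) (Metric.mem_closedBall_self (norm_nonneg _))
      (by rw [Metric.mem_closedBall, dist_eq_norm])
    have h1 := (hball z (hsub z hz)).2
    have h2 : ‖z - x‖ ≤ ‖y - x‖ := by rw [← dist_eq_norm]; exact hz
    rw [norm_pow, norm_norm] at h1
    have hC0 : 0 ≤ C ∨ ‖z - x‖ ^ n = 0 := by
      by_contra! hcon
      have : 0 < ‖z - x‖ ^ n := lt_of_le_of_ne (by positivity) (Ne.symm hcon.2)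
      nlinarith [norm_nonneg (g' z)]
    have hC1 : 0 ≤ C * ‖y - x‖ ^ n := by
      have h3 := (hball y hy).2
      rw [norm_pow, norm_norm] at h3
      exact (norm_nonneg _).trans h3
    rcases hC0 with h | h
    · exact h1.trans (mul_le_mul_of_nonneg_left (pow_le_pow_left₀ (norm_nonneg _) h2 n) h)
    · rw [h, mul_zero] at h1
      exact h1.trans hC1
  rw [norm_pow, norm_norm]
  calc _ ≤ _ := key
    _ = _ := by ring

namespace QuadApproxAt

lemma hasFDerivAt {f : E → G} {f' : E →L[ℝ] G} {x : E} (h : QuadApproxAt f f' x) :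
    HasFDerivAt f f' x := by
  rw [hasFDerivAt_iff_isLittleO]
  exact h.trans_isLittleO (isLittleO_pow_sub_sub x one_lt_two)

lemma isBigO_sub {f : E → G} {f' : E →L[ℝ] G} {x : E} (h : QuadApproxAt f f' x) :
    (fun y => f y - f x) =O[𝓝 x] fun y => ‖y - x‖ :=
  h.hasFDerivAt.isBigO_sub.norm_right

lemma congr {f g : E → G} {f' : E →L[ℝ] G} {x : E} (h : QuadApproxAt f f' x)
    (hfg : f =ᶠ[𝓝 x] g) : QuadApproxAt g f' x := by
  refine IsBigO.congr' h ?_ EventuallyEq.rfl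
  filter_upwards [hfg] with y hy
  rw [hy, hfg.eq_of_nhds]

/-- A map whose derivative is Lipschitz at `x` has a quadratic remainder. -/
lemma of_fderiv {f : E → G} {x : E} (hf : ∀ᶠ y in 𝓝 x, DifferentiableAt ℝ f y)
    (hO : (fun y => fderiv ℝ f y - fderiv ℝ f x) =O[𝓝 x] fun y => ‖y - x‖) :
    QuadApproxAt f (fderiv ℝ f x) x := by
  have := isBigO_sub_of_hasFDerivAt (g := fun y => f y - fderiv ℝ f x y)
    (g' := fun y => fderiv ℝ f y - fderiv ℝ f x) (n := 1)
    (hf.mono fun y hy => hy.hasFDerivAt.sub (fderiv ℝ f x).hasFDerivAt) (by simpa using hO)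
  refine this.congr_left fun y => ?_
  simp only [map_sub]
  abel

lemma of_contDiffAt {f : E → G} {x : E} (hf : ContDiffAt ℝ 2 f x) :
    QuadApproxAt f (fderiv ℝ f x) x := by
  refine of_fderiv ?_ ?_
  · exact (hf.eventually (by simp)).mono fun y hy => hy.differentiableAt (by norm_num)
  · exact ((hf.fderiv_right (m := 1) (by norm_num)).differentiableAt
      (by norm_num)).isBigO_sub.norm_right

lemma comp {f : G → G'} {f' : G →L[ℝ] G'} {k : E → G} {k' : E →L[ℝ] G} {x : E}
    (hf : QuadApproxAt f f' (k x)) (hk : QuadApproxAt k k' x) :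
    QuadApproxAt (f ∘ k) (f'.comp k') x := by
  have h1 : (fun y => f (k y) - f (k x) - f' (k y - k x)) =O[𝓝 x] fun y => ‖y - x‖ ^ 2 :=
    (hf.comp_tendsto hk.hasFDerivAt.continuousAt).trans (by
      simpa [Function.comp_def] using (hk.isBigO_sub.norm_left.pow 2))
  have h2 : (fun y => f' (k y - k x - k' (y - x))) =O[𝓝 x] fun y => ‖y - x‖ ^ 2 :=
    (f'.isBigO_comp _ _).trans hk
  refine (h1.add h2).congr_left fun y => ?_
  simp [map_sub]

lemma bilin (B : G →L[ℝ] G' →L[ℝ] G'') {f : E → G} {f' : E →L[ℝ] G} {g : E → G'}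
    {g' : E →L[ℝ] G'} {x : E} (hf : QuadApproxAt f f' x) (hg : QuadApproxAt g g' x) :
    QuadApproxAt (fun y => B (f y) (g y)) ((B (f x)).comp g' + (B.flip (g x)).comp f') x := by
  have h1 : (fun y => B (f y - f x) (g y - g x)) =O[𝓝 x] fun y => ‖y - x‖ ^ 2 := by
    refine (IsBigO.of_bound ‖B‖ (Eventually.of_forall fun y => ?_) :
      _ =O[𝓝 x] fun y => ‖f y - f x‖ * ‖g y - g x‖).trans ?_
    · rw [norm_mul, norm_norm, norm_norm, ← mul_assoc]
      exact B.le_opNorm₂ _ _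
    · simpa [sq] using hf.isBigO_sub.norm_left.mul hg.isBigO_sub.norm_left
  have h2 : (fun y => B (f x) (g y - g x - g' (y - x))) =O[𝓝 x] fun y => ‖y - x‖ ^ 2 :=
    ((B (f x)).isBigO_comp _ _).trans hg
  have h3 : (fun y => B.flip (g x) (f y - f x - f' (y - x))) =O[𝓝 x] fun y => ‖y - x‖ ^ 2 :=
    ((B.flip (g x)).isBigO_comp _ _).trans hf
  refine ((h1.add h2).add h3).congr_left fun y => ?_
  simp [map_sub]
  abel

end QuadApproxAt

set_option synthInstance.maxHeartbeats 200000 in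
lemma IsC21On.isBigO_fderiv_fderiv_sub {f : E → G} {U : Set E} (hf : IsC21On f U)
    (hU : IsOpen U) {x : E} (hx : x ∈ U) :
    (fun y => fderiv ℝ (fderiv ℝ f) y - fderiv ℝ (fderiv ℝ f) x) =O[𝓝 x] fun y => ‖y - x‖ := by
  obtain ⟨C, t, ht, hL⟩ := hf.2 hx
  rw [hU.nhdsWithin_eq hx] at ht
  refine IsBigO.of_bound C ?_
  filter_upwards [ht] with y hy
  have h := hL.dist_le_mul y hy x (mem_of_mem_nhds ht)
  rw [dist_eq_norm y x] at h
  rw [norm_norm]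
  exact (dist_eq_norm _ _).symm.trans_le h

lemma IsC21On.contDiffAt {f : E → G} {U : Set E} (hf : IsC21On f U)
    (hU : IsOpen U) {x : E} (hx : x ∈ U) : ContDiffAt ℝ 2 f x :=
  hf.1.contDiffAt (hU.mem_nhds hx)

lemma IsC21On.quadApproxAt_fderiv {f : E → G} {U : Set E} (hf : IsC21On f U)
    (hU : IsOpen U) {x : E} (hx : x ∈ U) :
    QuadApproxAt (fderiv ℝ f) (fderiv ℝ (fderiv ℝ f) x) x := by
  refine QuadApproxAt.of_fderiv ?_ (hf.isBigO_fderiv_fderiv_sub hU hx)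
  filter_upwards [hU.mem_nhds hx] with y hy
  exact ((hf.contDiffAt hU hy).fderiv_right (m := 1) (by norm_num)).differentiableAt
    (by norm_num)

/-- The class `C^{2,1}` is stable under a smooth change of variables. -/
lemma IsC21On.quadApproxAt_fderiv_comp {f : G → G'} {U : Set G} (hf : IsC21On f U)
    (hU : IsOpen U) {k : E → G} {x : E} (hk : ContDiffAt ℝ 3 k x) (hx : k x ∈ U) :
    QuadApproxAt (fderiv ℝ (f ∘ k)) (fderiv ℝ (fderiv ℝ (f ∘ k)) x) x := by
  have h1 := (hf.quadApproxAt_fderiv hU hx).comp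
    (QuadApproxAt.of_contDiffAt (hk.of_le (by norm_num)))
  have h2 := QuadApproxAt.of_contDiffAt (hk.fderiv_right (m := 2) (by norm_num))
  have h3 := QuadApproxAt.bilin (ContinuousLinearMap.compL ℝ E G G') h1 h2
  have h4 : (fun y => ContinuousLinearMap.compL ℝ E G G' ((fderiv ℝ f ∘ k) y) (fderiv ℝ k y))
      =ᶠ[𝓝 x] fderiv ℝ (f ∘ k) := by
    filter_upwards [hk.eventually (by simp),
      hk.continuousAt.preimage_mem_nhds (hU.mem_nhds hx)] with y hy hyU
    rw [fderiv_comp y ((hf.contDiffAt hU hyU).differentiableAt (by norm_num))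
      (hy.differentiableAt (by norm_num))]
    rfl
  have h5 := h3.congr h4
  rwa [h5.hasFDerivAt.fderiv]

set_option synthInstance.maxHeartbeats 200000 in
/-- Third order Taylor estimate for a map whose second derivative is Lipschitz at `x`. -/
lemma isBigO_taylor_two {f : E → G} {x : E} (hf : ContDiffAt ℝ 2 f x)
    (h : QuadApproxAt (fderiv ℝ f) (fderiv ℝ (fderiv ℝ f) x) x) :
    (fun y => f y - f x - fderiv ℝ f x (y - x)
      - (1 / 2 : ℝ) • fderiv ℝ (fderiv ℝ f) x (y - x) (y - x)) =O[𝓝 x] fun y => ‖y - x‖ ^ 3 := by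
  set B := fderiv ℝ (fderiv ℝ f) x
  have hsymm : ∀ v w, B v w = B w v := fun v w =>
    (hf.isSymmSndFDerivAt (by simp)).eq v w
  have hB : ∀ y, HasFDerivAt (fun y => (1 / 2 : ℝ) • B (y - x) (y - x)) (B (y - x)) y := by
    intro y
    have h0 : HasFDerivAt (fun y : E => y - x) (ContinuousLinearMap.id ℝ E) y :=
      (hasFDerivAt_id y).sub_const x
    have h1 := (B.hasFDerivAt_of_bilinear h0 h0).const_smul (1 / 2 : ℝ)
    refine h1.congr_fderiv ?_
    ext v
    simp only [ContinuousLinearMap.precompR, ContinuousLinearMap.precompL, one_div, smul_add,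
      add_apply, FunLike.coe_smul, Pi.smul_apply,
      ContinuousLinearMap.compL_apply, ContinuousLinearMap.comp_id, ContinuousLinearMap.flip_apply,
      ContinuousLinearMap.comp_apply, hsymm v (y - x)]
    rw [← add_smul]
    norm_num
  have := isBigO_sub_of_hasFDerivAt (n := 2)
    (g := fun y => f y - fderiv ℝ f x y - (1 / 2 : ℝ) • B (y - x) (y - x))
    (g' := fun y => fderiv ℝ f y - fderiv ℝ f x - B (y - x))
    ((hf.eventually (by simp)).mono fun y hy =>
      ((hy.differentiableAt (by norm_num)).hasFDerivAt.sub (fderiv ℝ f x).hasFDerivAt).sub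
        (hB y)) h
  refine this.congr_left fun y => ?_
  have h0 : B (x - x) (x - x) = 0 := by simp
  rw [h0, smul_zero, map_sub (fderiv ℝ f x)]
  abel

end Taylor

/-! ### The Riemannian gradient in coordinates -/

section Geometry

variable {d : ℕ} {Θ : Type*} [EMetricSpace Θ] [ChartedSpace (Eucl d) Θ]

/-- A smooth system of coordinates on an open subset of a manifold. -/
structure IsSmoothChart (e : OpenPartialHomeomorph Θ (Eucl d)) : Prop where
  smooth : ContMDiffOn 𝓘(ℝ, Eucl d) 𝓘(ℝ, Eucl d) ∞ e e.source
  smooth_symm : ContMDiffOn 𝓘(ℝ, Eucl d) 𝓘(ℝ, Eucl d) ∞ e.symm e.target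

lemma isSmoothChart_chartAt [IsManifold 𝓘(ℝ, Eucl d) ∞ Θ] (p : Θ) :
    IsSmoothChart (chartAt (Eucl d) p) :=
  ⟨contMDiffOn_chart, contMDiffOn_chart_symm⟩

namespace IsSmoothChart

variable {e : OpenPartialHomeomorph Θ (Eucl d)}

lemma mdifferentiable (he : IsSmoothChart e) :
    e.MDifferentiable 𝓘(ℝ, Eucl d) 𝓘(ℝ, Eucl d) :=
  ⟨he.smooth.mdifferentiableOn (by simp), he.smooth_symm.mdifferentiableOn (by simp)⟩

lemma contMDiffAt_symm (he : IsSmoothChart e) {y : Eucl d} (hy : y ∈ e.target) :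
    ContMDiffAt 𝓘(ℝ, Eucl d) 𝓘(ℝ, Eucl d) ∞ e.symm y :=
  he.smooth_symm.contMDiffAt (e.open_target.mem_nhds hy)

/-- The differential at `y` of the inverse of a coordinate system, as an isomorphism between the
coordinate space and the tangent space. -/
noncomputable def frame (he : IsSmoothChart e) {y : Eucl d} (hy : y ∈ e.target) :
    TangentSpace 𝓘(ℝ, Eucl d) y ≃L[ℝ] TangentSpace 𝓘(ℝ, Eucl d) (e.symm y) :=
  he.mdifferentiable.symm.mfderiv hy

lemma frame_apply (he : IsSmoothChart e) {y : Eucl d} (hy : y ∈ e.target) (w : Eucl d) :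
    he.frame hy w = mfderiv 𝓘(ℝ, Eucl d) 𝓘(ℝ, Eucl d) e.symm y w := rfl

lemma exists_frame_eq (he : IsSmoothChart e) {y : Eucl d} (hy : y ∈ e.target)
    (v : TangentSpace 𝓘(ℝ, Eucl d) (e.symm y)) : ∃ w : Eucl d, he.frame hy w = v :=
  (he.frame hy).surjective v

lemma riemDiff_frame (he : IsSmoothChart e) {y : Eucl d} (hy : y ∈ e.target) {f : Θ → ℝ}
    (hf : MDifferentiableAt 𝓘(ℝ, Eucl d) 𝓘(ℝ, ℝ) f (e.symm y)) (w : Eucl d) :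
    riemDiff d f (e.symm y) (he.frame hy w) = fderiv ℝ (f ∘ e.symm) y w := by
  have h := mfderiv_comp y hf ((he.contMDiffAt_symm hy).mdifferentiableAt (by simp))
  rw [mfderiv_eq_fderiv] at h
  rw [h]
  rfl

variable [IsManifold 𝓘(ℝ, Eucl d) ∞ Θ]
  [RiemannianBundle (fun p : Θ => TangentSpace 𝓘(ℝ, Eucl d) p)]

/-- The coefficients of the Riemannian metric in a coordinate system are differentiable. -/
lemma differentiableAt_inner_frame [IsContMDiffRiemannianBundle 𝓘(ℝ, Eucl d) ∞ (Eucl d)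
      (fun p : Θ => TangentSpace 𝓘(ℝ, Eucl d) p)]
    (he : IsSmoothChart e) {y : Eucl d} (hy : y ∈ e.target)
    (v w : Eucl d) :
    DifferentiableAt ℝ (fun z =>
      (⟪(mfderiv 𝓘(ℝ, Eucl d) 𝓘(ℝ, Eucl d) e.symm z v : TangentSpace 𝓘(ℝ, Eucl d) (e.symm z)),
        (mfderiv 𝓘(ℝ, Eucl d) 𝓘(ℝ, Eucl d) e.symm z w : TangentSpace 𝓘(ℝ, Eucl d) (e.symm z))⟫
        : ℝ)) y := by
  have key : ∀ v : Eucl d, ContMDiffAt 𝓘(ℝ, Eucl d) (𝓘(ℝ, Eucl d).prod 𝓘(ℝ, Eucl d)) 1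
      (fun z => (⟨e.symm z, mfderiv 𝓘(ℝ, Eucl d) 𝓘(ℝ, Eucl d) e.symm z v⟩ :
        TangentBundle 𝓘(ℝ, Eucl d) Θ)) y := by
    intro v
    have h1 := (he.contMDiffAt_symm hy).mfderiv_const (m := 1)
      (by norm_num; exact ENat.LEInfty.out)
    have h2 : ContMDiffAt 𝓘(ℝ, Eucl d) (𝓘(ℝ, Eucl d).prod 𝓘(ℝ, Eucl d)) 1
        (fun z : Eucl d => (⟨z, v⟩ : TangentBundle 𝓘(ℝ, Eucl d) (Eucl d))) y := by
      rw [contMDiffAt_totalSpace]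
      refine ⟨contMDiffAt_id, ?_⟩
      simpa using contMDiffAt_const
    exact ContMDiffWithinAt.clm_apply_of_inCoordinates h1 h2
      ((he.contMDiffAt_symm hy).of_le (by norm_num))
  have : IsContMDiffRiemannianBundle 𝓘(ℝ, Eucl d) 1 (Eucl d)
      (fun p : Θ => TangentSpace 𝓘(ℝ, Eucl d) p) :=
    IsContMDiffRiemannianBundle.of_le (n := ∞) (by exact_mod_cast le_top)
  have h := ContMDiffAt.inner_bundle (E := fun p : Θ => TangentSpace 𝓘(ℝ, Eucl d) p) (n := 1)
    (key v) (key w)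
  exact (h.mdifferentiableAt (by norm_num)).differentiableAt

end IsSmoothChart

variable [IsManifold 𝓘(ℝ, Eucl d) ∞ Θ]
  [RiemannianBundle (fun p : Θ => TangentSpace 𝓘(ℝ, Eucl d) p)]

lemma norm_riemGrad (f : Θ → ℝ) (p : Θ) : ‖riemGrad d f p‖ = ‖riemDiff d f p‖ :=
  (InnerProductSpace.toDual ℝ (TangentSpace 𝓘(ℝ, Eucl d) p)).symm.norm_map _

lemma inner_riemGrad (f : Θ → ℝ) (p : Θ) (v : TangentSpace 𝓘(ℝ, Eucl d) p) :
    ⟪riemGrad d f p, v⟫ = riemDiff d f p v :=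
  InnerProductSpace.toDual_symm_apply

/-- The variational lower bound of the gradient norm, with equality when `v` is the gradient. -/
lemma sq_norm_riemGrad_ge (f : Θ → ℝ) (p : Θ) (v : TangentSpace 𝓘(ℝ, Eucl d) p) :
    2 * riemDiff d f p v - ⟪v, v⟫ ≤ ‖riemGrad d f p‖ ^ 2 := by
  have h := real_inner_self_nonneg (x := riemGrad d f p - v)
  rw [inner_sub_left, inner_sub_right, inner_sub_right, real_inner_comm (riemGrad d f p) v,
    real_inner_self_eq_norm_sq (riemGrad d f p), inner_riemGrad] at h
  linarith

/-- The norm of the gradient is a supremum of continuous functions, so it is lower semicontinuous,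
hence measurable. -/
lemma lowerSemicontinuous_sq_norm_riemGrad [IsContMDiffRiemannianBundle 𝓘(ℝ, Eucl d) ∞ (Eucl d)
      (fun p : Θ => TangentSpace 𝓘(ℝ, Eucl d) p)]
    {f : Θ → ℝ} (hf : ContMDiff 𝓘(ℝ, Eucl d) 𝓘(ℝ, ℝ) 1 f) :
    LowerSemicontinuous fun p => ‖riemGrad d f p‖ ^ 2 := by
  intro p₀ c hc
  obtain ⟨e, hsm, hp₀⟩ : ∃ e : OpenPartialHomeomorph Θ (Eucl d), IsSmoothChart e ∧ p₀ ∈ e.source :=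
    ⟨chartAt (Eucl d) p₀, isSmoothChart_chartAt p₀, mem_chart_source _ p₀⟩
  obtain ⟨y₀, hy₀, rfl⟩ : ∃ y₀ ∈ e.target, e.symm y₀ = p₀ :=
    ⟨e p₀, e.map_source hp₀, e.left_inv hp₀⟩
  obtain ⟨w, hw⟩ := hsm.exists_frame_eq hy₀ (riemGrad d f (e.symm y₀))
  let Fn : Eucl d → ℝ := fun y => 2 * fderiv ℝ (f ∘ e.symm) y w -
    ⟪(mfderiv 𝓘(ℝ, Eucl d) 𝓘(ℝ, Eucl d) e.symm y w : TangentSpace 𝓘(ℝ, Eucl d) (e.symm y)),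
      (mfderiv 𝓘(ℝ, Eucl d) 𝓘(ℝ, Eucl d) e.symm y w : TangentSpace 𝓘(ℝ, Eucl d) (e.symm y))⟫
  have hfe : ContDiffAt ℝ 1 (f ∘ e.symm) y₀ := by
    have := (hf.contMDiffAt (x := e.symm y₀)).comp y₀
      ((hsm.contMDiffAt_symm hy₀).of_le (by exact_mod_cast le_top))
    exact this.contDiffAt
  have hcont : ContinuousAt Fn y₀ := by
    refine ContinuousAt.sub (continuousAt_const.mul ?_)
      (hsm.differentiableAt_inner_frame hy₀ w w).continuousAt
    exact ((hfe.fderiv_right (m := 0) (by norm_num)).continuousAt).clm_apply continuousAt_const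
  have hle : ∀ y ∈ e.target, Fn y ≤ ‖riemGrad d f (e.symm y)‖ ^ 2 := by
    intro y hy
    have h := sq_norm_riemGrad_ge f (e.symm y) (hsm.frame hy w)
    rwa [hsm.riemDiff_frame hy (hf.mdifferentiableAt (by norm_num))] at h
  have heq : Fn y₀ = ‖riemGrad d f (e.symm y₀)‖ ^ 2 := by
    have h1 : Fn y₀ = 2 * riemDiff d f (e.symm y₀) (hsm.frame hy₀ w) -
        ⟪hsm.frame hy₀ w, hsm.frame hy₀ w⟫ := by
      rw [hsm.riemDiff_frame hy₀ (hf.mdifferentiableAt (by norm_num))]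
      rfl
    rw [h1, hw, ← inner_riemGrad, real_inner_self_eq_norm_sq]
    ring
  have hev : ∀ᶠ y in 𝓝 y₀, c < Fn y := hcont.eventually_const_lt (by rw [heq]; exact hc)
  have hce : Tendsto e (𝓝 (e.symm y₀)) (𝓝 y₀) := by
    have := e.continuousAt hp₀
    rwa [ContinuousAt, e.right_inv hy₀] at this
  filter_upwards [hce.eventually hev, e.open_source.mem_nhds hp₀] with p hp hps
  have := hle (e p) (e.map_source hps)
  rw [e.left_inv hps] at this
  exact hp.trans_le this

lemma abs_sq_sub_sq_le_of_ratio {ε N g : ℝ} (hε0 : 0 ≤ ε) (hε : ε ≤ 1 / 2)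
    (h1 : g ^ 2 ≤ (1 + ε) * N ^ 2) (h2 : (1 - ε) * N ^ 2 ≤ g ^ 2) :
    |N ^ 2 - g ^ 2| ≤ 2 * ε * g ^ 2 := by
  rw [abs_le]
  constructor <;> nlinarith [sq_nonneg N, sq_nonneg g, mul_nonneg hε0 (sq_nonneg N),
    mul_nonneg hε0 (sq_nonneg g)]

/-- If the frame of a coordinate system is almost isometric at a point, then the Riemannian norm
of a gradient is close to the Euclidean norm of its expression in coordinates. -/
lemma IsSmoothChart.abs_sq_norm_riemGrad_sub_le {e : OpenPartialHomeomorph Θ (Eucl d)}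
    (he : IsSmoothChart e) {y : Eucl d} (hy : y ∈ e.target) {ε : ℝ} (hε0 : 0 ≤ ε)
    (hε : ε ≤ 1 / 2)
    (hA : ∀ w : Eucl d, |‖he.frame hy w‖ ^ 2 - ‖w‖ ^ 2| ≤ ε * ‖w‖ ^ 2) {f : Θ → ℝ}
    (hf : MDifferentiableAt 𝓘(ℝ, Eucl d) 𝓘(ℝ, ℝ) f (e.symm y)) :
    |‖riemGrad d f (e.symm y)‖ ^ 2 - ‖fderiv ℝ (f ∘ e.symm) y‖ ^ 2|
      ≤ 2 * ε * ‖fderiv ℝ (f ∘ e.symm) y‖ ^ 2 := by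
  set N := ‖riemDiff d f (e.symm y)‖
  set g := ‖fderiv ℝ (f ∘ e.symm) y‖
  have hN : 0 ≤ N := norm_nonneg (riemDiff d f (e.symm y))
  have hg : 0 ≤ g := norm_nonneg _
  rw [norm_riemGrad]
  refine abs_sq_sub_sq_le_of_ratio hε0 hε ?_ ?_
  · have h1 : g ≤ √(1 + ε) * N := by
      refine ContinuousLinearMap.opNorm_le_bound _ (by positivity) fun w => ?_
      have h2 := (riemDiff d f (e.symm y)).le_opNorm (he.frame hy w)
      rw [he.riemDiff_frame hy hf] at h2
      have h3 : ‖he.frame hy w‖ ≤ √(1 + ε) * ‖w‖ := by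
        rw [← Real.sqrt_sq (norm_nonneg w), ← Real.sqrt_mul (by positivity)]
        refine Real.le_sqrt_of_sq_le ?_
        have := (abs_le.1 (hA w)).2
        linarith
      calc _ ≤ N * ‖he.frame hy w‖ := h2
        _ ≤ N * (√(1 + ε) * ‖w‖) := by gcongr
        _ = _ := by ring
    calc g ^ 2 ≤ (√(1 + ε) * N) ^ 2 := by gcongr
      _ = _ := by rw [mul_pow, Real.sq_sqrt (by positivity)]
  · have h1 : N ≤ (√(1 - ε))⁻¹ * g := by
      refine ContinuousLinearMap.opNorm_le_bound _ (by positivity) fun v => ?_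
      obtain ⟨w, rfl⟩ := he.exists_frame_eq hy v
      rw [he.riemDiff_frame hy hf]
      have h2 := (fderiv ℝ (f ∘ e.symm) y).le_opNorm w
      have hpos : 0 < √(1 - ε) := Real.sqrt_pos.2 (by linarith)
      have h3 : √(1 - ε) * ‖(w : Eucl d)‖ ≤ ‖he.frame hy w‖ := by
        rw [← Real.sqrt_sq (norm_nonneg (w : Eucl d)), ← Real.sqrt_mul (by linarith)]
        refine Real.sqrt_le_iff.2 ⟨norm_nonneg _, ?_⟩
        have := (abs_le.1 (hA w)).1
        linarith
      calc _ ≤ g * ‖(w : Eucl d)‖ := h2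
        _ = g * ((√(1 - ε))⁻¹ * (√(1 - ε) * ‖(w : Eucl d)‖)) := by
            rw [inv_mul_cancel_left₀ hpos.ne']
        _ ≤ g * ((√(1 - ε))⁻¹ * ‖he.frame hy w‖) := by gcongr
        _ = _ := by ring
    have h4 : 0 < 1 - ε := by linarith
    calc (1 - ε) * N ^ 2 ≤ (1 - ε) * ((√(1 - ε))⁻¹ * g) ^ 2 := by gcongr
      _ = g ^ 2 := by
        rw [mul_pow, inv_pow, Real.sq_sqrt h4.le, ← mul_assoc, mul_inv_cancel₀ h4.ne', one_mul]

end Geometry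

/-! ### Normal coordinates -/

lemma EuclideanSpace.sum_smul_single {ι : Type*} [Fintype ι] [DecidableEq ι]
    (v : EuclideanSpace ℝ ι) : ∑ j, v j • EuclideanSpace.single j (1 : ℝ) = v := by
  simpa using (EuclideanSpace.basisFun ι ℝ).sum_repr v

lemma exists_bound_of_isBigO_norm_pow {E G : Type*} [NormedAddCommGroup E] [NormedAddCommGroup G]
    {f : E → G} {n : ℕ} {x : E} (h : f =O[𝓝 x] fun y => ‖y - x‖ ^ n) :
    ∃ C, 0 ≤ C ∧ ∃ R, 0 < R ∧ ∀ y, ‖y‖ < R → ‖f (x + y)‖ ≤ C * ‖y‖ ^ n := by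
  obtain ⟨C, hC, hb⟩ := h.exists_nonneg
  obtain ⟨R, hR, hball⟩ := Metric.eventually_nhds_iff_ball.1 hb.bound
  refine ⟨C, hC, R, hR, fun y hy => ?_⟩
  simpa using hball (x + y) (by simpa using hy)

lemma exists_isBigO_bound {E G : Type*} [NormedAddCommGroup E] [NormedAddCommGroup G]
    {f : E → G} {n : ℕ} (h : f =O[𝓝 0] fun y => ‖y - 0‖ ^ n) :
    ∃ C, 0 ≤ C ∧ ∃ R, 0 < R ∧ ∀ y, ‖y‖ < R → ‖f y‖ ≤ C * ‖y‖ ^ n := by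
  simpa using exists_bound_of_isBigO_norm_pow h

section Geometry

variable {d : ℕ} {Θ : Type*} [EMetricSpace Θ] [ChartedSpace (Eucl d) Θ]
  [RiemannianBundle (fun p : Θ => TangentSpace 𝓘(ℝ, Eucl d) p)]

namespace IsNormalChart

variable {p : Θ} {ρ : ℝ} {x : OpenPartialHomeomorph Θ (Eucl d)}

lemma isSmoothChart (hx : IsNormalChart p ρ x) : IsSmoothChart x := ⟨hx.smooth, hx.smooth_symm⟩

lemma zero_mem_target (hx : IsNormalChart p ρ x) : (0 : Eucl d) ∈ x.target := by
  rw [hx.target_eq]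
  exact Metric.mem_ball_self hx.radius_pos

lemma center_mem_source (hx : IsNormalChart p ρ x) : p ∈ x.source := by
  rw [hx.source_eq]
  exact Metric.mem_eball_self (by simpa using hx.radius_pos)

lemma symm_zero (hx : IsNormalChart p ρ x) : x.symm 0 = p := by
  rw [← hx.map_center, x.left_inv hx.center_mem_source]

/-- In normal coordinates, the distance to the centre is the Euclidean norm. -/
lemma edist_eq (hx : IsNormalChart p ρ x) {q : Θ} (hq : q ∈ x.source) :
    edist q p = ENNReal.ofReal ‖x q‖ := by
  have hy := x.map_source hq
  rw [hx.target_eq, mem_ball_zero_iff] at hy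
  by_cases h0 : x q = 0
  · have : q = p := by rw [← x.left_inv hq, h0, hx.symm_zero]
    simp [this, hx.map_center]
  · have hn : ‖x q‖ ≠ 0 := norm_ne_zero_iff.2 h0
    have h := hx.radial_geodesic (‖x q‖⁻¹ • x q) (by rw [norm_smul, norm_inv, norm_norm,
      inv_mul_cancel₀ hn]) ‖x q‖ ⟨norm_nonneg _, hy⟩ 0 ⟨le_rfl, hx.radius_pos⟩
    rwa [smul_inv_smul₀ hn, zero_smul, hx.symm_zero, x.left_inv hq, sub_zero, abs_norm] at h

lemma mem_source_iff_of_lt (hx : IsNormalChart p ρ x) {τ : ℝ} (hτ : τ ≤ ρ) {q : Θ} :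
    q ∈ Metric.eball p (ENNReal.ofReal τ) ↔ q ∈ x.source ∧ ‖x q‖ < τ := by
  constructor
  · intro h
    have hq : q ∈ x.source := by
      rw [hx.source_eq]
      exact Metric.eball_subset_eball (ENNReal.ofReal_le_ofReal hτ) h
    refine ⟨hq, ?_⟩
    rw [Metric.mem_eball, hx.edist_eq hq] at h
    exact (ENNReal.ofReal_lt_ofReal_iff_of_nonneg (norm_nonneg _)).1 h
  · rintro ⟨hq, h⟩
    rw [Metric.mem_eball, hx.edist_eq hq]
    exact (ENNReal.ofReal_lt_ofReal_iff_of_nonneg (norm_nonneg _)).2 h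

/-- The coordinate frame of a normal chart is isometric up to a factor `1 + O(‖y‖)`. -/
lemma exists_abs_sq_norm_frame_sub_le [IsManifold 𝓘(ℝ, Eucl d) ∞ Θ]
    [IsContMDiffRiemannianBundle 𝓘(ℝ, Eucl d) ∞ (Eucl d)
      (fun p : Θ => TangentSpace 𝓘(ℝ, Eucl d) p)] (hx : IsNormalChart p ρ x) :
    ∃ C, 0 ≤ C ∧ ∃ R, 0 < R ∧ ∀ y (hy : y ∈ x.target), ‖y‖ < R → ∀ w : Eucl d,
      |‖hx.isSmoothChart.frame hy w‖ ^ 2 - ‖w‖ ^ 2| ≤ C * ‖y‖ * ‖w‖ ^ 2 := by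
  let G : Fin d → Fin d → Eucl d → ℝ := fun j k z =>
    ⟪(mfderiv 𝓘(ℝ, Eucl d) 𝓘(ℝ, Eucl d) x.symm z (EuclideanSpace.single j 1) :
        TangentSpace 𝓘(ℝ, Eucl d) (x.symm z)),
      (mfderiv 𝓘(ℝ, Eucl d) 𝓘(ℝ, Eucl d) x.symm z (EuclideanSpace.single k 1) :
        TangentSpace 𝓘(ℝ, Eucl d) (x.symm z))⟫
  have hG : ∀ j k, ∃ C, 0 ≤ C ∧ ∃ R, 0 < R ∧ ∀ y, ‖y‖ < R →
      ‖G j k y - G j k 0‖ ≤ C * ‖y‖ ^ 1 := by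
    intro j k
    refine exists_isBigO_bound ?_
    simp only [pow_one]
    exact (hx.isSmoothChart.differentiableAt_inner_frame
      hx.zero_mem_target _ _).isBigO_sub.norm_right
  choose C hC R hR hCR using hG
  have hexp : ∀ y (hy : y ∈ x.target), ∀ w : Eucl d,
      ‖hx.isSmoothChart.frame hy w‖ ^ 2 = ∑ j, ∑ k, w j * w k * G j k y := by
    intro y hy w
    have h1 : hx.isSmoothChart.frame hy w
        = ∑ j, w j • hx.isSmoothChart.frame hy (EuclideanSpace.single j (1 : ℝ)) := by
      conv_lhs => rw [← EuclideanSpace.sum_smul_single w]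
      simp only [IsSmoothChart.frame_apply]
      exact (map_sum _ _ _).trans (Finset.sum_congr rfl fun j _ => map_smul _ _ _)
    rw [← real_inner_self_eq_norm_sq, h1, sum_inner]
    refine Finset.sum_congr rfl fun j _ => ?_
    rw [inner_sum]
    refine Finset.sum_congr rfl fun k _ => ?_
    rw [real_inner_smul_left, real_inner_smul_right, ← mul_assoc]
    rfl
  obtain ⟨R₀, hR₀, hR₀'⟩ : ∃ R₀, 0 < R₀ ∧ ∀ j k, R₀ ≤ R j k := by
    rcases isEmpty_or_nonempty (Fin d × Fin d) with h | h
    · exact ⟨1, one_pos, fun j k => (h.false (j, k)).elim⟩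
    · obtain ⟨a, ha⟩ := Finite.exists_min fun a : Fin d × Fin d => R a.1 a.2
      exact ⟨R a.1 a.2, hR _ _, fun j k => ha (j, k)⟩
  refine ⟨∑ j, ∑ k, C j k, Finset.sum_nonneg fun j _ => Finset.sum_nonneg fun k _ => hC j k,
    R₀, hR₀, fun y hy hyR w => ?_⟩
  have h0 : ‖w‖ ^ 2 = ∑ j, ∑ k, w j * w k * G j k 0 := by
    rw [← hexp 0 hx.zero_mem_target w, IsSmoothChart.frame_apply]
    exact (congrArg (· ^ 2) (hx.isometric_center w)).symm
  rw [hexp y hy w, h0, ← Finset.sum_sub_distrib, ← h0]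
  simp only [← Finset.sum_sub_distrib, ← mul_sub, Finset.sum_mul]
  refine (Finset.abs_sum_le_sum_abs _ _).trans (Finset.sum_le_sum fun j _ =>
    (Finset.abs_sum_le_sum_abs _ _).trans (Finset.sum_le_sum fun k _ => ?_))
  have h1 := hCR j k y (hyR.trans_le (hR₀' j k))
  rw [pow_one, Real.norm_eq_abs] at h1
  have h2 : |w j| ≤ ‖w‖ := by simpa using PiLp.norm_apply_le w j
  have h3 : |w k| ≤ ‖w‖ := by simpa using PiLp.norm_apply_le w k
  rw [abs_mul, abs_mul]
  calc |w j| * |w k| * |G j k y - G j k 0| ≤ ‖w‖ * ‖w‖ * (C j k * ‖y‖) := by gcongr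
    _ = _ := by ring

end IsNormalChart

section Bound

attribute [local instance] normedAddCommGroupTangentSpaceVectorSpace
attribute [local instance] normedSpaceTangentSpaceVectorSpace

/-- Locally, the Riemannian norm dominates the Euclidean norm of the vectors read in a chart.
The Euclidean norm is written out, because the values of `mfderiv` are typed as tangent vectors of
the model space. -/
lemma eventually_norm_mfderiv_chartAt_apply_le [IsManifold 𝓘(ℝ, Eucl d) ∞ Θ]
    [IsContMDiffRiemannianBundle 𝓘(ℝ, Eucl d) ∞ (Eucl d)
      (fun p : Θ => TangentSpace 𝓘(ℝ, Eucl d) p)] (p₀ : Θ) :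
    ∃ C > 0, ∀ᶠ p in 𝓝 p₀, ∀ v : TangentSpace 𝓘(ℝ, Eucl d) p,
      (norm : Eucl d → ℝ)
        (mfderiv 𝓘(ℝ, Eucl d) 𝓘(ℝ, Eucl d) (chartAt (Eucl d) p₀) p v) ≤ C * ‖v‖ := by
  have : IsContinuousRiemannianBundle (Eucl d) (fun p : Θ => TangentSpace 𝓘(ℝ, Eucl d) p) := by
    obtain ⟨g, hg, h⟩ := IsContMDiffRiemannianBundle.exists_contMDiff (IB := 𝓘(ℝ, Eucl d)) (n := ∞)
      (F := Eucl d) (E := fun p : Θ => TangentSpace 𝓘(ℝ, Eucl d) p)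
    exact ⟨g, hg.continuous, h⟩
  obtain ⟨C, hC, h⟩ := eventually_norm_mfderiv_extChartAt_lt 𝓘(ℝ, Eucl d) p₀
  refine ⟨C, hC, h.mono fun p hp v => ?_⟩
  have h1 := (mfderiv 𝓘(ℝ, Eucl d) 𝓘(ℝ, Eucl d) (extChartAt 𝓘(ℝ, Eucl d) p₀) p).le_opNorm v
  have h2 := h1.trans (mul_le_mul_of_nonneg_right hp.le (norm_nonneg v))
  exact h2

end Bound

end Geometry

/-! ### Expansions at the centre of a normal chart -/

lemma le_div_pow_mul_pow {a K R t : ℝ} {n : ℕ} (ha : a ≤ K) (hK : 0 ≤ K) (hR : 0 < R)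
    (ht : R ≤ t) : a ≤ K / R ^ n * t ^ n := by
  have h1 : R ^ n ≤ t ^ n := pow_le_pow_left₀ hR.le ht n
  rw [div_mul_eq_mul_div, le_div_iff₀ (by positivity)]
  nlinarith [pow_pos hR n]

/-- The Euclidean norm of a linear form, computed from its components. -/
lemma sq_norm_clm_eq_sum {d : ℕ} (g : Eucl d →L[ℝ] ℝ) :
    ‖g‖ ^ 2 = ∑ j, g (EuclideanSpace.single j 1) ^ 2 := by
  rw [← (InnerProductSpace.toDual ℝ (Eucl d)).symm.norm_map g, EuclideanSpace.norm_sq_eq]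
  refine Finset.sum_congr rfl fun j _ => ?_
  have h : ⟪(InnerProductSpace.toDual ℝ (Eucl d)).symm g, EuclideanSpace.single j (1 : ℝ)⟫ =
      g (EuclideanSpace.single j 1) := InnerProductSpace.toDual_symm_apply
  rw [← h, EuclideanSpace.inner_single_right]
  simp

lemma abs_sq_norm_sub_sq_norm_le {V : Type*} [SeminormedAddCommGroup V] (a b : V) :
    |‖a‖ ^ 2 - ‖b‖ ^ 2| ≤ ‖a - b‖ * (‖a - b‖ + 2 * ‖b‖) := by
  have h1 : |‖a‖ - ‖b‖| ≤ ‖a - b‖ := abs_norm_sub_norm_le a b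
  have h2 : ‖a‖ + ‖b‖ ≤ ‖a - b‖ + 2 * ‖b‖ := by linarith [(abs_le.1 h1).2]
  have h3 : ‖a‖ ^ 2 - ‖b‖ ^ 2 = (‖a‖ - ‖b‖) * (‖a‖ + ‖b‖) := by ring
  rw [h3, abs_mul, abs_of_nonneg (by positivity : 0 ≤ ‖a‖ + ‖b‖)]
  gcongr

lemma fderiv_clm_comp_add {E M F : Type*} [NormedAddCommGroup E] [NormedSpace ℝ E]
    [TopologicalSpace M] [NormedAddCommGroup F] [NormedSpace ℝ F]
    {φ : M → F} {e : OpenPartialHomeomorph M E} {y : E}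
    (hφ : DifferentiableAt ℝ (φ ∘ e.symm) y) (ℓ : F →L[ℝ] ℝ) (c : ℝ) :
    fderiv ℝ ((fun q => ℓ (φ q) + c) ∘ e.symm) y = ℓ.comp (fderiv ℝ (φ ∘ e.symm) y) :=
  ((ℓ.hasFDerivAt.comp y hφ.hasFDerivAt).add_const c).fderiv

section Geometry

variable {d : ℕ} {Θ : Type*} [EMetricSpace Θ] [ChartedSpace (Eucl d) Θ]
  {F : Type*} [NormedAddCommGroup F] [NormedSpace ℝ F]

lemma IsC21Manifold.contMDiff [IsManifold 𝓘(ℝ, Eucl d) ∞ Θ] {φ : Θ → F} (hφ : IsC21Manifold d φ) :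
    ContMDiff 𝓘(ℝ, Eucl d) 𝓘(ℝ, F) 2 φ := by
  intro p
  set e := chartAt (Eucl d) p
  have hp : p ∈ e.source := mem_chart_source _ p
  have h1 : ContMDiffAt 𝓘(ℝ, Eucl d) 𝓘(ℝ, F) 2 (φ ∘ e.symm) (e p) :=
    ((hφ p).contDiffAt e.open_target (e.map_source hp)).contMDiffAt
  have h2 : ContMDiffAt 𝓘(ℝ, Eucl d) 𝓘(ℝ, Eucl d) 2 e p :=
    ((isSmoothChart_chartAt p).smooth.contMDiffAt (e.open_source.mem_nhds hp)).of_le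
      (by exact_mod_cast ENat.LEInfty.out)
  refine (h1.comp p h2).congr_of_eventuallyEq ?_
  filter_upwards [e.open_source.mem_nhds hp] with q hq
  simp [e.left_inv hq]

lemma IsSmoothChart.contDiffAt_comp_symm {e : OpenPartialHomeomorph Θ (Eucl d)}
    (he : IsSmoothChart e) {φ : Θ → F} (hφ : ContMDiff 𝓘(ℝ, Eucl d) 𝓘(ℝ, F) 2 φ)
    {y : Eucl d} (hy : y ∈ e.target) : ContDiffAt ℝ 2 (φ ∘ e.symm) y :=
  ((hφ.contMDiffAt (x := e.symm y)).comp y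
    ((he.contMDiffAt_symm hy).of_le (by exact_mod_cast ENat.LEInfty.out))).contDiffAt

/-- A `C^{2,1}` map on a manifold is of class `C^{2,1}` in any smooth system of coordinates. -/
lemma IsSmoothChart.quadApproxAt_fderiv_comp_symm [IsManifold 𝓘(ℝ, Eucl d) ∞ Θ]
    {e : OpenPartialHomeomorph Θ (Eucl d)}
    (he : IsSmoothChart e) {φ : Θ → F} (hφ : IsC21Manifold d φ) {y : Eucl d} (hy : y ∈ e.target) :
    QuadApproxAt (fderiv ℝ (φ ∘ e.symm)) (fderiv ℝ (fderiv ℝ (φ ∘ e.symm)) y) y := by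
  set κ := chartAt (Eucl d) (e.symm y)
  have hκ : e.symm y ∈ κ.source := mem_chart_source _ _
  have h1 : ContDiffAt ℝ 3 (κ ∘ e.symm) y := by
    refine ContMDiffAt.contDiffAt ?_
    refine ContMDiffAt.of_le (n := ∞) ?_ (by exact_mod_cast ENat.LEInfty.out)
    exact ((isSmoothChart_chartAt _).smooth.contMDiffAt (κ.open_source.mem_nhds hκ)).comp y
      (he.contMDiffAt_symm hy)
  have h2 := (hφ (e.symm y)).quadApproxAt_fderiv_comp κ.open_target h1 (κ.map_source hκ)
  have h3 : (φ ∘ κ.symm) ∘ (κ ∘ e.symm) =ᶠ[𝓝 y] φ ∘ e.symm := by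
    filter_upwards [(e.continuousAt_symm hy).preimage_mem_nhds (κ.open_source.mem_nhds hκ)]
      with z hz
    simp [κ.left_inv hz]
  have h4 := h3.fderiv (𝕜 := ℝ)
  rw [h4.fderiv_eq] at h2
  exact h2.congr h4

lemma contMDiff_clm_comp_add {φ : Θ → F} (hφ : ContMDiff 𝓘(ℝ, Eucl d) 𝓘(ℝ, F) 2 φ)
    (ℓ : F →L[ℝ] ℝ) (c : ℝ) :
    ContMDiff 𝓘(ℝ, Eucl d) 𝓘(ℝ, ℝ) 2 (fun q => ℓ (φ q) + c) :=
  (by fun_prop : ContDiff ℝ 2 fun v : F => ℓ v + c).contMDiff.comp hφ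

variable [IsManifold 𝓘(ℝ, Eucl d) ∞ Θ]
  [RiemannianBundle (fun p : Θ => TangentSpace 𝓘(ℝ, Eucl d) p)]
  [IsContMDiffRiemannianBundle 𝓘(ℝ, Eucl d) ∞ (Eucl d)
      (fun p : Θ => TangentSpace 𝓘(ℝ, Eucl d) p)]

/-- On a compact manifold the gradient of `ℓ ∘ φ + c` is bounded by a multiple of `‖ℓ‖`. -/
lemma exists_norm_riemGrad_le [CompactSpace Θ] {φ : Θ → F}
    (hφ : ContMDiff 𝓘(ℝ, Eucl d) 𝓘(ℝ, F) 2 φ) :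
    ∃ C, 0 ≤ C ∧ ∀ (ℓ : F →L[ℝ] ℝ) (c : ℝ) (p : Θ),
      ‖riemGrad d (fun q => ℓ (φ q) + c) p‖ ≤ C * ‖ℓ‖ := by
  have key : ∃ C, 0 ≤ C ∧ ∀ p ∈ (Set.univ : Set Θ), ∀ (ℓ : F →L[ℝ] ℝ) (c : ℝ),
      ‖riemGrad d (fun q => ℓ (φ q) + c) p‖ ≤ C * ‖ℓ‖ := by
    refine isCompact_univ.induction_on
      (p := fun s => ∃ C, 0 ≤ C ∧ ∀ p ∈ s, ∀ (ℓ : F →L[ℝ] ℝ) (c : ℝ),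
        ‖riemGrad d (fun q => ℓ (φ q) + c) p‖ ≤ C * ‖ℓ‖) ?_ ?_ ?_ ?_
    · exact ⟨0, le_rfl, by simp⟩
    · rintro s t hst ⟨C, hC, h⟩
      exact ⟨C, hC, fun p hp => h p (hst hp)⟩
    · rintro s t ⟨C, hC, h⟩ ⟨C', hC', h'⟩
      refine ⟨max C C', le_max_of_le_left hC, fun p hp ℓ c => ?_⟩
      rcases hp with hp | hp
      · exact (h p hp ℓ c).trans (by gcongr; exact le_max_left _ _)
      · exact (h' p hp ℓ c).trans (by gcongr; exact le_max_right _ _)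
    · intro p₀ _
      obtain ⟨C, hC, hCe⟩ := eventually_norm_mfderiv_chartAt_apply_le (d := d) p₀
      obtain ⟨e, he, hp₀, hCe⟩ : ∃ e : OpenPartialHomeomorph Θ (Eucl d), IsSmoothChart e ∧
          p₀ ∈ e.source ∧ ∀ᶠ p in 𝓝 p₀, ∀ v : TangentSpace 𝓘(ℝ, Eucl d) p,
          (norm : Eucl d → ℝ) (mfderiv 𝓘(ℝ, Eucl d) 𝓘(ℝ, Eucl d) e p v) ≤ C * ‖v‖ :=
        ⟨_, isSmoothChart_chartAt p₀, mem_chart_source _ p₀, hCe⟩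
      have h1 := (he.contDiffAt_comp_symm hφ (e.map_source hp₀)).fderiv_right (m := 0)
        (by norm_num)
      have h2 := (h1.continuousAt.norm.comp (e.continuousAt hp₀)).eventually_lt_const
        (lt_add_one _)
      simp only [Function.comp_apply] at h2
      set K := ‖fderiv ℝ (φ ∘ e.symm) (e p₀)‖ + 1
      have hK : 0 ≤ K := by positivity
      refine ⟨_, mem_nhdsWithin_of_mem_nhds (inter_mem (inter_mem hCe h2)
        (e.open_source.mem_nhds hp₀)), K * C, by positivity, ?_⟩
      rintro p ⟨⟨hp1, hp2⟩, hp3⟩ ℓ c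
      obtain ⟨y, hy, rfl⟩ : ∃ y ∈ e.target, e.symm y = p :=
        ⟨e p, e.map_source hp3, e.left_inv hp3⟩
      rw [norm_riemGrad]
      refine ContinuousLinearMap.opNorm_le_bound _ (by positivity) fun v => ?_
      obtain ⟨w, hw⟩ := he.exists_frame_eq hy v
      have hf := contMDiff_clm_comp_add hφ ℓ c
      have hw' : ‖w‖ ≤ C * ‖v‖ := by
        have h3 := hp1 v
        have h4 := congrArg (fun A => A w) (he.mdifferentiable.comp_symm_deriv hy)
        have h5 : mfderiv 𝓘(ℝ, Eucl d) 𝓘(ℝ, Eucl d) e (e.symm y) v = w := by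
          rw [← hw]
          exact h4
        rwa [h5] at h3
      rw [← hw, he.riemDiff_frame hy (hf.mdifferentiableAt (by norm_num)), hw,
        fderiv_clm_comp_add ((he.contDiffAt_comp_symm hφ hy).differentiableAt (by norm_num))]
      simp only [Set.mem_ofPred_eq, e.right_inv hy] at hp2
      calc ‖(ℓ.comp (fderiv ℝ (φ ∘ e.symm) y)) w‖
          ≤ ‖ℓ.comp (fderiv ℝ (φ ∘ e.symm) y)‖ * ‖w‖ := ContinuousLinearMap.le_opNorm _ _
        _ ≤ (‖ℓ‖ * K) * (C * ‖v‖) := by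
          gcongr
          exact (ContinuousLinearMap.opNorm_comp_le _ _).trans (by gcongr)
        _ = _ := by ring
  obtain ⟨C, hC, h⟩ := key
  exact ⟨C, hC, fun ℓ c p => h p (Set.mem_univ _) ℓ c⟩

set_option maxHeartbeats 800000 in
/-- Expansions at the centre of a normal chart of a `C^{2,1}` map `φ` and of a function
`ℓ₀ ∘ φ + c` that has a zero and a critical point there. The third bound concerns the gradient of
the functions `ℓ ∘ φ + c` with `ℓ` close to `ℓ₀`. -/
lemma IsNormalChart.exists_expansion_near {p : Θ} {ρ : ℝ} {x : OpenPartialHomeomorph Θ (Eucl d)}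
    (hx : IsNormalChart p ρ x) {φ : Θ → F} (hφ : IsC21Manifold d φ) {ℓ₀ : F →L[ℝ] ℝ} {c : ℝ}
    (h0 : ℓ₀ (φ p) + c = 0)
    (h1 : fderiv ℝ ((fun q => ℓ₀ (φ q) + c) ∘ x.symm) 0 = 0) :
    ∃ C, 0 ≤ C ∧ ∃ R, 0 < R ∧ ∀ q ∈ x.source, ‖x q‖ < R →
      ‖φ q - φ p - fderiv ℝ (φ ∘ x.symm) 0 (x q)‖ ≤ C * ‖x q‖ ^ 2 ∧
      |ℓ₀ (φ q) + c - 1 / 2 *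
        fderiv ℝ (fderiv ℝ ((fun q => ℓ₀ (φ q) + c) ∘ x.symm)) 0 (x q) (x q)| ≤ C * ‖x q‖ ^ 3 ∧
      ∀ ℓ : F →L[ℝ] ℝ, |‖riemGrad d (fun q => ℓ (φ q) + c) q‖ ^ 2 -
        ‖fderiv ℝ (fderiv ℝ ((fun q => ℓ₀ (φ q) + c) ∘ x.symm)) 0 (x q)
          + (ℓ - ℓ₀).comp (fderiv ℝ (φ ∘ x.symm) 0)‖ ^ 2|
        ≤ C * (‖x q‖ * (‖x q‖ + ‖ℓ - ℓ₀‖) ^ 2) := by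
  have he := hx.isSmoothChart
  have hz := hx.zero_mem_target
  have hφ2 := hφ.contMDiff
  set ψ := φ ∘ x.symm with hψ
  set u := (fun q => ℓ₀ (φ q) + c) ∘ x.symm with hu
  have hu2 : ContDiffAt ℝ 2 u 0 := he.contDiffAt_comp_symm (contMDiff_clm_comp_add hφ2 ℓ₀ c) hz
  have hψ2 : ∀ y ∈ x.target, ContDiffAt ℝ 2 ψ y := fun y hy => he.contDiffAt_comp_symm hφ2 hy
  have hQψ := QuadApproxAt.of_contDiffAt (hψ2 0 hz)
  have hDψ := he.quadApproxAt_fderiv_comp_symm hφ hz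
  have hfu : ∀ y ∈ x.target, fderiv ℝ u y = ℓ₀.comp (fderiv ℝ ψ y) := fun y hy =>
    fderiv_clm_comp_add ((hψ2 y hy).differentiableAt (by norm_num)) ℓ₀ c
  have hDu : QuadApproxAt (fderiv ℝ u) (fderiv ℝ (fderiv ℝ u) 0) 0 := by
    have h : QuadApproxAt (fderiv ℝ u) ((ContinuousLinearMap.compL ℝ (Eucl d) F ℝ ℓ₀).comp
        (fderiv ℝ (fderiv ℝ ψ) 0)) 0 := by
      have h2 : (fun y => (ContinuousLinearMap.compL ℝ (Eucl d) F ℝ ℓ₀)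
          (fderiv ℝ ψ y - fderiv ℝ ψ 0 - fderiv ℝ (fderiv ℝ ψ) 0 (y - 0)))
          =O[𝓝 0] fun y => ‖y - 0‖ ^ 2 := (ContinuousLinearMap.isBigO_comp _ _ _).trans hDψ
      refine h2.congr' ?_ EventuallyEq.rfl
      filter_upwards [x.open_target.mem_nhds hz] with y hy
      rw [hfu y hy, hfu 0 hz]
      simp
    rwa [h.hasFDerivAt.fderiv]
  have hTu := isBigO_taylor_two hu2 hDu
  obtain ⟨C₁, hC₁, R₁, hR₁, hb₁⟩ := exists_isBigO_bound hQψ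
  obtain ⟨C₂, hC₂, R₂, hR₂, hb₂⟩ := exists_isBigO_bound hTu
  obtain ⟨C₃, hC₃, R₃, hR₃, hb₃⟩ := exists_isBigO_bound hDu
  obtain ⟨C₄, hC₄, R₄, hR₄, hb₄⟩ := exists_isBigO_bound (n := 1) (by
    simpa using hDψ.isBigO_sub)
  obtain ⟨C₅, hC₅, R₅, hR₅, hb₅⟩ := hx.exists_abs_sq_norm_frame_sub_le
  set B := fderiv ℝ (fderiv ℝ u) 0
  set K := max (max C₃ C₄) (max ‖B‖ ‖fderiv ℝ ψ 0‖)
  have hK3 : C₃ ≤ K := (le_max_left _ _).trans (le_max_left _ _)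
  have hK4 : C₄ ≤ K := (le_max_right _ _).trans (le_max_left _ _)
  have hKB : ‖B‖ ≤ K := (le_max_left _ _).trans (le_max_right _ _)
  have hKψ : ‖fderiv ℝ ψ 0‖ ≤ K := (le_max_right _ _).trans (le_max_right _ _)
  have hK : 0 ≤ K := hC₃.trans hK3
  have hR6 : 0 < 1 / (2 * (C₅ + 1)) := by positivity
  refine ⟨max (max C₁ C₂) (3 * K ^ 2 + 8 * C₅ * K ^ 2),
    le_max_of_le_left (le_max_of_le_left hC₁),
    min (min R₁ R₂) (min (min R₃ R₄) (min R₅ (min 1 (1 / (2 * (C₅ + 1)))))), by positivity,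
    fun q hq hqR => ?_⟩
  simp only [lt_min_iff] at hqR
  obtain ⟨⟨hq1, hq2⟩, ⟨hq3, hq4⟩, hq5, hq6, hq7⟩ := hqR
  have hψ0 : ψ 0 = φ p := by simp [hψ, hx.symm_zero]
  have hψq : ψ (x q) = φ q := by simp [hψ, x.left_inv hq]
  have hu0 : u 0 = 0 := by simp [hu, hx.symm_zero, h0]
  have huq : u (x q) = ℓ₀ (φ q) + c := by simp [hu, x.left_inv hq]
  have hxq := x.map_source hq
  refine ⟨?_, ?_, fun ℓ => ?_⟩
  · have h := hb₁ _ hq1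
    rw [hψ0, hψq, sub_zero] at h
    exact h.trans (by gcongr; exact (le_max_left _ _).trans (le_max_left _ _))
  · have h := hb₂ _ hq2
    rw [hu0, huq, sub_zero, sub_zero, h1, zero_apply, sub_zero, Real.norm_eq_abs, smul_eq_mul] at h
    exact h.trans (by gcongr; exact (le_max_right _ _).trans (le_max_left _ _))
  · set t := ‖x q‖
    set L := ‖ℓ - ℓ₀‖
    have ht : 0 ≤ t := norm_nonneg _
    have hL : 0 ≤ L := norm_nonneg _
    set g := fderiv ℝ ((fun q => ℓ (φ q) + c) ∘ x.symm) (x q) with hg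
    set g₀ := B (x q) + (ℓ - ℓ₀).comp (fderiv ℝ ψ 0) with hg₀
    have hgeq : g = fderiv ℝ u (x q) + (ℓ - ℓ₀).comp (fderiv ℝ ψ (x q)) := by
      rw [hg, hfu _ hxq, fderiv_clm_comp_add ((hψ2 _ hxq).differentiableAt (by norm_num)) ℓ c,
        ContinuousLinearMap.sub_comp]
      abel
    have hd : ‖g - g₀‖ ≤ K * t * (t + L) := by
      have e1 : g - g₀ = (fderiv ℝ u (x q) - fderiv ℝ u 0 - B (x q - 0))
          + (ℓ - ℓ₀).comp (fderiv ℝ ψ (x q) - fderiv ℝ ψ 0) := by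
        rw [hgeq, hg₀, h1, sub_zero, sub_zero, ContinuousLinearMap.comp_sub]
        abel
      rw [e1]
      have e2 := hb₃ _ hq3
      have e3 := hb₄ _ hq4
      rw [pow_one] at e3
      calc _ ≤ C₃ * t ^ 2 + L * (C₄ * t) :=
            (norm_add_le _ _).trans (add_le_add e2 ((ContinuousLinearMap.opNorm_comp_le _ _).trans
              (by gcongr)))
        _ ≤ K * t ^ 2 + L * (K * t) := by gcongr
        _ = _ := by ring
    have hg0 : ‖g₀‖ ≤ K * (t + L) := by
      calc _ ≤ ‖B‖ * t + L * ‖fderiv ℝ ψ 0‖ :=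
            (norm_add_le _ _).trans (add_le_add (ContinuousLinearMap.le_opNorm _ _)
              (ContinuousLinearMap.opNorm_comp_le _ _))
        _ ≤ K * t + L * K := by gcongr
        _ = _ := by ring
    have hd' : ‖g - g₀‖ ≤ K * (t + L) := hd.trans (by
      rw [mul_right_comm]
      exact mul_le_of_le_one_right (by positivity) hq6.le)
    have hg1 : ‖g‖ ≤ 2 * K * (t + L) := by
      have := norm_add_le (g - g₀) g₀
      rw [sub_add_cancel] at this
      linarith
    have e1 : |‖g‖ ^ 2 - ‖g₀‖ ^ 2| ≤ 3 * K ^ 2 * (t * (t + L) ^ 2) := by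
      calc _ ≤ ‖g - g₀‖ * (‖g - g₀‖ + 2 * ‖g₀‖) := abs_sq_norm_sub_sq_norm_le g g₀
        _ ≤ (K * t * (t + L)) * (K * (t + L) + 2 * (K * (t + L))) := by gcongr
        _ = _ := by ring
    have hε : C₅ * t ≤ 1 / 2 := by
      rw [lt_div_iff₀ (by positivity)] at hq7
      have e : ‖x q‖ * (2 * (C₅ + 1)) = 2 * (C₅ * ‖x q‖) + 2 * ‖x q‖ := by ring
      linarith
    have e2 : |‖riemGrad d (fun q => ℓ (φ q) + c) q‖ ^ 2 - ‖g‖ ^ 2|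
        ≤ 8 * C₅ * K ^ 2 * (t * (t + L) ^ 2) := by
      have h := he.abs_sq_norm_riemGrad_sub_le hxq (by positivity) hε
        (fun w => hb₅ (x q) hxq hq5 w)
        ((contMDiff_clm_comp_add hφ2 ℓ c).mdifferentiableAt (by norm_num))
      rw [x.left_inv hq] at h
      calc _ ≤ _ := h
        _ ≤ 2 * (C₅ * t) * (2 * K * (t + L)) ^ 2 := by gcongr
        _ = _ := by ring
    calc _ ≤ |‖riemGrad d (fun q => ℓ (φ q) + c) q‖ ^ 2 - ‖g‖ ^ 2| + |‖g‖ ^ 2 - ‖g₀‖ ^ 2| :=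
          abs_sub_le _ _ _
      _ ≤ (3 * K ^ 2 + 8 * C₅ * K ^ 2) * (t * (t + L) ^ 2) := by linarith
      _ ≤ _ := by gcongr; exact le_max_right _ _

/-- On a compact manifold, the expansions at the centre of a normal chart hold on the whole chart
domain up to radius one, away from the centre because all the quantities are bounded. -/
lemma IsNormalChart.exists_expansion [CompactSpace Θ] {p : Θ} {ρ : ℝ}
    {x : OpenPartialHomeomorph Θ (Eucl d)}
    (hx : IsNormalChart p ρ x) {φ : Θ → F} (hφ : IsC21Manifold d φ) {ℓ₀ : F →L[ℝ] ℝ} {c : ℝ}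
    (h0 : ℓ₀ (φ p) + c = 0)
    (h1 : fderiv ℝ ((fun q => ℓ₀ (φ q) + c) ∘ x.symm) 0 = 0) (M : ℝ) :
    ∃ C, 0 ≤ C ∧ ∀ q ∈ x.source, ‖x q‖ < 1 →
      ‖φ q - φ p - fderiv ℝ (φ ∘ x.symm) 0 (x q)‖ ≤ C * ‖x q‖ ^ 2 ∧
      |ℓ₀ (φ q) + c - 1 / 2 *
        fderiv ℝ (fderiv ℝ ((fun q => ℓ₀ (φ q) + c) ∘ x.symm)) 0 (x q) (x q)| ≤ C * ‖x q‖ ^ 3 ∧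
      ∀ ℓ : F →L[ℝ] ℝ, ‖ℓ - ℓ₀‖ ≤ M → |‖riemGrad d (fun q => ℓ (φ q) + c) q‖ ^ 2 -
        ‖fderiv ℝ (fderiv ℝ ((fun q => ℓ₀ (φ q) + c) ∘ x.symm)) 0 (x q)
          + (ℓ - ℓ₀).comp (fderiv ℝ (φ ∘ x.symm) 0)‖ ^ 2|
        ≤ C * (‖x q‖ * (‖x q‖ + ‖ℓ - ℓ₀‖) ^ 2) := by
  obtain ⟨C, hC, R, hR, hnear⟩ := hx.exists_expansion_near hφ h0 h1
  obtain ⟨G, hG, hgrad⟩ := exists_norm_riemGrad_le hφ.contMDiff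
  obtain ⟨N, hN⟩ := isCompact_univ.exists_bound_of_continuousOn hφ.contMDiff.continuous.continuousOn
  have hN' : ∀ q, ‖φ q‖ ≤ N := fun q => hN q (Set.mem_univ q)
  have hN0 : 0 ≤ N := (norm_nonneg _).trans (hN' p)
  set D := fderiv ℝ (φ ∘ x.symm) 0
  set B := fderiv ℝ (fderiv ℝ ((fun q => ℓ₀ (φ q) + c) ∘ x.symm)) 0
  set K₁ := N + N + ‖D‖
  set K₂ := ‖ℓ₀‖ * N + |c| + ‖B‖
  set K₃ := (G * (|M| + ‖ℓ₀‖)) ^ 2 + (‖B‖ + |M| * ‖D‖) ^ 2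
  have hK1 : 0 ≤ K₁ := by positivity
  have hK2 : 0 ≤ K₂ := by positivity
  have hK3 : 0 ≤ K₃ := by positivity
  have h10 : 0 ≤ K₁ / R ^ 2 := by positivity
  have h20 : 0 ≤ K₂ / R ^ 3 := by positivity
  have h30 : 0 ≤ K₃ / R ^ 3 := by positivity
  refine ⟨C + K₁ / R ^ 2 + K₂ / R ^ 3 + K₃ / R ^ 3, by positivity, fun q hq hq1 => ?_⟩
  rcases lt_or_ge ‖x q‖ R with hlt | hge
  · obtain ⟨a1, a2, a3⟩ := hnear q hq hlt
    exact ⟨a1.trans (by gcongr; linarith), a2.trans (by gcongr; linarith),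
      fun ℓ _ => (a3 ℓ).trans (by gcongr; linarith)⟩
  · have hD : ‖D (x q)‖ ≤ ‖D‖ := (D.le_opNorm _).trans (by nlinarith [norm_nonneg D])
    have hB : ‖B (x q)‖ ≤ ‖B‖ := (B.le_opNorm _).trans (by nlinarith [norm_nonneg B])
    refine ⟨?_, ?_, fun ℓ hℓ => ?_⟩
    · have : ‖φ q - φ p - D (x q)‖ ≤ K₁ :=
        (norm_sub_le _ _).trans (add_le_add ((norm_sub_le _ _).trans
          (add_le_add (hN' q) (hN' p))) hD)
      exact (le_div_pow_mul_pow this hK1 hR hge).trans (by gcongr; linarith)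
    · have hBB : |B (x q) (x q)| ≤ ‖B‖ := by
        have := (B (x q)).le_opNorm (x q)
        rw [Real.norm_eq_abs] at this
        nlinarith [norm_nonneg (B (x q)), norm_nonneg (x q)]
      have hl : |ℓ₀ (φ q)| ≤ ‖ℓ₀‖ * N := (ℓ₀.le_opNorm _).trans (by gcongr; exact hN' q)
      have : |ℓ₀ (φ q) + c - 1 / 2 * B (x q) (x q)| ≤ K₂ := by
        refine (abs_sub _ _).trans (add_le_add ((abs_add_le _ _).trans (by gcongr)) ?_)
        rw [abs_mul, abs_of_pos (by norm_num : (0 : ℝ) < 1 / 2)]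
        linarith [abs_nonneg (B (x q) (x q))]
      exact (le_div_pow_mul_pow this hK2 hR hge).trans (by gcongr; linarith)
    · have hℓ' : ‖ℓ - ℓ₀‖ ≤ |M| := hℓ.trans (le_abs_self M)
      have e1 : ‖riemGrad d (fun q => ℓ (φ q) + c) q‖ ≤ G * (|M| + ‖ℓ₀‖) := by
        refine (hgrad ℓ c q).trans ?_
        gcongr
        have := norm_add_le (ℓ - ℓ₀) ℓ₀
        rw [sub_add_cancel] at this
        linarith
      have e2 : ‖B (x q) + (ℓ - ℓ₀).comp D‖ ≤ ‖B‖ + |M| * ‖D‖ :=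
        (norm_add_le _ _).trans (add_le_add hB ((ContinuousLinearMap.opNorm_comp_le _ _).trans
          (by gcongr)))
      have e3 : |‖riemGrad d (fun q => ℓ (φ q) + c) q‖ ^ 2 - ‖B (x q) + (ℓ - ℓ₀).comp D‖ ^ 2|
          ≤ K₃ := by
        refine (abs_sub _ _).trans ?_
        rw [abs_of_nonneg (by positivity), abs_of_nonneg (by positivity)]
        exact add_le_add (pow_le_pow_left₀ (norm_nonneg _) e1 2)
          (pow_le_pow_left₀ (norm_nonneg _) e2 2)
      refine (le_div_pow_mul_pow (n := 3) e3 hK3 hR hge).trans ?_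
      have e4 : ‖x q‖ ^ 3 ≤ ‖x q‖ * (‖x q‖ + ‖ℓ - ℓ₀‖) ^ 2 := by
        rw [pow_succ' _ 2]
        gcongr
        linarith [norm_nonneg (ℓ - ℓ₀)]
      calc _ ≤ K₃ / R ^ 3 * (‖x q‖ * (‖x q‖ + ‖ℓ - ℓ₀‖) ^ 2) := by gcongr
        _ ≤ _ := by gcongr; linarith

end Geometry

/-! ### Convexity of the loss and optimality of the sparse measure -/

/-- The one-sided first order optimality condition. -/
lemma HasDerivAt.nonneg_of_forall_le {g : ℝ → ℝ} {g' : ℝ} (hg : HasDerivAt g g' 0)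
    (h : ∀ t, 0 < t → t < 1 → g 0 ≤ g t) : 0 ≤ g' := by
  have h1 := hg.tendsto_slope_zero_right
  refine ge_of_tendsto h1 ?_
  have h2 : ∀ᶠ t : ℝ in 𝓝[>] 0, t < 1 :=
    mem_nhdsWithin_of_mem_nhds (Iio_mem_nhds one_pos)
  filter_upwards [self_mem_nhdsWithin, h2] with t ht ht1
  have := h t ht ht1
  rw [zero_add, smul_eq_mul]
  exact mul_nonneg (inv_nonneg.2 (le_of_lt ht)) (by linarith)

section Bregman

variable {F : Type*} [NormedAddCommGroup F] [NormedSpace ℝ F]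

/-- The Bregman divergence of `R` at `f`, as a function of the displacement. -/
noncomputable def bregman (R : F → ℝ) (f h : F) : ℝ := R (f + h) - R f - fderiv ℝ R f h

lemma bregman_smul_le {R : F → ℝ} (hR : ConvexOn ℝ Set.univ R) (f h : F) {t : ℝ} (ht0 : 0 ≤ t)
    (ht1 : t ≤ 1) : bregman R f (t • h) ≤ t * bregman R f h := by
  have h1 := hR.2 (Set.mem_univ f) (Set.mem_univ (f + h)) (sub_nonneg.2 ht1) ht0 (by ring)
  have h2 : (1 - t) • f + t • (f + h) = f + t • h := by module
  rw [h2, smul_eq_mul, smul_eq_mul] at h1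
  simp only [bregman, map_smul, smul_eq_mul]
  linarith

lemma bregman_nonneg {R : F → ℝ} (hR : ConvexOn ℝ Set.univ R) {f : F}
    (hd : DifferentiableAt ℝ R f) (h : F) : 0 ≤ bregman R f h := by
  have h1 : HasDerivAt (fun t : ℝ => t * bregman R f h - bregman R f (t • h))
      (bregman R f h) 0 := by
    have h2 : HasDerivAt (fun t : ℝ => f + t • h) h 0 := by
      simpa using ((hasDerivAt_id (0 : ℝ)).smul_const h).const_add f
    have h3 : HasDerivAt (fun t : ℝ => R (f + t • h)) (fderiv ℝ R f h) 0 := by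
      have h4 : HasFDerivAt R (fderiv ℝ R f) (f + (0 : ℝ) • h) := by
        rw [zero_smul, add_zero]
        exact hd.hasFDerivAt
      exact h4.comp_hasDerivAt (0 : ℝ) h2
    have h5 : HasDerivAt (fun t : ℝ => t * fderiv ℝ R f h) (fderiv ℝ R f h) 0 := by
      simpa using (hasDerivAt_id (0 : ℝ)).mul_const (fderiv ℝ R f h)
    have h6 : HasDerivAt (fun t : ℝ => t * bregman R f h) (bregman R f h) 0 := by
      simpa using (hasDerivAt_id (0 : ℝ)).mul_const (bregman R f h)
    have h7 := h6.sub ((h3.sub_const (R f)).sub h5)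
    rw [sub_self, sub_zero] at h7
    refine h7.congr_of_eventuallyEq (Eventually.of_forall fun t => ?_)
    simp [bregman]
  refine h1.nonneg_of_forall_le fun t ht ht1 => ?_
  have h8 := bregman_smul_le hR f h ht.le ht1.le
  have h9 : bregman R f ((0 : ℝ) • h) = 0 := by simp [bregman]
  rw [h9, zero_mul, sub_zero]
  linarith

end Bregman

namespace SparseProblem

variable {d m : ℕ} {Θ F : Type*} [EMetricSpace Θ] [MeasurableSpace Θ]
  [NormedAddCommGroup F] [InnerProductSpace ℝ F]

lemma Jstar_eq {P : SparseProblem d m Θ F} (h4 : P.A4) : P.Jstar = P.J P.νstar :=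
  le_antisymm (ciInf_le ⟨P.J P.νstar, by rintro _ ⟨ν, rfl⟩; exact h4.isMin ν⟩ _)
    (le_ciInf h4.isMin)

lemma gap_nonneg {P : SparseProblem d m Θ F} (h4 : P.A4) (ν : FiniteMeasure Θ) :
    0 ≤ P.J ν - P.Jstar := by
  rw [Jstar_eq h4]
  linarith [h4.isMin ν]

lemma J'_eq [CompleteSpace F] (P : SparseProblem d m Θ F) (ν : FiniteMeasure Θ) :
    P.J' ν = fun p => fderiv ℝ P.R (P.feat ν) (P.φ p) + P.lam := by
  funext p
  rw [J', gradient, real_inner_comm, InnerProductSpace.toDual_symm_apply]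

lemma norm_gradient [CompleteSpace F] (R : F → ℝ) (f : F) :
    ‖gradient R f‖ = ‖fderiv ℝ R f‖ :=
  (InnerProductSpace.toDual ℝ F).symm.norm_map _

lemma integrable_of_continuous [CompactSpace Θ] [BorelSpace Θ] {G : Type*} [NormedAddCommGroup G]
    {g : Θ → G} (hg : Continuous g) (ν : FiniteMeasure Θ) : Integrable g (ν : Measure Θ) :=
  hg.integrable_of_hasCompactSupport (HasCompactSupport.of_compactSpace g)

lemma integral_νstar [BorelSpace Θ] (P : SparseProblem d m Θ F) {G : Type*}
    [NormedAddCommGroup G] [NormedSpace ℝ G] [CompleteSpace G] (g : Θ → G) :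
    ∫ p, g p ∂(P.νstar : Measure Θ) = ∑ i, P.r i ^ 2 • g (P.θ i) := by
  have h : (P.νstar : Measure Θ) = ∑ i, (P.r i ^ 2).toNNReal • Measure.dirac (P.θ i) := by
    rw [νstar, FiniteMeasure.toMeasure_sum]
    rfl
  rw [h, integral_finsetSum_measure]
  · refine Finset.sum_congr rfl fun i _ => ?_
    rw [integral_smul_nnreal_measure, integral_dirac, NNReal.smul_def,
      Real.coe_toNNReal _ (sq_nonneg _)]
  · intro i _
    exact (integrable_dirac (by finiteness)).smul_measure_nnreal

/-- The mixture `(1 - t) ν⋆ + t ν`, for `0 ≤ t ≤ 1`. -/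
noncomputable def mix (P : SparseProblem d m Θ F) (ν : FiniteMeasure Θ) (t : ℝ) :
    FiniteMeasure Θ := (1 - t).toNNReal • P.νstar + t.toNNReal • ν

lemma integral_mix [CompactSpace Θ] [BorelSpace Θ] (P : SparseProblem d m Θ F)
    (ν : FiniteMeasure Θ) {t : ℝ} (ht0 : 0 ≤ t) (ht1 : t ≤ 1) {G : Type*}
    [NormedAddCommGroup G] [NormedSpace ℝ G] {g : Θ → G} (hg : Continuous g) :
    ∫ p, g p ∂(P.mix ν t : Measure Θ) =
      (1 - t) • ∫ p, g p ∂(P.νstar : Measure Θ) + t • ∫ p, g p ∂(ν : Measure Θ) := by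
  have h : (P.mix ν t : Measure Θ) =
      (1 - t).toNNReal • (P.νstar : Measure Θ) + t.toNNReal • (ν : Measure Θ) := by
    simp [mix]
  rw [h, integral_add_measure (integrable_of_continuous hg _).smul_measure_nnreal
    (integrable_of_continuous hg _).smul_measure_nnreal, integral_smul_nnreal_measure,
    integral_smul_nnreal_measure, NNReal.smul_def, NNReal.smul_def,
    Real.coe_toNNReal _ (sub_nonneg.2 ht1), Real.coe_toNNReal _ ht0]

lemma integral_lam (P : SparseProblem d m Θ F) (ν : FiniteMeasure Θ) :
    ∫ _, P.lam ∂(ν : Measure Θ) = P.lam * (ν.mass : ℝ) := by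
  rw [integral_const, smul_eq_mul, mul_comm]
  rfl

section Optimality

variable [CompactSpace Θ] [BorelSpace Θ] [CompleteSpace F]

lemma continuous_J' {P : SparseProblem d m Θ F} (hφ : Continuous P.φ) (ν : FiniteMeasure Θ) :
    Continuous (P.J' ν) := by
  rw [J'_eq]
  fun_prop

lemma integral_J' {P : SparseProblem d m Θ F} (hφ : Continuous P.φ) (μ ν : FiniteMeasure Θ) :
    ∫ p, P.J' μ p ∂(ν : Measure Θ) =
      fderiv ℝ P.R (P.feat μ) (P.feat ν) + P.lam * (ν.mass : ℝ) := by
  have hi := integrable_of_continuous hφ ν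
  rw [J'_eq, integral_add (ContinuousLinearMap.integrable_comp _ hi) (integrable_const _),
    ContinuousLinearMap.integral_comp_comm _ hi, integral_lam]
  rfl

/-- First order optimality of `ν⋆` along the segment from `ν⋆` to `ν`. -/
lemma integral_J'_νstar_le {P : SparseProblem d m Θ F} (hφ : Continuous P.φ)
    (hR : DifferentiableAt ℝ P.R P.fstar) (h4 : P.A4) (ν : FiniteMeasure Θ) :
    ∫ p, P.J' P.νstar p ∂(P.νstar : Measure Θ) ≤ ∫ p, P.J' P.νstar p ∂(ν : Measure Θ) := by
  have hJ : ∀ t, 0 ≤ t → t ≤ 1 → P.J (P.mix ν t) =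
      P.R (P.fstar + t • (P.feat ν - P.fstar)) +
        (P.lam * P.νstar.mass + t * (P.lam * ν.mass - P.lam * P.νstar.mass)) := by
    intro t ht0 ht1
    rw [J, ← integral_lam, feat, integral_mix P ν ht0 ht1 hφ,
      integral_mix P ν ht0 ht1 continuous_const, integral_lam, integral_lam]
    congr 1
    · congr 1
      rw [fstar, feat, feat]
      module
    · simp only [smul_eq_mul]
      ring
  have h2 : HasDerivAt (fun t : ℝ => P.fstar + t • (P.feat ν - P.fstar))
      (P.feat ν - P.fstar) 0 := by
    simpa using ((hasDerivAt_id (0 : ℝ)).smul_const (P.feat ν - P.fstar)).const_add P.fstar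
  have h3 : HasDerivAt (fun t : ℝ => P.R (P.fstar + t • (P.feat ν - P.fstar)))
      (fderiv ℝ P.R P.fstar (P.feat ν - P.fstar)) 0 := by
    have h4 : HasFDerivAt P.R (fderiv ℝ P.R P.fstar)
        (P.fstar + (0 : ℝ) • (P.feat ν - P.fstar)) := by
      rw [zero_smul, add_zero]
      exact hR.hasFDerivAt
    exact h4.comp_hasDerivAt (0 : ℝ) h2
  have h5 : HasDerivAt (fun t : ℝ => P.lam * P.νstar.mass +
      t * (P.lam * ν.mass - P.lam * P.νstar.mass)) (P.lam * ν.mass - P.lam * P.νstar.mass) 0 := by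
    simpa using ((hasDerivAt_id (0 : ℝ)).mul_const
      (P.lam * ν.mass - P.lam * P.νstar.mass)).const_add (P.lam * P.νstar.mass : ℝ)
  have h6 := (h3.add h5).nonneg_of_forall_le fun t ht0 ht1 => by
    have h := h4.isMin (P.mix ν t)
    rw [hJ t ht0.le ht1.le] at h
    have h0 := hJ 0 le_rfl zero_le_one
    have hmix : P.mix ν 0 = P.νstar := by simp [mix]
    rw [hmix] at h0
    rw [h0] at h
    exact h
  rw [integral_J' hφ, integral_J' hφ]
  rw [map_sub] at h6
  change fderiv ℝ P.R P.fstar P.fstar + _ ≤ fderiv ℝ P.R P.fstar _ + _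
  linarith

lemma J'_νstar_nonneg {P : SparseProblem d m Θ F} (hφ : Continuous P.φ)
    (hR : DifferentiableAt ℝ P.R P.fstar) (h4 : P.A4) (p : Θ) : 0 ≤ P.J' P.νstar p := by
  have h := integral_J'_νstar_le hφ hR h4 (P.νstar + (diracProba p).toFiniteMeasure)
  have h1 : ((P.νstar + (diracProba p).toFiniteMeasure : FiniteMeasure Θ) : Measure Θ) =
      (P.νstar : Measure Θ) + Measure.dirac p := rfl
  rw [h1, integral_add_measure (integrable_of_continuous (continuous_J' hφ _) _)
    (integrable_dirac (by finiteness)), integral_dirac] at h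
  linarith

/-- Complementary slackness: the first variation at `ν⋆` vanishes on the support of `ν⋆`. -/
lemma J'_νstar_θ {P : SparseProblem d m Θ F} (hφ : Continuous P.φ)
    (hR : DifferentiableAt ℝ P.R P.fstar) (h4 : P.A4) (i : Fin m) :
    P.J' P.νstar (P.θ i) = 0 := by
  have h := integral_J'_νstar_le hφ hR h4 0
  rw [integral_νstar] at h
  simp only [FiniteMeasure.toMeasure_zero, integral_zero_measure, smul_eq_mul] at h
  have h1 : ∀ i ∈ Finset.univ, 0 ≤ P.r i ^ 2 * P.J' P.νstar (P.θ i) := fun i _ =>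
    mul_nonneg (sq_nonneg _) (J'_νstar_nonneg hφ hR h4 _)
  have h2 := (Finset.sum_eq_zero_iff_of_nonneg h1).1 (le_antisymm h (Finset.sum_nonneg h1)) i
    (Finset.mem_univ i)
  exact (mul_eq_zero.1 h2).resolve_left (pow_ne_zero 2 (h4.r_pos i).ne')

/-- The excess of `J` is the sum of the Bregman divergence of `R` and of the integral of the first
variation at the minimizer, which are both nonnegative. -/
lemma gap_eq {P : SparseProblem d m Θ F} (hφ : Continuous P.φ)
    (hR : DifferentiableAt ℝ P.R P.fstar) (h4 : P.A4) (ν : FiniteMeasure Θ) :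
    P.J ν - P.Jstar = bregman P.R P.fstar (P.feat ν - P.fstar) +
      ∫ p, P.J' P.νstar p ∂(ν : Measure Θ) := by
  have h0 : ∫ p, P.J' P.νstar p ∂(P.νstar : Measure Θ) = 0 := by
    rw [integral_νstar]
    simp [J'_νstar_θ hφ hR h4]
  rw [integral_J' hφ] at h0
  change fderiv ℝ P.R P.fstar P.fstar + _ = 0 at h0
  rw [Jstar_eq h4, integral_J' hφ, bregman, map_sub, add_sub_cancel, J, J]
  change P.R (P.feat ν) + _ - (P.R P.fstar + _) = _ + (fderiv ℝ P.R P.fstar _ + _)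
  linarith

end Optimality

end SparseProblem

/-! ### Coercivity of the first variation -/

lemma EuclideanSpace.real_norm_sq_eq_dotProduct {ι : Type*} [Fintype ι] (v : EuclideanSpace ℝ ι) :
    ‖v‖ ^ 2 = v.ofLp ⬝ᵥ v.ofLp := by
  rw [EuclideanSpace.norm_sq_eq, dotProduct]
  exact Finset.sum_congr rfl fun j _ => by rw [Real.norm_eq_abs, sq_abs, sq]

/-- A positive semidefinite matrix whose smallest singular value is positive is coercive. -/
lemma SigmaMinPos.exists_le_dotProduct_mulVec {ι : Type*} [Fintype ι] [DecidableEq ι]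
    {A : Matrix ι ι ℝ} (hA : SigmaMinPos A) (hsymm : A.IsSymm)
    (hpos : ∀ v, 0 ≤ v ⬝ᵥ (A *ᵥ v)) :
    ∃ c : ℝ, 0 < c ∧ ∀ v : ι → ℝ, c * (v ⬝ᵥ v) ≤ v ⬝ᵥ (A *ᵥ v) := by
  obtain ⟨a, ha, hAv⟩ := hA
  -- By the Cauchy-Schwarz inequality for the form of `A`, `|A v|² ≤ (1 + ‖A‖) ⟨v, A v⟩`.
  set T := LinearMap.toContinuousLinearMap (Matrix.toEuclideanLin A)
  set N := ‖T‖ + 1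
  have hN : 0 < N := by positivity
  refine ⟨a ^ 2 / N, by positivity, fun v => ?_⟩
  set w := A *ᵥ v
  have hw : a ^ 2 * (v ⬝ᵥ v) ≤ w ⬝ᵥ w := by
    have h := hAv (WithLp.toLp 2 v)
    have h2 := pow_le_pow_left₀ (by positivity) h 2
    rw [mul_pow, EuclideanSpace.real_norm_sq_eq_dotProduct,
      EuclideanSpace.real_norm_sq_eq_dotProduct] at h2
    exact h2
  have hAw : w ⬝ᵥ (A *ᵥ w) ≤ N * (w ⬝ᵥ w) := by
    have h := T.le_opNorm (WithLp.toLp 2 w)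
    have h2 := real_inner_le_norm (WithLp.toLp 2 w) (T (WithLp.toLp 2 w))
    have h3 : ⟪WithLp.toLp 2 w, T (WithLp.toLp 2 w)⟫ = w ⬝ᵥ (A *ᵥ w) := by
      rw [real_inner_comm]
      simp [T, PiLp.inner_apply, dotProduct]
    have h4 := EuclideanSpace.real_norm_sq_eq_dotProduct (WithLp.toLp 2 w)
    rw [h3] at h2
    change _ = w ⬝ᵥ w at h4
    rw [← h4]
    nlinarith [norm_nonneg (WithLp.toLp 2 w), norm_nonneg T, sq_nonneg ‖WithLp.toLp 2 w‖]
  have hcs : ∀ t : ℝ, 0 ≤ (v ⬝ᵥ w) - 2 * t * (w ⬝ᵥ w) + t ^ 2 * (w ⬝ᵥ (A *ᵥ w)) := by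
    intro t
    have h := hpos (v - t • w)
    have h2 : v ⬝ᵥ (A *ᵥ w) = w ⬝ᵥ w := by
      rw [Matrix.dotProduct_mulVec, ← Matrix.mulVec_transpose, hsymm.eq]
    rw [Matrix.mulVec_sub, Matrix.mulVec_smul, sub_dotProduct, dotProduct_sub, dotProduct_sub,
      smul_dotProduct, smul_dotProduct, dotProduct_smul, dotProduct_smul, h2] at h
    simp only [smul_eq_mul] at h
    change 0 ≤ v ⬝ᵥ w - t * (w ⬝ᵥ w) - (t * (w ⬝ᵥ w) - t * (t * (w ⬝ᵥ A *ᵥ w))) at h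
    linarith
  have h := hcs N⁻¹
  have h5 : (N⁻¹) ^ 2 * (w ⬝ᵥ (A *ᵥ w)) ≤ N⁻¹ * (w ⬝ᵥ w) := by
    calc _ ≤ (N⁻¹) ^ 2 * (N * (w ⬝ᵥ w)) := by gcongr
      _ = _ := by field_simp
  calc a ^ 2 / N * (v ⬝ᵥ v) = N⁻¹ * (a ^ 2 * (v ⬝ᵥ v)) := by ring
    _ ≤ N⁻¹ * (w ⬝ᵥ w) := by gcongr
    _ ≤ v ⬝ᵥ w := by linarith

/-- A bilinear form on a Euclidean space, computed from its components. -/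
lemma clm_apply_apply_eq_sum {d : ℕ} (B : Eucl d →L[ℝ] Eucl d →L[ℝ] ℝ) (v w : Eucl d) :
    B v w = ∑ j, ∑ k, v j * w k * B (EuclideanSpace.single j 1) (EuclideanSpace.single k 1) := by
  conv_lhs => rw [← EuclideanSpace.sum_smul_single v, ← EuclideanSpace.sum_smul_single w]
  rw [map_sum B, sum_apply]
  refine Finset.sum_congr rfl fun j _ => ?_
  rw [map_sum]
  refine Finset.sum_congr rfl fun k _ => ?_
  rw [map_smul, map_smul, smul_apply, smul_eq_mul, smul_eq_mul]
  ring

namespace SparseProblem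

variable {d m : ℕ} {Θ F : Type*} [EMetricSpace Θ]
  [NormedAddCommGroup F] [InnerProductSpace ℝ F] [MeasurableSpace Θ] [CompleteSpace F]

/-- The second derivative of `J'_{ν⋆}` at `θ i`, in the coordinates `x i`. -/
noncomputable def hessJ' (P : SparseProblem d m Θ F) (i : Fin m) : Eucl d →L[ℝ] Eucl d →L[ℝ] ℝ :=
  fderiv ℝ (fderiv ℝ (P.J' P.νstar ∘ (P.x i).symm)) 0

lemma Hloc_apply (P : SparseProblem d m Θ F) (i : Fin m) (j k : Fin d) :
    P.Hloc i j k = P.β ^ 2 *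
      P.hessJ' i (EuclideanSpace.single j 1) (EuclideanSpace.single k 1) := rfl

lemma hessJ'_eq {P : SparseProblem d m Θ F} (h2 : P.A2) (i : Fin m) (v w : Eucl d) :
    P.hessJ' i v w = (P.β ^ 2)⁻¹ * (v.ofLp ⬝ᵥ (P.Hloc i *ᵥ w.ofLp)) := by
  have hβ : P.β ≠ 0 := h2.β_pos.ne'
  rw [clm_apply_apply_eq_sum, dotProduct, Finset.mul_sum]
  refine Finset.sum_congr rfl fun j _ => ?_
  rw [Matrix.mulVec, dotProduct, Finset.mul_sum, Finset.mul_sum]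
  refine Finset.sum_congr rfl fun k _ => ?_
  rw [Hloc_apply]
  field_simp

/-- The differential of `φ` at `θ i`, in the coordinates `x i`. -/
noncomputable def dφ (P : SparseProblem d m Θ F) (i : Fin m) : Eucl d →L[ℝ] F :=
  fderiv ℝ (P.φ ∘ (P.x i).symm) 0

lemma sq_norm_hessJ'_add {P : SparseProblem d m Θ F} (h2 : P.A2) (i : Fin m)
    (hsymm : (P.Hloc i).IsSymm) (v : Eucl d) (ℓ : F →L[ℝ] ℝ) :
    ‖P.hessJ' i v + ℓ.comp (P.dφ i)‖ ^ 2 = ∑ k, ((P.β ^ 2)⁻¹ * (P.Hloc i *ᵥ v.ofLp) k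
      + ℓ (P.dφ i (EuclideanSpace.single k 1))) ^ 2 := by
  rw [sq_norm_clm_eq_sum]
  refine Finset.sum_congr rfl fun k _ => ?_
  rw [add_apply, hessJ'_eq h2, ContinuousLinearMap.comp_apply, Matrix.dotProduct_mulVec,
    ← Matrix.mulVec_transpose, hsymm.eq]
  congr 3
  simp

section

variable [CompactSpace Θ] [BorelSpace Θ] [ChartedSpace (Eucl d) Θ] [IsManifold 𝓘(ℝ, Eucl d) ∞ Θ]
  [RiemannianBundle (fun p : Θ => TangentSpace 𝓘(ℝ, Eucl d) p)]
  [IsContMDiffRiemannianBundle 𝓘(ℝ, Eucl d) ∞ (Eucl d)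
      (fun p : Θ => TangentSpace 𝓘(ℝ, Eucl d) p)]
  {P : SparseProblem d m Θ F}

lemma A1.continuous_φ (h1 : P.A1) : Continuous P.φ := h1.φ_reg.contMDiff.continuous

lemma A1.contDiffAt_R (h1 : P.A1) (f : F) : ContDiffAt ℝ 2 P.R f :=
  h1.R_reg.contDiffAt isOpen_univ (Set.mem_univ f)

lemma A1.differentiableAt_R (h1 : P.A1) (f : F) : DifferentiableAt ℝ P.R f :=
  (h1.contDiffAt_R f).differentiableAt (by norm_num)

lemma A1.contMDiff_J' (h1 : P.A1) (ν : FiniteMeasure Θ) :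
    ContMDiff 𝓘(ℝ, Eucl d) 𝓘(ℝ, ℝ) 2 (P.J' ν) := by
  rw [J'_eq]
  exact contMDiff_clm_comp_add h1.φ_reg.contMDiff _ _

lemma Hloc_isSymm (hx : ∀ i, IsNormalChart (P.θ i) (P.ρ i) (P.x i)) (h1 : P.A1) (i : Fin m) :
    (P.Hloc i).IsSymm := by
  refine Matrix.IsSymm.ext fun j k => ?_
  rw [Hloc_apply, Hloc_apply]
  have h := ((hx i).isSmoothChart.contDiffAt_comp_symm (h1.contMDiff_J' P.νstar)
    (hx i).zero_mem_target).isSymmSndFDerivAt (by simp)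
  rw [hessJ', h.eq]

lemma J'_νstar_ge_zero (h1 : P.A1) (h4 : P.A4) (p : Θ) : 0 ≤ P.J' P.νstar p :=
  J'_νstar_nonneg h1.continuous_φ (h1.differentiableAt_R _) h4 p

/-- The local expansions around `θ i`, up to radius one. -/
lemma exists_cell_expansion (hx : ∀ i, IsNormalChart (P.θ i) (P.ρ i) (P.x i))
    (h1 : P.A1) (h4 : P.A4) (M : ℝ) (i : Fin m) :
    ∃ C, 0 ≤ C ∧ ∀ q ∈ (P.x i).source, ‖P.x i q‖ < 1 →
      ‖P.φ q - P.φ (P.θ i) - P.dφ i (P.x i q)‖ ≤ C * ‖P.x i q‖ ^ 2 ∧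
      |P.J' P.νstar q - 1 / 2 * P.hessJ' i (P.x i q) (P.x i q)| ≤ C * ‖P.x i q‖ ^ 3 ∧
      ∀ ν : FiniteMeasure Θ, ‖fderiv ℝ P.R (P.feat ν) - fderiv ℝ P.R P.fstar‖ ≤ M →
        |‖riemGrad d (P.J' ν) q‖ ^ 2 - ‖P.hessJ' i (P.x i q)
          + (fderiv ℝ P.R (P.feat ν) - fderiv ℝ P.R P.fstar).comp (P.dφ i)‖ ^ 2|
        ≤ C * (‖P.x i q‖ *
          (‖P.x i q‖ + ‖fderiv ℝ P.R (P.feat ν) - fderiv ℝ P.R P.fstar‖) ^ 2) := by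
  have h0 := J'_νstar_θ h1.continuous_φ (h1.differentiableAt_R _) h4 i
  have hmin : fderiv ℝ (P.J' P.νstar ∘ (P.x i).symm) 0 = 0 := by
    refine IsLocalMin.fderiv_eq_zero (Eventually.of_forall fun y => ?_)
    simp only [Function.comp_apply, (hx i).symm_zero, h0]
    exact J'_νstar_ge_zero h1 h4 _
  simp only [hessJ', dφ]
  rw [J'_eq] at h0 hmin ⊢
  obtain ⟨C, hC, h⟩ := (hx i).exists_expansion h1.φ_reg h0 hmin M
  refine ⟨C, hC, fun q hq hq1 => ?_⟩
  obtain ⟨a1, a2, a3⟩ := h q hq hq1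
  refine ⟨a1, a2, fun ν hν => ?_⟩
  rw [J'_eq]
  exact a3 _ hν

/-- The atoms are minimum points of the first variation at `ν⋆`. -/
lemma hessJ'_nonneg (hx : ∀ i, IsNormalChart (P.θ i) (P.ρ i) (P.x i))
    (h1 : P.A1) (h4 : P.A4) (i : Fin m) (v : Eucl d) : 0 ≤ P.hessJ' i v v := by
  obtain ⟨C, hC, h⟩ := exists_cell_expansion hx h1 h4 0 i
  have hlim : Tendsto (fun t : ℝ => 1 / 2 * P.hessJ' i v v + C * t * ‖v‖ ^ 3) (𝓝[>] 0)
      (𝓝 (1 / 2 * P.hessJ' i v v)) := by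
    have : Tendsto (fun t : ℝ => 1 / 2 * P.hessJ' i v v + C * t * ‖v‖ ^ 3) (𝓝 0)
        (𝓝 (1 / 2 * P.hessJ' i v v + C * 0 * ‖v‖ ^ 3)) :=
      Continuous.tendsto (by fun_prop) 0
    rw [mul_zero, zero_mul, add_zero] at this
    exact this.mono_left nhdsWithin_le_nhds
  have hnhds : ∀ᶠ t : ℝ in 𝓝[>] 0, t • v ∈ (P.x i).target ∩ Metric.ball 0 1 := by
    have hc : Tendsto (fun t : ℝ => t • v) (𝓝 0) (𝓝 0) := by
      have : Continuous fun t : ℝ => t • v := by fun_prop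
      simpa using this.tendsto 0
    exact nhdsWithin_le_nhds (hc (inter_mem ((P.x i).open_target.mem_nhds (hx i).zero_mem_target)
      (Metric.ball_mem_nhds 0 one_pos)))
  have hge : 0 ≤ 1 / 2 * P.hessJ' i v v := by
    refine ge_of_tendsto hlim ?_
    filter_upwards [hnhds, self_mem_nhdsWithin] with t ht ht0
    replace ht0 : 0 < t := ht0
    have h3 := (h _ ((P.x i).map_target ht.1) (by
      rw [(P.x i).right_inv ht.1]; simpa using ht.2)).2.1
    rw [(P.x i).right_inv ht.1, map_smul, map_smul, smul_apply, smul_eq_mul, smul_eq_mul,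
      norm_smul, Real.norm_of_nonneg ht0.le] at h3
    have h5 := J'_νstar_ge_zero h1 h4 ((P.x i).symm (t • v))
    have h6 := (abs_le.1 h3).2
    have h7 : 0 ≤ t ^ 2 * (1 / 2 * P.hessJ' i v v + C * t * ‖v‖ ^ 3) := by
      nlinarith
    exact nonneg_of_mul_nonneg_right h7 (by positivity)
  linarith

lemma exists_le_hessJ' (hx : ∀ i, IsNormalChart (P.θ i) (P.ρ i) (P.x i))
    (h1 : P.A1) (h2 : P.A2) (h4 : P.A4) (h5 : P.A5) (i : Fin m) :
    ∃ c : ℝ, 0 < c ∧ ∀ v : Eucl d, c * ‖v‖ ^ 2 ≤ P.hessJ' i v v := by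
  have hβ : 0 < P.β ^ 2 := pow_pos h2.β_pos 2
  obtain ⟨c, hc, h⟩ := (h5.H_pos i).exists_le_dotProduct_mulVec (Hloc_isSymm hx h1 i) (by
    intro v
    have := hessJ'_nonneg hx h1 h4 i (WithLp.toLp 2 v)
    rw [hessJ'_eq h2] at this
    exact nonneg_of_mul_nonneg_right this (by positivity))
  refine ⟨(P.β ^ 2)⁻¹ * c, by positivity, fun v => ?_⟩
  rw [hessJ'_eq h2, EuclideanSpace.real_norm_sq_eq_dotProduct, mul_assoc]
  gcongr
  exact h v.ofLp

lemma mem_cell_iff (hx : ∀ i, IsNormalChart (P.θ i) (P.ρ i) (P.x i)) {τ : ℝ}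
    {i : Fin m} (hτ : τ ≤ P.ρ i) {q : Θ} :
    q ∈ P.cell τ i ↔ q ∈ (P.x i).source ∧ ‖P.x i q‖ < τ :=
  (hx i).mem_source_iff_of_lt hτ

/-- The first variation at the minimizer grows quadratically around the atoms, uniformly in the
admissible radius `τ`, and is at least of the order of `τ²` away from them. -/
lemma exists_coercivity (hx : ∀ i, IsNormalChart (P.θ i) (P.ρ i) (P.x i))
    (h1 : P.A1) (h2 : P.A2) (h4 : P.A4) (h5 : P.A5) :
    ∃ c : ℝ, 0 < c ∧ ∀ τ, P.Admissible τ →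
      (∀ i, ∀ q ∈ P.cell τ i, c * ‖P.x i q‖ ^ 2 ≤ P.J' P.νstar q) ∧
      ∀ q ∈ P.cell₀ τ, c * τ ^ 2 ≤ P.J' P.νstar q := by
  have hnear : ∀ i, ∃ c : ℝ, 0 < c ∧ ∃ R : ℝ, 0 < R ∧ R ≤ P.ρ i ∧ ∀ q ∈ P.cell R i,
      c * ‖P.x i q‖ ^ 2 ≤ P.J' P.νstar q := by
    intro i
    obtain ⟨C, hC, h⟩ := exists_cell_expansion hx h1 h4 0 i
    obtain ⟨c, hc, hH⟩ := exists_le_hessJ' hx h1 h2 h4 h5 i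
    have hR0 : 0 < c / (4 * (C + 1)) := by positivity
    refine ⟨c / 4, by positivity, min (P.ρ i) (min 1 (c / (4 * (C + 1)))),
      lt_min (hx i).radius_pos (lt_min one_pos hR0), min_le_left _ _, fun q hq => ?_⟩
    rw [mem_cell_iff hx (min_le_left _ _), lt_min_iff, lt_min_iff] at hq
    obtain ⟨hqs, -, hq1, hq2⟩ := hq
    have h3 := (abs_le.1 (h q hqs hq1).2.1).1
    have h6 := hH (P.x i q)
    rw [lt_div_iff₀ (by positivity)] at hq2
    have h7 : C * ‖P.x i q‖ ^ 3 ≤ c / 4 * ‖P.x i q‖ ^ 2 := by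
      have : C * ‖P.x i q‖ ≤ c / 4 := by nlinarith [norm_nonneg (P.x i q)]
      calc _ = C * ‖P.x i q‖ * ‖P.x i q‖ ^ 2 := by ring
        _ ≤ _ := by gcongr
    linarith
  choose c hc R hR hRρ hcR using hnear
  have hcont : Continuous (P.J' P.νstar) := continuous_J' h1.continuous_φ _
  obtain ⟨c₀, hc₀, hfar⟩ : ∃ c₀ : ℝ, 0 < c₀ ∧ ∀ q, (∀ i, q ∉ P.cell (R i) i) →
      c₀ ≤ P.J' P.νstar q := by
    have hK : IsCompact (⋃ i, P.cell (R i) i)ᶜ :=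
      (isOpen_iUnion fun i => Metric.isOpen_eball).isClosed_compl.isCompact
    rcases (⋃ i, P.cell (R i) i)ᶜ.eq_empty_or_nonempty with hemp | hne
    · refine ⟨1, one_pos, fun q hq => ?_⟩
      have : q ∈ (⋃ i, P.cell (R i) i)ᶜ := by simpa using hq
      rw [hemp] at this
      exact this.elim
    · obtain ⟨q₀, hq₀, hmin⟩ := hK.exists_isMinOn hne hcont.continuousOn
      refine ⟨P.J' P.νstar q₀, lt_of_le_of_ne (J'_νstar_ge_zero h1 h4 _) fun h0 => ?_,
        fun q hq => hmin (by simpa using hq)⟩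
      obtain ⟨i, rfl⟩ := h5.slack q₀ h0.symm
      refine hq₀ (Set.mem_iUnion.2 ⟨i, ?_⟩)
      exact Metric.mem_eball_self (by simpa using hR i)
  obtain ⟨c₁, hc₁, hc₁'⟩ : ∃ c₁ : ℝ, 0 < c₁ ∧ ∀ i, c₁ ≤ c i := by
    rcases isEmpty_or_nonempty (Fin m) with h | h
    · exact ⟨1, one_pos, fun i => (h.false i).elim⟩
    · obtain ⟨a, ha⟩ := Finite.exists_min c
      exact ⟨c a, hc a, ha⟩
  refine ⟨min c₀ c₁, lt_min hc₀ hc₁, fun τ hτ => ?_⟩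
  obtain ⟨hτ0, hτ1, hτρ, hdisj⟩ := hτ
  constructor
  · intro i q hq
    have hxq := (mem_cell_iff hx (hτρ i).le).1 hq
    by_cases hqi : q ∈ P.cell (R i) i
    · refine le_trans ?_ (hcR i q hqi)
      gcongr
      exact (min_le_right _ _).trans (hc₁' i)
    · have hRτ : R i < τ := by
        by_contra hcon
        exact hqi (Metric.eball_subset_eball (ENNReal.ofReal_le_ofReal (not_lt.1 hcon)) hq)
      by_cases hex : ∃ j, q ∈ P.cell (R j) j
      · -- A point of another small ball lies outside the cell `i`, unless that small ball is not
        -- contained in the cell of the same index, in which case it is itself far from that atom.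
        obtain ⟨j, hj⟩ := hex
        have hji : j ≠ i := by rintro rfl; exact hqi hj
        have hqj : q ∉ P.cell τ j := fun h => Set.disjoint_left.1 (hdisj hji) h hq
        have hxj := (mem_cell_iff hx (hRρ j)).1 hj
        have hge : τ ≤ ‖P.x j q‖ := by
          by_contra hcon
          exact hqj ((mem_cell_iff hx (hτρ j).le).2 ⟨hxj.1, not_le.1 hcon⟩)
        refine le_trans ?_ (hcR j q hj)
        have : ‖P.x i q‖ ≤ ‖P.x j q‖ := hxq.2.le.trans hge
        have h8 : min c₀ c₁ ≤ c j := (min_le_right _ _).trans (hc₁' j)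
        have h9 : 0 ≤ c j := (hc j).le
        gcongr
      · push Not at hex
        refine le_trans ?_ (hfar q hex)
        have h8 : ‖P.x i q‖ ^ 2 ≤ 1 := pow_le_one₀ (norm_nonneg _) (hxq.2.le.trans hτ1.le)
        calc min c₀ c₁ * ‖P.x i q‖ ^ 2 ≤ c₀ * 1 := by
              gcongr
              exact min_le_left _ _
          _ = c₀ := mul_one _
  · intro q hq
    have hq' : ∀ i, q ∉ P.cell τ i := by simpa [cell₀] using hq
    by_cases hex : ∃ j, q ∈ P.cell (R j) j
    · obtain ⟨j, hj⟩ := hex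
      have hxj := (mem_cell_iff hx (hRρ j)).1 hj
      have hge : τ ≤ ‖P.x j q‖ := by
        by_contra hcon
        exact hq' j ((mem_cell_iff hx (hτρ j).le).2 ⟨hxj.1, not_le.1 hcon⟩)
      refine le_trans ?_ (hcR j q hj)
      have h8 : min c₀ c₁ ≤ c j := (min_le_right _ _).trans (hc₁' j)
      have h9 : 0 ≤ c j := (hc j).le
      gcongr
    · push Not at hex
      refine le_trans ?_ (hfar q hex)
      have h8 : τ ^ 2 ≤ 1 := pow_le_one₀ hτ0.le hτ1.le
      calc min c₀ c₁ * τ ^ 2 ≤ c₀ * 1 := by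
            gcongr
            exact min_le_left _ _
        _ = c₀ := mul_one _

end

end SparseProblem

/-! ### Moments on the cells -/

namespace SparseProblem

variable {d m : ℕ} {Θ F : Type*} [EMetricSpace Θ]
  [NormedAddCommGroup F] [InnerProductSpace ℝ F] [MeasurableSpace Θ] [BorelSpace Θ]
  {P : SparseProblem d m Θ F}

lemma isOpen_cell (P : SparseProblem d m Θ F) (τ : ℝ) (i : Fin m) : IsOpen (P.cell τ i) :=
  Metric.isOpen_eball

lemma measurableSet_cell (P : SparseProblem d m Θ F) (τ : ℝ) (i : Fin m) :
    MeasurableSet (P.cell τ i) := (P.isOpen_cell τ i).measurableSet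

lemma measurableSet_cell₀ (P : SparseProblem d m Θ F) (τ : ℝ) : MeasurableSet (P.cell₀ τ) :=
  (MeasurableSet.iUnion fun i => P.measurableSet_cell τ i).compl

lemma integral_eq_cell₀_add_sum {τ : ℝ} (hτ : P.Admissible τ) {G : Type*}
    [NormedAddCommGroup G] [NormedSpace ℝ G] {ν : Measure Θ} {g : Θ → G} (hg : Integrable g ν) :
    ∫ p, g p ∂ν = ∫ p in P.cell₀ τ, g p ∂ν + ∑ i, ∫ p in P.cell τ i, g p ∂ν := by
  rw [← integral_add_compl (P.measurableSet_cell₀ τ) hg]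
  congr 1
  rw [cell₀, compl_compl]
  exact integral_iUnion_fintype (fun i => P.measurableSet_cell τ i) hτ.2.2.2
    fun i => hg.integrableOn

lemma locMass_eq (P : SparseProblem d m Θ F) (τ : ℝ) (ν : FiniteMeasure Θ) (i : Fin m) :
    P.locMass τ ν i = (ν : Measure Θ).real (P.cell τ i) := rfl

lemma locMass_nonneg (P : SparseProblem d m Θ F) (τ : ℝ) (ν : FiniteMeasure Θ) (i : Fin m) :
    0 ≤ P.locMass τ ν i := NNReal.coe_nonneg _

lemma locMass_le_mass (P : SparseProblem d m Θ F) (τ : ℝ) (ν : FiniteMeasure Θ) (i : Fin m) :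
    P.locMass τ ν i ≤ ν.mass := by
  exact_mod_cast ν.apply_le_mass (P.cell τ i)

lemma setIntegral_const_cell (P : SparseProblem d m Θ F) (τ : ℝ) (ν : FiniteMeasure Θ) (i : Fin m)
    {G : Type*} [NormedAddCommGroup G] [NormedSpace ℝ G] [CompleteSpace G] (c : G) :
    ∫ _ in P.cell τ i, c ∂(ν : Measure Θ) = P.locMass τ ν i • c := by
  rw [setIntegral_const, locMass_eq]

lemma setIntegral_cell_eq_zero {τ : ℝ} {ν : FiniteMeasure Θ} {i : Fin m}
    (h : P.locMass τ ν i = 0) {G : Type*} [NormedAddCommGroup G] [NormedSpace ℝ G] (g : Θ → G) :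
    ∫ p in P.cell τ i, g p ∂(ν : Measure Θ) = 0 := by
  rw [locMass_eq, measureReal_eq_zero_iff] at h
  rw [Measure.restrict_eq_zero.2 h, integral_zero_measure]

section Moments

variable [CompactSpace Θ] {τ : ℝ} {ν : FiniteMeasure Θ} {i : Fin m}
  (hcell : ∀ q ∈ P.cell τ i, q ∈ (P.x i).source ∧ ‖P.x i q‖ < 1)

include hcell

lemma integrableOn_comp_chart {G : Type*} [NormedAddCommGroup G] [SecondCountableTopology G]
    {g : Eucl d → G} (hg : Continuous g) :
    IntegrableOn (fun p => g (P.x i p)) (P.cell τ i) (ν : Measure Θ) := by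
  have hsub : P.cell τ i ⊆ (P.x i).source := fun q hq => (hcell q hq).1
  have hc : ContinuousOn (fun p => g (P.x i p)) (P.cell τ i) :=
    hg.comp_continuousOn ((P.x i).continuousOn.mono hsub)
  obtain ⟨C, hC⟩ := (isCompact_closedBall (0 : Eucl d) 1).exists_bound_of_continuousOn
    hg.continuousOn
  refine Integrable.of_bound (hc.aestronglyMeasurable (P.measurableSet_cell τ i)) C ?_
  refine (ae_restrict_iff' (P.measurableSet_cell τ i)).2 (Eventually.of_forall fun q hq => ?_)
  exact hC _ (by simpa using (hcell q hq).2.le)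

/-- The definition of the local mean, in a form that also holds when the cell has no mass. -/
lemma setIntegral_chart :
    ∫ p in P.cell τ i, P.x i p ∂(ν : Measure Θ) = P.locMass τ ν i • P.locMean τ ν i := by
  by_cases h : P.locMass τ ν i = 0
  · rw [setIntegral_cell_eq_zero h, h, zero_smul]
  · rw [locMean, smul_inv_smul₀ h]

lemma setIntegral_chart_apply (j : Fin d) :
    ∫ p in P.cell τ i, P.x i p j ∂(ν : Measure Θ) = P.locMass τ ν i * P.locMean τ ν i j := by
  have h := (EuclideanSpace.proj (𝕜 := ℝ) j).integral_comp_comm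
    (integrableOn_comp_chart (ν := ν) hcell (g := fun y => y) continuous_id)
  rw [setIntegral_chart hcell] at h
  simpa using h

lemma abs_locMean_apply_le (j : Fin d) : |P.locMean τ ν i j| ≤ 1 := by
  by_cases h : P.locMass τ ν i = 0
  · simp [locMean, h]
  · have hpos : 0 < P.locMass τ ν i := lt_of_le_of_ne (P.locMass_nonneg τ ν i) (Ne.symm h)
    have h1 : ‖∫ p in P.cell τ i, P.x i p j ∂(ν : Measure Θ)‖ ≤ 1 * P.locMass τ ν i :=
      norm_setIntegral_le_of_norm_le_const (measure_lt_top _ _) fun q hq =>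
        (PiLp.norm_apply_le (P.x i q) j).trans (hcell q hq).2.le
    rw [setIntegral_chart_apply hcell, norm_mul, Real.norm_of_nonneg hpos.le, mul_comm,
      Real.norm_eq_abs] at h1
    exact le_of_mul_le_mul_right h1 hpos

/-- The König-Huygens formula for the centred second moments. -/
lemma setIntegral_centered (j k : Fin d) :
    ∫ p in P.cell τ i, (P.x i p j - P.locMean τ ν i j) * (P.x i p k - P.locMean τ ν i k)
      ∂(ν : Measure Θ) = ∫ p in P.cell τ i, P.x i p j * P.x i p k ∂(ν : Measure Θ)
        - P.locMass τ ν i * (P.locMean τ ν i j * P.locMean τ ν i k) := by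
  set a := P.locMean τ ν i
  have i1 : IntegrableOn (fun p => P.x i p j * P.x i p k) (P.cell τ i) (ν : Measure Θ) :=
    integrableOn_comp_chart hcell (g := fun y => y j * y k) (by fun_prop)
  have i2 : IntegrableOn (fun p => a k * P.x i p j) (P.cell τ i) (ν : Measure Θ) :=
    integrableOn_comp_chart hcell (g := fun y => a k * y j) (by fun_prop)
  have i3 : IntegrableOn (fun p => a j * P.x i p k) (P.cell τ i) (ν : Measure Θ) :=
    integrableOn_comp_chart hcell (g := fun y => a j * y k) (by fun_prop)
  have i4 : IntegrableOn (fun _ => a j * a k) (P.cell τ i) (ν : Measure Θ) :=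
    integrableOn_comp_chart hcell (g := fun _ => a j * a k) continuous_const
  have i5 : IntegrableOn (fun p => P.x i p j * P.x i p k - a k * P.x i p j) (P.cell τ i)
      (ν : Measure Θ) := i1.sub i2
  have i6 : IntegrableOn (fun p => P.x i p j * P.x i p k - a k * P.x i p j - a j * P.x i p k)
      (P.cell τ i) (ν : Measure Θ) := i5.sub i3
  have h : ∀ p, (P.x i p j - a j) * (P.x i p k - a k) =
      P.x i p j * P.x i p k - a k * P.x i p j - a j * P.x i p k + a j * a k := fun p => by ring
  simp only [h]
  rw [integral_add i6 i4, integral_sub i5 i3, integral_sub i1 i2,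
    integral_const_mul, integral_const_mul, setIntegral_chart_apply hcell,
    setIntegral_chart_apply hcell, setIntegral_const_cell, smul_eq_mul]
  ring

lemma locMass_mul_locCov (hβ : P.β ≠ 0) (j k : Fin d) :
    P.locMass τ ν i * (P.β ^ 2 * P.locCov τ ν i j k) =
      ∫ p in P.cell τ i, P.x i p j * P.x i p k ∂(ν : Measure Θ)
        - P.locMass τ ν i * (P.locMean τ ν i j * P.locMean τ ν i k) := by
  rw [← setIntegral_centered hcell]
  by_cases h : P.locMass τ ν i = 0
  · rw [setIntegral_cell_eq_zero h, h, zero_mul]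
  · rw [locCov, Matrix.of_apply]
    field_simp

lemma abs_locCov_le (hβ : P.β ≠ 0) (j k : Fin d) : |P.locCov τ ν i j k| ≤ 4 * (P.β ^ 2)⁻¹ := by
  have hβ2 : 0 < P.β ^ 2 := by positivity
  by_cases h : P.locMass τ ν i = 0
  · simp only [locCov, h, Matrix.of_apply, zero_mul, inv_zero, abs_zero]
    positivity
  · have hpos : 0 < P.locMass τ ν i := lt_of_le_of_ne (P.locMass_nonneg τ ν i) (Ne.symm h)
    have h1 : ‖∫ p in P.cell τ i, (P.x i p j - P.locMean τ ν i j) *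
        (P.x i p k - P.locMean τ ν i k) ∂(ν : Measure Θ)‖ ≤ 4 * P.locMass τ ν i := by
      refine norm_setIntegral_le_of_norm_le_const (measure_lt_top _ _) fun q hq => ?_
      have hb : ∀ j, |P.x i q j - P.locMean τ ν i j| ≤ 2 := fun j => by
        have e1 := (PiLp.norm_apply_le (P.x i q) j).trans (hcell q hq).2.le
        have e2 := abs_locMean_apply_le (ν := ν) hcell j
        have e3 := abs_sub (P.x i q j) (P.locMean τ ν i j)
        rw [Real.norm_eq_abs] at e1
        linarith
      rw [norm_mul, Real.norm_eq_abs, Real.norm_eq_abs]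
      calc _ ≤ (2 : ℝ) * 2 := by gcongr <;> exact hb _
        _ = 4 := by norm_num
    rw [locCov, Matrix.of_apply, abs_mul, abs_inv, abs_of_pos (by positivity), mul_inv]
    rw [Real.norm_eq_abs] at h1
    calc _ ≤ (P.locMass τ ν i)⁻¹ * (P.β ^ 2)⁻¹ * (4 * P.locMass τ ν i) := by gcongr
      _ = _ := by field_simp

lemma abs_setIntegral_mul_le (j k : Fin d) :
    |∫ p in P.cell τ i, P.x i p j * P.x i p k ∂(ν : Measure Θ)| ≤
      ∫ p in P.cell τ i, ‖P.x i p‖ ^ 2 ∂(ν : Measure Θ) := by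
  rw [← Real.norm_eq_abs]
  refine norm_integral_le_of_norm_le (integrableOn_comp_chart hcell (g := fun y => ‖y‖ ^ 2)
    (by fun_prop)) (Eventually.of_forall fun q => ?_)
  rw [norm_mul, sq]
  gcongr <;> exact PiLp.norm_apply_le _ _

/-- The moments of the local mean are at most the second moment around the atom, by the
Cauchy-Schwarz inequality. -/
lemma abs_locMass_mul_locMean_le (j k : Fin d) :
    |P.locMass τ ν i * (P.locMean τ ν i j * P.locMean τ ν i k)| ≤
      ∫ p in P.cell τ i, ‖P.x i p‖ ^ 2 ∂(ν : Measure Θ) := by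
  have hs := P.locMass_nonneg τ ν i
  have h1 : ∀ j, P.locMass τ ν i * P.locMean τ ν i j ^ 2 ≤
      ∫ p in P.cell τ i, ‖P.x i p‖ ^ 2 ∂(ν : Measure Θ) := by
    intro j
    have h2 := setIntegral_centered (ν := ν) hcell j j
    have h3 : 0 ≤ ∫ p in P.cell τ i, (P.x i p j - P.locMean τ ν i j) *
        (P.x i p j - P.locMean τ ν i j) ∂(ν : Measure Θ) :=
      integral_nonneg fun p => mul_self_nonneg _
    have h4 := (abs_le.1 (abs_setIntegral_mul_le (ν := ν) hcell j j)).2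
    nlinarith
  have hj := h1 j
  have hk := h1 k
  rw [abs_le]
  constructor <;> nlinarith [mul_nonneg hs (sq_nonneg (P.locMean τ ν i j + P.locMean τ ν i k)),
    mul_nonneg hs (sq_nonneg (P.locMean τ ν i j - P.locMean τ ν i k))]

/-- The integral of a quadratic form over a cell splits into the contributions of the covariance
and of the mean. -/
lemma setIntegral_quadratic (hβ : P.β ≠ 0) (M : Matrix (Fin d) (Fin d) ℝ) :
    ∫ p in P.cell τ i, (P.x i p).ofLp ⬝ᵥ (M *ᵥ (P.x i p).ofLp) ∂(ν : Measure Θ) =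
      P.locMass τ ν i * (P.β ^ 2 * (P.locCov τ ν i * M).trace) +
      P.locMass τ ν i * ((P.locMean τ ν i).ofLp ⬝ᵥ (M *ᵥ (P.locMean τ ν i).ofLp)) := by
  have hexp : ∀ v : Fin d → ℝ, v ⬝ᵥ (M *ᵥ v) = ∑ j, ∑ k, M k j * (v j * v k) := by
    intro v
    rw [Finset.sum_comm]
    simp only [dotProduct, Matrix.mulVec, Finset.mul_sum]
    exact Finset.sum_congr rfl fun j _ => Finset.sum_congr rfl fun k _ => by ring
  have hint : ∀ j k, IntegrableOn (fun p => M k j * (P.x i p j * P.x i p k)) (P.cell τ i)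
      (ν : Measure Θ) := fun j k =>
    integrableOn_comp_chart hcell (g := fun y => M k j * (y j * y k)) (by fun_prop)
  simp only [hexp, Matrix.trace, Matrix.diag, Matrix.mul_apply, Finset.mul_sum]
  rw [integral_finsetSum _ fun j _ => integrable_finsetSum _ fun k _ => hint j k,
    ← Finset.sum_add_distrib]
  refine Finset.sum_congr rfl fun j _ => ?_
  rw [integral_finsetSum _ fun k _ => hint j k, ← Finset.sum_add_distrib]
  refine Finset.sum_congr rfl fun k _ => ?_
  rw [integral_const_mul]
  linear_combination (-M k j) * locMass_mul_locCov (ν := ν) hcell hβ j k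

end Moments

end SparseProblem

/-! ### Quantities controlled by the excess -/

/-- Let `D` be a function with `D (t h) ≤ t D h` whose second order part at the origin is the
nonnegative form `Q / 2`. If `Q` is coercive along `u` and `D (u + e) ≤ δ²` with `e = O(δ)`, then
`u = O(δ)`. -/
lemma exists_le_mul_of_bregman_le {F : Type*} [NormedAddCommGroup F] [NormedSpace ℝ F]
    {Q : F →L[ℝ] F →L[ℝ] ℝ} (hQ : ∀ v, 0 ≤ Q v v) {D : F → ℝ}
    (hD : ∀ h t, 0 ≤ t → t ≤ 1 → D (t • h) ≤ t * D h) {C ε : ℝ} (hC : 0 ≤ C) (hε : 0 < ε)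
    (hT : ∀ h, ‖h‖ < ε → |D h - 1 / 2 * Q h h| ≤ C * ‖h‖ ^ 3) {c Λ A : ℝ} (hc : 0 < c)
    (hΛ : 0 ≤ Λ) (hA : 0 ≤ A) :
    ∃ N, 0 ≤ N ∧ ∀ (Y δ : ℝ) (u e : F), 0 ≤ Y → 0 ≤ δ → δ ≤ 1 → c * Y ^ 2 ≤ Q u u →
      ‖u‖ ≤ Λ * Y → ‖e‖ ≤ A * δ → D (u + e) ≤ δ ^ 2 → Y ≤ N * δ := by
  set G := Λ + 1
  have hG : 0 < G := by positivity
  -- On the segment from `0` to `h`, the point `t h` with `t = min(1, η / Y)` is in the region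
  -- where the Taylor expansion is dominated by its quadratic part.
  obtain ⟨η, hη, hη1, hη2⟩ : ∃ η : ℝ, 0 < η ∧ G * η < ε ∧ (C + 1) * G ^ 3 * η ≤ c / 16 := by
    refine ⟨min (ε / (2 * G)) (c / (16 * (C + 1) * G ^ 3)), by positivity, ?_, ?_⟩
    · calc _ ≤ G * (ε / (2 * G)) := by gcongr; exact min_le_left _ _
        _ = ε / 2 := by field_simp
        _ < ε := by linarith
    · calc _ ≤ (C + 1) * G ^ 3 * (c / (16 * (C + 1) * G ^ 3)) := by
            gcongr; exact min_le_right _ _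
        _ = c / 16 := by field_simp
  obtain ⟨N, hN1, hNA, hNQ, hNc, hNη⟩ : ∃ N : ℝ, 1 ≤ N ∧ A ≤ N ∧ 4 * ‖Q‖ * A ^ 2 ≤ N * c ∧
      16 ≤ N * c ∧ 16 ≤ N * (c * η) := by
    have p1 : 0 ≤ 4 * ‖Q‖ * A ^ 2 / c := by positivity
    have p2 : 0 ≤ 16 / c := by positivity
    have p3 : 0 ≤ 16 / (c * η) := by positivity
    refine ⟨1 + A + 4 * ‖Q‖ * A ^ 2 / c + 16 / c + 16 / (c * η), by linarith, by linarith, ?_, ?_,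
      ?_⟩
    · rw [← div_le_iff₀ hc]; linarith
    · rw [← div_le_iff₀ hc]; linarith
    · rw [← div_le_iff₀ (by positivity)]; linarith
  refine ⟨N, by linarith, fun Y δ u e hY hδ hδ1 hu huΛ he hDh => ?_⟩
  by_contra! hcon
  have hN0 : 0 < N := by linarith
  have hY0 : 0 < Y := lt_of_le_of_lt (by positivity) hcon
  set h := u + e
  have heY : ‖e‖ ≤ Y := he.trans ((mul_le_mul_of_nonneg_right hNA hδ).trans hcon.le)
  have hhY : ‖h‖ ≤ G * Y := (norm_add_le u e).trans (by
    calc _ ≤ Λ * Y + Y := add_le_add huΛ heY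
      _ = G * Y := by ring)
  have hNY : N * δ ^ 2 ≤ Y ^ 2 := by
    have e1 : (N * δ) ^ 2 ≤ Y ^ 2 := pow_le_pow_left₀ (by positivity) hcon.le 2
    have e2 : N * δ ^ 2 ≤ (N * δ) ^ 2 := by
      rw [mul_pow]
      gcongr
      exact le_self_pow₀ hN1 two_ne_zero
    exact e2.trans e1
  have hQe : Q e e ≤ c / 4 * Y ^ 2 := by
    have e1 : Q e e ≤ ‖Q‖ * ‖e‖ * ‖e‖ := (le_abs_self _).trans (Q.le_opNorm₂ e e)
    have e3 : ‖Q‖ * ‖e‖ * ‖e‖ ≤ ‖Q‖ * (A * δ) * (A * δ) := by gcongr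
    have e4 : 4 * ‖Q‖ * A ^ 2 * δ ^ 2 ≤ N * c * δ ^ 2 := by gcongr
    have e5 : c * (N * δ ^ 2) ≤ c * Y ^ 2 := by gcongr
    linarith
  have hQh : c / 4 * Y ^ 2 ≤ Q h h := by
    have e1 : Q u u = 2 * Q h h + 2 * Q e e - Q (h + e) (h + e) := by
      have : u = h - e := by simp [h]
      rw [this]
      simp only [map_sub, map_add, sub_apply, add_apply]
      ring
    linarith [hQ (h + e)]
  set t := min 1 (η / Y)
  have ht0 : 0 < t := by positivity
  have ht1 : t ≤ 1 := min_le_left _ _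
  have htY : t * Y ≤ η := by
    calc t * Y ≤ η / Y * Y := by gcongr; exact min_le_right _ _
      _ = η := div_mul_cancel₀ _ hY0.ne'
  have hth : ‖t • h‖ ≤ G * (t * Y) := by
    rw [norm_smul, Real.norm_of_nonneg ht0.le]
    calc t * ‖h‖ ≤ t * (G * Y) := by gcongr
      _ = _ := by ring
  have hthε : ‖t • h‖ < ε := by
    calc _ ≤ G * (t * Y) := hth
      _ ≤ G * η := by gcongr
      _ < ε := hη1
  have h1 := (abs_le.1 (hT _ hthε)).1
  have h2 := (hD h t ht0.le ht1).trans (mul_le_mul_of_nonneg_left hDh ht0.le)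
  have h3 : Q (t • h) (t • h) = t ^ 2 * Q h h := by
    simp only [map_smul, smul_apply, smul_eq_mul]
    ring
  have h4 : C * ‖t • h‖ ^ 3 ≤ c / 16 * (t * Y) ^ 2 := by
    have e1 : (C + 1) * G ^ 3 * (t * Y) ≤ c / 16 := by
      calc (C + 1) * G ^ 3 * (t * Y) ≤ (C + 1) * G ^ 3 * η := by gcongr
        _ ≤ c / 16 := hη2
    calc C * ‖t • h‖ ^ 3 ≤ (C + 1) * (G * (t * Y)) ^ 3 := by
          gcongr
          linarith
      _ = (C + 1) * G ^ 3 * (t * Y) * (t * Y) ^ 2 := by ring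
      _ ≤ _ := by gcongr
  have h5 : c / 16 * (t * Y) ^ 2 ≤ t * δ ^ 2 := by
    have e1 : t ^ 2 * (c / 4 * Y ^ 2) ≤ t ^ 2 * Q h h := by gcongr
    nlinarith
  have h6 : c / 16 * (t * Y) * Y ≤ δ ^ 2 := by
    refine le_of_mul_le_mul_left (a := t) ?_ ht0
    calc _ = c / 16 * (t * Y) ^ 2 := by ring
      _ ≤ _ := h5
  rcases min_choice 1 (η / Y) with hmin | hmin
  · have ht : t = 1 := hmin
    rw [ht, one_mul] at h6
    have e1 : (N * δ) ^ 2 < Y ^ 2 := pow_lt_pow_left₀ hcon (by positivity) two_ne_zero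
    have e2 : N * δ ^ 2 ≤ (N * δ) ^ 2 := by
      rw [mul_pow]
      gcongr
      exact le_self_pow₀ hN1 two_ne_zero
    have e3 : c * (N * δ ^ 2) < c * Y ^ 2 := by gcongr; exact e2.trans_lt e1
    have e4 : 16 * δ ^ 2 ≤ N * c * δ ^ 2 := by gcongr
    linarith
  · have ht : t * Y = η := by
      change t = η / Y at hmin
      rw [hmin, div_mul_cancel₀ _ hY0.ne']
    rw [ht] at h6
    have e2 : δ ^ 2 ≤ δ := by
      rw [sq]
      exact mul_le_of_le_one_left hδ hδ1
    have e4 : c * η * (N * δ) < c * η * Y := by gcongr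
    have e5 : 16 * δ ≤ N * (c * η) * δ := by gcongr
    linarith

lemma isBigO_principal_of_norm_le {α G : Type*} [NormedAddCommGroup G] {S : Set α} {f : α → G}
    {g : α → ℝ} {C : ℝ} (hC : 0 ≤ C) (h : ∀ z ∈ S, ‖f z‖ ≤ C * g z) : f =O[𝓟 S] g :=
  IsBigO.of_bound C (eventually_principal.2 fun z hz =>
    (h z hz).trans (mul_le_mul_of_nonneg_left (le_abs_self _) hC))

namespace SparseProblem

variable {d m : ℕ} {Θ F : Type*} [EMetricSpace Θ] [CompactSpace Θ] [MeasurableSpace Θ]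
  [BorelSpace Θ] [NormedAddCommGroup F] [InnerProductSpace ℝ F] [CompleteSpace F]

/-- The excess `J(ν) - J⋆`. -/
noncomputable def gap (P : SparseProblem d m Θ F) (ν : FiniteMeasure Θ) : ℝ := P.J ν - P.Jstar

/-- The pairs of an admissible radius and of a measure of the sublevel set. -/
def dom (P : SparseProblem d m Θ F) (Jmax : ℝ) : Set (ℝ × FiniteMeasure Θ) :=
  {z | P.Admissible z.1 ∧ P.J z.2 ≤ Jmax}

/-- The pairs for which the excess is at most `τ⁴`. Elsewhere the error `Δ^{3/2} τ⁻⁶` is at least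
one, and the expansions only say that their terms are bounded. -/
def smallDom (P : SparseProblem d m Θ F) (Jmax : ℝ) : Set (ℝ × FiniteMeasure Θ) :=
  {z | z ∈ P.dom Jmax ∧ P.gap z.2 ≤ z.1 ^ 4}

/-- The displacement `f_ν - f⋆`. -/
noncomputable def disp (P : SparseProblem d m Θ F) (ν : FiniteMeasure Θ) : F :=
  P.feat ν - P.fstar

/-- The variation `dR(f_ν) - dR(f⋆)` of the differential of the loss. -/
noncomputable def dvar (P : SparseProblem d m Θ F) (ν : FiniteMeasure Θ) : F →L[ℝ] ℝ :=
  fderiv ℝ P.R (P.feat ν) - fderiv ℝ P.R P.fstar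

/-- The Hessian of `R` at `f⋆`, as a bilinear map. -/
noncomputable def hessMap (P : SparseProblem d m Θ F) : F →L[ℝ] F →L[ℝ] ℝ :=
  fderiv ℝ (fderiv ℝ P.R) P.fstar

/-- The linear map that sends the biases to the first order part of the displacement. -/
noncomputable def lin (P : SparseProblem d m Θ F) (b : Fin m × Fin (d + 1) → ℝ) : F :=
  ∑ a, b a • (P.r a.1 • P.gradBar a.1 a.2)

/-- The part of the displacement that the biases do not account for. -/
noncomputable def rem (P : SparseProblem d m Θ F) (τ : ℝ) (ν : FiniteMeasure Θ) : F :=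
  P.disp ν - P.lin (P.bias τ ν)

/-- The second moment of `ν` on the cell `i`, around `θ i`. -/
noncomputable def secMoment (P : SparseProblem d m Θ F) (τ : ℝ) (ν : FiniteMeasure Θ)
    (i : Fin m) : ℝ := ∫ p in P.cell τ i, ‖P.x i p‖ ^ 2 ∂(ν : Measure Θ)

variable [ChartedSpace (Eucl d) Θ] [IsManifold 𝓘(ℝ, Eucl d) ∞ Θ]
  [RiemannianBundle (fun p : Θ => TangentSpace 𝓘(ℝ, Eucl d) p)]
  [IsContMDiffRiemannianBundle 𝓘(ℝ, Eucl d) ∞ (Eucl d)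
      (fun p : Θ => TangentSpace 𝓘(ℝ, Eucl d) p)]
  {P : SparseProblem d m Θ F}

/-- On a cell, the normal coordinates are defined and bounded by one. -/
lemma mem_source_of_mem_cell (hx : ∀ i, IsNormalChart (P.θ i) (P.ρ i) (P.x i)) {τ : ℝ}
    (hτ : P.Admissible τ)
    (i : Fin m) : ∀ q ∈ P.cell τ i, q ∈ (P.x i).source ∧ ‖P.x i q‖ < 1 := fun _ hq =>
  have h := (mem_cell_iff hx (hτ.2.2.1 i).le).1 hq
  ⟨h.1, h.2.trans hτ.2.1⟩

lemma secMoment_nonneg (P : SparseProblem d m Θ F) (τ : ℝ) (ν : FiniteMeasure Θ) (i : Fin m) :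
    0 ≤ P.secMoment τ ν i := integral_nonneg fun _ => by positivity

lemma integral_J'_le_gap (h1 : P.A1) (h3 : P.A3) (h4 : P.A4) (ν : FiniteMeasure Θ) :
    ∫ p, P.J' P.νstar p ∂(ν : Measure Θ) ≤ P.gap ν := by
  rw [gap, gap_eq h1.continuous_φ (h1.differentiableAt_R _) h4]
  linarith [bregman_nonneg h3 (h1.differentiableAt_R P.fstar) (P.feat ν - P.fstar)]

lemma bregman_le_gap (h1 : P.A1) (h4 : P.A4) (ν : FiniteMeasure Θ) :
    bregman P.R P.fstar (P.disp ν) ≤ P.gap ν := by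
  rw [gap, gap_eq h1.continuous_φ (h1.differentiableAt_R _) h4, disp]
  linarith [integral_nonneg (μ := (ν : Measure Θ)) (f := P.J' P.νstar)
    fun p => J'_νstar_ge_zero h1 h4 p]

lemma setIntegral_J'_le_gap (h1 : P.A1) (h3 : P.A3) (h4 : P.A4) (ν : FiniteMeasure Θ)
    (A : Set Θ) : ∫ p in A, P.J' P.νstar p ∂(ν : Measure Θ) ≤ P.gap ν :=
  (setIntegral_le_integral (integrable_of_continuous (continuous_J' h1.continuous_φ _) _)
    (Eventually.of_forall fun p => J'_νstar_ge_zero h1 h4 p)).trans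
    (integral_J'_le_gap h1 h3 h4 ν)

/-- The second moments around the atoms are controlled by the excess. -/
lemma isBigO_secMoment (hx : ∀ i, IsNormalChart (P.θ i) (P.ρ i) (P.x i))
    (h1 : P.A1) (h2 : P.A2) (h3 : P.A3) (h4 : P.A4) (h5 : P.A5) (Jmax : ℝ) (i : Fin m) :
    (fun z : ℝ × FiniteMeasure Θ => P.secMoment z.1 z.2 i) =O[𝓟 (P.dom Jmax)]
      fun z => P.gap z.2 := by
  obtain ⟨c, hc, hco⟩ := exists_coercivity hx h1 h2 h4 h5
  refine isBigO_principal_of_norm_le (C := c⁻¹) (by positivity) fun z hz => ?_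
  rw [Real.norm_of_nonneg (P.secMoment_nonneg _ _ _), inv_mul_eq_div, le_div_iff₀ hc, mul_comm]
  refine le_trans ?_ (setIntegral_J'_le_gap h1 h3 h4 z.2 (P.cell z.1 i))
  rw [secMoment, ← integral_const_mul]
  refine setIntegral_mono_on ((integrableOn_comp_chart (mem_source_of_mem_cell hx hz.1 i)
    (g := fun y => c * ‖y‖ ^ 2)
    (by fun_prop))) (integrable_of_continuous (continuous_J' h1.continuous_φ _) _).integrableOn
    (P.measurableSet_cell _ _) fun q hq => (hco z.1 hz.1).1 i q hq

/-- The mass away from the atoms is controlled by the excess. -/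
lemma isBigO_mass_cell₀ (hx : ∀ i, IsNormalChart (P.θ i) (P.ρ i) (P.x i))
    (h1 : P.A1) (h2 : P.A2) (h3 : P.A3) (h4 : P.A4) (h5 : P.A5) (Jmax : ℝ) :
    (fun z : ℝ × FiniteMeasure Θ => (z.2 : Measure Θ).real (P.cell₀ z.1)) =O[𝓟 (P.dom Jmax)]
      fun z => P.gap z.2 / z.1 ^ 2 := by
  obtain ⟨c, hc, hco⟩ := exists_coercivity hx h1 h2 h4 h5
  refine isBigO_principal_of_norm_le (C := c⁻¹) (by positivity) fun z hz => ?_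
  have hτ : 0 < z.1 := hz.1.1
  rw [Real.norm_of_nonneg measureReal_nonneg, inv_mul_eq_div, le_div_iff₀ hc,
    le_div_iff₀ (by positivity), mul_assoc, ← smul_eq_mul, ← setIntegral_const]
  refine le_trans ?_ (setIntegral_J'_le_gap h1 h3 h4 z.2 (P.cell₀ z.1))
  exact setIntegral_mono_on (integrableOn_const (measure_ne_top _ _))
    (integrable_of_continuous (continuous_J' h1.continuous_φ _) _).integrableOn
    (P.measurableSet_cell₀ _) fun q hq => (hco z.1 hz.1).2 q hq

lemma mass_le (hlam : 0 < P.lam) (h1 : P.A1) {Jmax : ℝ} {ν : FiniteMeasure Θ} (hν : P.J ν ≤ Jmax) :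
    (ν.mass : ℝ) ≤ Jmax / P.lam := by
  rw [le_div_iff₀ hlam, mul_comm]
  have := h1.R_nonneg (P.feat ν)
  rw [J] at hν
  linarith

lemma exists_norm_φ_le (h1 : P.A1) : ∃ N, 0 ≤ N ∧ ∀ p, ‖P.φ p‖ ≤ N := by
  obtain ⟨N, hN⟩ := isCompact_univ.exists_bound_of_continuousOn h1.continuous_φ.continuousOn
  exact ⟨max N 0, le_max_right _ _, fun p => (hN p (Set.mem_univ p)).trans (le_max_left _ _)⟩

lemma exists_norm_disp_le (hlam : 0 < P.lam) (h1 : P.A1) (Jmax : ℝ) :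
    ∃ N, 0 ≤ N ∧ ∀ ν, P.J ν ≤ Jmax → ‖P.disp ν‖ ≤ N := by
  obtain ⟨N, hN0, hN⟩ := exists_norm_φ_le h1
  refine ⟨N * |Jmax / P.lam| + ‖P.fstar‖, by positivity, fun ν hν => ?_⟩
  refine (norm_sub_le _ _).trans (add_le_add_left ?_ _)
  have h := norm_integral_le_of_norm_le_const (μ := (ν : Measure Θ)) (Eventually.of_forall hN)
  refine h.trans ?_
  gcongr
  exact (mass_le hlam h1 hν).trans (le_abs_self _)

lemma exists_norm_fderiv_R_le (hlam : 0 < P.lam) (h1 : P.A1) (Jmax : ℝ) :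
    ∃ N, 0 ≤ N ∧ ∀ ν, P.J ν ≤ Jmax → ‖fderiv ℝ P.R (P.feat ν)‖ ≤ N := by
  obtain ⟨B, hB⟩ := h1.gradR_bdd Jmax
  refine ⟨|B|, abs_nonneg _, fun ν hν => ?_⟩
  rw [← norm_gradient]
  refine (hB _ ?_).trans (le_abs_self B)
  rw [J] at hν
  have : 0 ≤ P.lam * (ν.mass : ℝ) := by positivity
  linarith

lemma exists_norm_dvar_le (hlam : 0 < P.lam) (h1 : P.A1) (Jmax : ℝ) :
    ∃ N, 0 ≤ N ∧ ∀ ν, P.J ν ≤ Jmax → ‖P.dvar ν‖ ≤ N := by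
  obtain ⟨N, hN0, hN⟩ := exists_norm_fderiv_R_le hlam h1 Jmax
  exact ⟨N + ‖fderiv ℝ P.R P.fstar‖, by positivity, fun ν hν =>
    (norm_sub_le _ _).trans (add_le_add_left (hN ν hν) _)⟩

lemma hessR_eq (P : SparseProblem d m Θ F) (v w : F) : P.hessR v w = P.hessMap v w := rfl

lemma hessMap_nonneg (h5 : P.A5) (v : F) : 0 ≤ P.hessMap v v := by
  by_cases h : v = 0
  · simp [h]
  · exact (h5.hessR_pos v h).le

lemma hessMap_symm (h1 : P.A1) (v w : F) : P.hessMap v w = P.hessMap w v :=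
  ((h1.contDiffAt_R P.fstar).isSymmSndFDerivAt (by simp)).eq v w

/-- Third order Taylor estimate of the loss at `f⋆`. -/
lemma exists_bregman_taylor (h1 : P.A1) : ∃ C, 0 ≤ C ∧ ∃ ε, 0 < ε ∧ ∀ h, ‖h‖ < ε →
    |bregman P.R P.fstar h - 1 / 2 * P.hessMap h h| ≤ C * ‖h‖ ^ 3 := by
  obtain ⟨C, hC, ε, hε, h⟩ := exists_bound_of_isBigO_norm_pow
    (isBigO_taylor_two (h1.contDiffAt_R P.fstar)
    (h1.R_reg.quadApproxAt_fderiv isOpen_univ (Set.mem_univ P.fstar)))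
  refine ⟨C, hC, ε, hε, fun v hv => ?_⟩
  have := h v hv
  rwa [add_sub_cancel_left] at this

lemma isBigO_bregman_sub (hlam : 0 < P.lam) (h1 : P.A1) (h3 : P.A3) (h4 : P.A4) (Jmax : ℝ) :
    (fun z : ℝ × FiniteMeasure Θ => bregman P.R P.fstar (P.disp z.2)
      - 1 / 2 * P.hessMap (P.disp z.2) (P.disp z.2)) =O[𝓟 (P.dom Jmax)]
      fun z => ‖P.disp z.2‖ ^ 3 := by
  obtain ⟨C, hC, ε, hε, h⟩ := exists_bregman_taylor h1
  obtain ⟨N, hN0, hN⟩ := exists_norm_disp_le hlam h1 Jmax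
  set K := |Jmax - P.Jstar| + 1 / 2 * (‖P.hessMap‖ * N * N)
  have hK : 0 ≤ K := by positivity
  have hK' : 0 ≤ K / ε ^ 3 := by positivity
  refine isBigO_principal_of_norm_le (C := C + K / ε ^ 3) (by positivity) fun z hz => ?_
  rcases lt_or_ge ‖P.disp z.2‖ ε with hlt | hge
  · exact (h _ hlt).trans (by gcongr; linarith)
  · have hd := hN z.2 hz.2
    have e1 : bregman P.R P.fstar (P.disp z.2) ≤ |Jmax - P.Jstar| :=
      (bregman_le_gap h1 h4 z.2).trans ((sub_le_sub_right hz.2 _).trans (le_abs_self _))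
    have e2 := bregman_nonneg h3 (h1.differentiableAt_R P.fstar) (P.disp z.2)
    have e3 : |P.hessMap (P.disp z.2) (P.disp z.2)| ≤ ‖P.hessMap‖ * N * N :=
      (P.hessMap.le_opNorm₂ _ _).trans (by gcongr)
    have e4 : |bregman P.R P.fstar (P.disp z.2)
        - 1 / 2 * P.hessMap (P.disp z.2) (P.disp z.2)| ≤ K := by
      refine (abs_sub _ _).trans ?_
      rw [abs_of_nonneg e2, abs_mul, abs_of_pos (by norm_num : (0 : ℝ) < 1 / 2)]
      exact add_le_add e1 (mul_le_mul_of_nonneg_left e3 (by norm_num))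
    exact (le_div_pow_mul_pow e4 hK hε hge).trans (by gcongr; linarith)

lemma isBigO_dvar_sub (hlam : 0 < P.lam) (h1 : P.A1) (Jmax : ℝ) :
    (fun z : ℝ × FiniteMeasure Θ => P.dvar z.2 - P.hessMap (P.disp z.2)) =O[𝓟 (P.dom Jmax)]
      fun z => ‖P.disp z.2‖ ^ 2 := by
  obtain ⟨C, hC, ε, hε, h⟩ := exists_bound_of_isBigO_norm_pow
    (h1.R_reg.quadApproxAt_fderiv isOpen_univ (Set.mem_univ P.fstar))
  obtain ⟨N, hN0, hN⟩ := exists_norm_disp_le hlam h1 Jmax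
  obtain ⟨M, hM0, hM⟩ := exists_norm_dvar_le hlam h1 Jmax
  set K := M + ‖P.hessMap‖ * N
  have hK : 0 ≤ K := by positivity
  have hK' : 0 ≤ K / ε ^ 2 := by positivity
  refine isBigO_principal_of_norm_le (C := C + K / ε ^ 2) (by positivity) fun z hz => ?_
  rcases lt_or_ge ‖P.disp z.2‖ ε with hlt | hge
  · have := h _ hlt
    rw [add_sub_cancel_left, disp, add_sub_cancel] at this
    exact this.trans (mul_le_mul_of_nonneg_right (by linarith) (by positivity))
  · have e4 : ‖P.dvar z.2 - P.hessMap (P.disp z.2)‖ ≤ K :=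
      (norm_sub_le _ _).trans (add_le_add (hM _ hz.2)
        ((P.hessMap.le_opNorm _).trans (by gcongr; exact hN _ hz.2)))
    exact (le_div_pow_mul_pow e4 hK hε hge).trans (by gcongr; linarith)

end SparseProblem

/-! ### Biases and remainder -/

lemma isBigO_dotProduct_mulVec {α ι : Type*} [Fintype ι] {l : Filter α} (M : Matrix ι ι ℝ)
    {v w : α → ι → ℝ} {f g : α → ℝ} (hv : ∀ i, (fun z => v z i) =O[l] f)
    (hw : ∀ i, (fun z => w z i) =O[l] g) :
    (fun z => v z ⬝ᵥ (M *ᵥ w z)) =O[l] fun z => f z * g z := by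
  simp only [dotProduct, Matrix.mulVec]
  exact IsBigO.fun_sum fun i _ =>
    (hv i).mul (IsBigO.fun_sum fun j _ => (hw j).const_mul_left (M i j))

lemma isBigO_trace_mul {α ι : Type*} [Fintype ι] {l : Filter α} (M : Matrix ι ι ℝ)
    {S : α → Matrix ι ι ℝ} {f : α → ℝ} (hS : ∀ j k, (fun z => S z j k) =O[l] f) :
    (fun z => (S z * M).trace) =O[l] f := by
  simp only [Matrix.trace, Matrix.diag, Matrix.mul_apply]
  refine IsBigO.fun_sum fun j _ => IsBigO.fun_sum fun k _ => ?_
  simpa [mul_comm] using (hS j k).const_mul_left (M k j)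

lemma isBigO_clm_apply_apply {α V W : Type*} [NormedAddCommGroup V] [NormedSpace ℝ V]
    [NormedAddCommGroup W] [NormedSpace ℝ W] {l : Filter α} (B : V →L[ℝ] W →L[ℝ] ℝ)
    {v : α → V} {w : α → W} {f g : α → ℝ} (hv : v =O[l] f) (hw : w =O[l] g) :
    (fun z => B (v z) (w z)) =O[l] fun z => f z * g z :=
  (B.isBoundedBilinearMap.isBigO_comp (g := v) (h := w)).trans (hv.norm_left.mul hw.norm_left)

namespace SparseProblem

variable {d m : ℕ} {Θ F : Type*} [EMetricSpace Θ] [CompactSpace Θ] [MeasurableSpace Θ]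
  [BorelSpace Θ] [NormedAddCommGroup F] [InnerProductSpace ℝ F] [CompleteSpace F]
  [ChartedSpace (Eucl d) Θ] [IsManifold 𝓘(ℝ, Eucl d) ∞ Θ]
  [RiemannianBundle (fun p : Θ => TangentSpace 𝓘(ℝ, Eucl d) p)]
  [IsContMDiffRiemannianBundle 𝓘(ℝ, Eucl d) ∞ (Eucl d)
      (fun p : Θ => TangentSpace 𝓘(ℝ, Eucl d) p)]
  {P : SparseProblem d m Θ F}

lemma bias_zero (P : SparseProblem d m Θ F) (τ : ℝ) (ν : FiniteMeasure Θ) (i : Fin m) :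
    P.bias τ ν (i, 0) = (P.locMass τ ν i - P.r i ^ 2) / (2 * P.α * P.r i) := rfl

lemma bias_succ (P : SparseProblem d m Θ F) (τ : ℝ) (ν : FiniteMeasure Θ) (i : Fin m) (j : Fin d) :
    P.bias τ ν (i, j.succ) = P.locMass τ ν i / (P.β * P.r i) * P.locMean τ ν i j := rfl

lemma gradBar_zero (P : SparseProblem d m Θ F) (i : Fin m) :
    P.gradBar i 0 = (2 * P.α) • P.φ (P.θ i) := rfl

lemma gradBar_succ (P : SparseProblem d m Θ F) (i : Fin m) (j : Fin d) :
    P.gradBar i j.succ = P.β • P.dφ i (EuclideanSpace.single j 1) := rfl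

lemma locMass_sub_eq (h2 : P.A2) (h4 : P.A4) (τ : ℝ) (ν : FiniteMeasure Θ) (i : Fin m) :
    P.locMass τ ν i - P.r i ^ 2 = 2 * P.α * P.r i * P.bias τ ν (i, 0) := by
  have hα := h2.α_pos.ne'
  have hr := (h4.r_pos i).ne'
  rw [bias_zero]
  field_simp

lemma locMass_mul_locMean_eq (h2 : P.A2) (h4 : P.A4) (τ : ℝ) (ν : FiniteMeasure Θ) (i : Fin m)
    (j : Fin d) : P.locMass τ ν i * P.locMean τ ν i j = P.β * P.r i * P.bias τ ν (i, j.succ) := by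
  have hβ := h2.β_pos.ne'
  have hr := (h4.r_pos i).ne'
  rw [bias_succ]
  field_simp

lemma lin_bias (h2 : P.A2) (h4 : P.A4) (τ : ℝ) (ν : FiniteMeasure Θ) :
    P.lin (P.bias τ ν) = ∑ i, ((P.locMass τ ν i - P.r i ^ 2) • P.φ (P.θ i)
      + P.dφ i (P.locMass τ ν i • P.locMean τ ν i)) := by
  rw [lin, Fintype.sum_prod_type]
  refine Finset.sum_congr rfl fun i _ => ?_
  rw [Fin.sum_univ_succ]
  congr 1
  · rw [gradBar_zero, locMass_sub_eq h2 h4, smul_smul, smul_smul]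
    congr 1
    ring
  · conv_rhs => rw [← EuclideanSpace.sum_smul_single (P.locMass τ ν i • P.locMean τ ν i), map_sum]
    refine Finset.sum_congr rfl fun j _ => ?_
    rw [map_smul, gradBar_succ, smul_smul, smul_smul, PiLp.smul_apply, smul_eq_mul,
      locMass_mul_locMean_eq h2 h4]
    congr 1
    ring

/-- The remainder collects the mass away from the atoms and the second order terms of `φ` in the
cells. -/
lemma rem_eq (hx : ∀ i, IsNormalChart (P.θ i) (P.ρ i) (P.x i)) (h1 : P.A1) (h2 : P.A2)
    (h4 : P.A4) {τ : ℝ} (hτ : P.Admissible τ) (ν : FiniteMeasure Θ) :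
    P.rem τ ν = ∫ p in P.cell₀ τ, P.φ p ∂(ν : Measure Θ) +
      ∑ i, ∫ p in P.cell τ i, (P.φ p - P.φ (P.θ i) - P.dφ i (P.x i p)) ∂(ν : Measure Θ) := by
  have hφ := integrable_of_continuous h1.continuous_φ ν
  rw [rem, disp, lin_bias h2 h4, fstar, feat, feat, integral_νstar,
    integral_eq_cell₀_add_sum hτ hφ, add_sub_assoc, add_sub_assoc, ← Finset.sum_sub_distrib,
    ← Finset.sum_sub_distrib]
  congr 1
  refine Finset.sum_congr rfl fun i _ => ?_
  have hc := mem_source_of_mem_cell hx hτ i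
  have ix : IntegrableOn (fun p => P.x i p) (P.cell τ i) (ν : Measure Θ) :=
    integrableOn_comp_chart hc (g := fun y => y) continuous_id
  have i1 : IntegrableOn (fun p => P.φ p - P.φ (P.θ i)) (P.cell τ i) (ν : Measure Θ) :=
    (integrable_of_continuous (h1.continuous_φ.sub continuous_const) ν).integrableOn
  have i2 : IntegrableOn (fun p => P.dφ i (P.x i p)) (P.cell τ i) (ν : Measure Θ) :=
    (P.dφ i).integrable_comp ix
  rw [integral_sub i1 i2, integral_sub hφ.integrableOn (integrable_const _),
    (P.dφ i).integral_comp_comm ix, setIntegral_chart hc, setIntegral_const_cell]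
  module

/-- Up to an error of the order of `Δ / τ²`, the displacement is a linear function of the
biases. -/
lemma isBigO_rem (hx : ∀ i, IsNormalChart (P.θ i) (P.ρ i) (P.x i))
    (h1 : P.A1) (h2 : P.A2) (h3 : P.A3) (h4 : P.A4) (h5 : P.A5) (Jmax : ℝ) :
    (fun z : ℝ × FiniteMeasure Θ => P.rem z.1 z.2) =O[𝓟 (P.dom Jmax)]
      fun z => P.gap z.2 / z.1 ^ 2 := by
  obtain ⟨N, hN0, hN⟩ := exists_norm_φ_le h1
  have e0 : (fun z : ℝ × FiniteMeasure Θ => ∫ p in P.cell₀ z.1, P.φ p ∂(z.2 : Measure Θ))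
      =O[𝓟 (P.dom Jmax)] fun z => P.gap z.2 / z.1 ^ 2 := by
    refine IsBigO.trans (IsBigO.of_bound N (Eventually.of_forall fun z => ?_))
      (isBigO_mass_cell₀ hx h1 h2 h3 h4 h5 Jmax)
    rw [Real.norm_of_nonneg measureReal_nonneg]
    exact norm_setIntegral_le_of_norm_le_const (measure_lt_top _ _) fun p _ => hN p
  have e1 : ∀ i, (fun z : ℝ × FiniteMeasure Θ => ∫ p in P.cell z.1 i,
      (P.φ p - P.φ (P.θ i) - P.dφ i (P.x i p)) ∂(z.2 : Measure Θ))
      =O[𝓟 (P.dom Jmax)] fun z => P.gap z.2 / z.1 ^ 2 := by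
    intro i
    obtain ⟨C, hC, h⟩ := exists_cell_expansion hx h1 h4 0 i
    have e2 : (fun z : ℝ × FiniteMeasure Θ => ∫ p in P.cell z.1 i,
        (P.φ p - P.φ (P.θ i) - P.dφ i (P.x i p)) ∂(z.2 : Measure Θ))
        =O[𝓟 (P.dom Jmax)] fun z => P.secMoment z.1 z.2 i := by
      refine isBigO_principal_of_norm_le hC fun z hz => ?_
      have hc := mem_source_of_mem_cell hx hz.1 i
      rw [secMoment, ← integral_const_mul]
      refine norm_integral_le_of_norm_le (integrableOn_comp_chart hc (g := fun y => C * ‖y‖ ^ 2)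
        (by fun_prop)) ?_
      refine (ae_restrict_iff' (P.measurableSet_cell _ _)).2 (Eventually.of_forall fun q hq => ?_)
      exact (h q (hc q hq).1 (hc q hq).2).1
    refine (e2.trans (isBigO_secMoment hx h1 h2 h3 h4 h5 Jmax i)).trans ?_
    refine isBigO_principal_of_norm_le zero_le_one fun z hz => ?_
    have hg : 0 ≤ P.gap z.2 := gap_nonneg h4 z.2
    have hτ : 0 < z.1 := hz.1.1
    rw [one_mul, Real.norm_of_nonneg hg, le_div_iff₀ (by positivity)]
    exact mul_le_of_le_one_right hg (pow_le_one₀ hτ.le hz.1.2.1.le)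
  refine (e0.add (IsBigO.fun_sum fun i (_ : i ∈ Finset.univ) => e1 i)).congr' ?_ EventuallyEq.rfl
  exact eventually_principal.2 fun z hz => (rem_eq hx h1 h2 h4 hz.1 z.2).symm

lemma smallDom_subset (P : SparseProblem d m Θ F) (Jmax : ℝ) : P.smallDom Jmax ⊆ P.dom Jmax :=
  fun _ hz => hz.1

lemma sq_sqrt_gap (h4 : P.A4) (ν : FiniteMeasure Θ) : √(P.gap ν) ^ 2 = P.gap ν :=
  Real.sq_sqrt (gap_nonneg h4 ν)

lemma sqrt_gap_le {Jmax : ℝ} {z : ℝ × FiniteMeasure Θ}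
    (hz : z ∈ P.smallDom Jmax) : √(P.gap z.2) ≤ z.1 ^ 2 := by
  refine Real.sqrt_le_iff.2 ⟨by positivity, ?_⟩
  calc _ ≤ z.1 ^ 4 := hz.2
    _ = _ := by ring

lemma sqrt_gap_le_one {Jmax : ℝ} {z : ℝ × FiniteMeasure Θ}
    (hz : z ∈ P.smallDom Jmax) : √(P.gap z.2) ≤ 1 :=
  (sqrt_gap_le hz).trans (pow_le_one₀ hz.1.1.1.le hz.1.1.2.1.le)

lemma gap_div_le (h4 : P.A4) {Jmax : ℝ} {z : ℝ × FiniteMeasure Θ}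
    (hz : z ∈ P.smallDom Jmax) : P.gap z.2 / z.1 ^ 2 ≤ √(P.gap z.2) := by
  have hτ : 0 < z.1 := hz.1.1.1
  rw [div_le_iff₀ (by positivity), ← sq_sqrt_gap h4, sq, Real.sqrt_mul_self (Real.sqrt_nonneg _)]
  gcongr
  exact sqrt_gap_le hz

lemma K_mulVec_apply (P : SparseProblem d m Θ F) (v : Fin m × Fin (d + 1) → ℝ)
    (a : Fin m × Fin (d + 1)) :
    (P.K *ᵥ v) a = P.hessMap (P.r a.1 • P.gradBar a.1 a.2) (P.lin v) := by
  rw [lin, map_sum, Matrix.mulVec, dotProduct]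
  refine Finset.sum_congr rfl fun b _ => ?_
  rw [K, Matrix.of_apply, hessR_eq, map_smul (P.hessMap _) (v b), smul_eq_mul, mul_comm]

lemma dotProduct_K_mulVec (P : SparseProblem d m Θ F) (v : Fin m × Fin (d + 1) → ℝ) :
    v ⬝ᵥ (P.K *ᵥ v) = P.hessMap (P.lin v) (P.lin v) := by
  have key : ∀ w, P.hessMap (P.lin v) w
      = ∑ a, v a * P.hessMap (P.r a.1 • P.gradBar a.1 a.2) w := by
    intro w
    rw [lin, map_sum, sum_apply]
    refine Finset.sum_congr rfl fun b _ => ?_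
    rw [map_smul P.hessMap (v b), smul_apply, smul_eq_mul]
  rw [key, dotProduct]
  simp only [K_mulVec_apply]

lemma K_isSymm (h1 : P.A1) : P.K.IsSymm :=
  Matrix.IsSymm.ext fun _ _ => hessMap_symm h1 _ _

lemma norm_lin_le (P : SparseProblem d m Θ F) (v : Fin m × Fin (d + 1) → ℝ) :
    ‖P.lin v‖ ≤ (∑ a : Fin m × Fin (d + 1), ‖P.r a.1 • P.gradBar a.1 a.2‖) * √(v ⬝ᵥ v) := by
  rw [lin, Finset.sum_mul]
  refine norm_sum_le_of_le _ fun a _ => ?_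
  rw [norm_smul, mul_comm, Real.norm_eq_abs]
  gcongr
  refine Real.abs_le_sqrt ?_
  rw [sq]
  exact Finset.single_le_sum (f := fun a => v a * v a) (fun _ _ => mul_self_nonneg _)
    (Finset.mem_univ a)

/-- The biases are of the order of the square root of the excess. -/
lemma isBigO_bias (hx : ∀ i, IsNormalChart (P.θ i) (P.ρ i) (P.x i))
    (h1 : P.A1) (h2 : P.A2) (h3 : P.A3) (h4 : P.A4) (h5 : P.A5) (Jmax : ℝ)
    (a : Fin m × Fin (d + 1)) :
    (fun z : ℝ × FiniteMeasure Θ => P.bias z.1 z.2 a) =O[𝓟 (P.smallDom Jmax)]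
      fun z => √(P.gap z.2) := by
  obtain ⟨c, hc, hK⟩ := h5.K_pos.exists_le_dotProduct_mulVec (K_isSymm h1) fun v => by
    rw [dotProduct_K_mulVec]
    exact hessMap_nonneg h5 _
  obtain ⟨C, hC, ε, hε, hT⟩ := exists_bregman_taylor h1
  obtain ⟨A, hA, hr⟩ := (isBigO_rem hx h1 h2 h3 h4 h5 Jmax).exists_nonneg
  obtain ⟨N, hN, hmain⟩ := exists_le_mul_of_bregman_le (hessMap_nonneg h5)
    (fun h t ht0 ht1 => bregman_smul_le h3 P.fstar h ht0 ht1) hC hε hT hc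
    (Λ := ∑ a : Fin m × Fin (d + 1), ‖P.r a.1 • P.gradBar a.1 a.2‖)
    (Finset.sum_nonneg fun _ _ => norm_nonneg _) hA
  refine isBigO_principal_of_norm_le hN fun z hz => ?_
  set b := P.bias z.1 z.2
  have hbb : 0 ≤ b ⬝ᵥ b := Finset.sum_nonneg fun a _ => mul_self_nonneg _
  have hba : ‖b a‖ ≤ √(b ⬝ᵥ b) := by
    refine Real.abs_le_sqrt ?_
    rw [sq]
    exact Finset.single_le_sum (f := fun a => b a * b a) (fun _ _ => mul_self_nonneg _)
      (Finset.mem_univ a)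
  refine hba.trans (hmain _ _ (P.lin b) (P.rem z.1 z.2) (Real.sqrt_nonneg _) (Real.sqrt_nonneg _)
    (sqrt_gap_le_one hz) ?_ (P.norm_lin_le b) ?_ ?_)
  · rw [Real.sq_sqrt hbb, ← dotProduct_K_mulVec]
    exact hK b
  · have h := eventually_principal.1 hr.bound z hz.1
    have hg : 0 ≤ P.gap z.2 := gap_nonneg h4 z.2
    rw [Real.norm_of_nonneg (by positivity)] at h
    exact h.trans (by gcongr; exact gap_div_le h4 hz)
  · rw [sq_sqrt_gap h4, rem, add_sub_cancel]
    exact bregman_le_gap h1 h4 z.2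

end SparseProblem

/-! ### Expansion of the objective -/

namespace SparseProblem

variable {d m : ℕ} {Θ F : Type*} [EMetricSpace Θ] [CompactSpace Θ] [MeasurableSpace Θ]
  [BorelSpace Θ] [NormedAddCommGroup F] [InnerProductSpace ℝ F] [CompleteSpace F]
  [ChartedSpace (Eucl d) Θ] [IsManifold 𝓘(ℝ, Eucl d) ∞ Θ]
  [RiemannianBundle (fun p : Θ => TangentSpace 𝓘(ℝ, Eucl d) p)]
  [IsContMDiffRiemannianBundle 𝓘(ℝ, Eucl d) ∞ (Eucl d)
      (fun p : Θ => TangentSpace 𝓘(ℝ, Eucl d) p)]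
  {P : SparseProblem d m Θ F}

/-- The error `Δ τ + Δ^{3/2} τ⁻⁶` that is allowed in the expansions. -/
noncomputable def errBound (P : SparseProblem d m Θ F) (z : ℝ × FiniteMeasure Θ) : ℝ :=
  P.gap z.2 * z.1 + P.gap z.2 ^ (3 / 2 : ℝ) / z.1 ^ 6

lemma gap_rpow (h4 : P.A4) (ν : FiniteMeasure Θ) :
    P.gap ν ^ (3 / 2 : ℝ) = √(P.gap ν) * P.gap ν := by
  have h : 0 ≤ P.gap ν := gap_nonneg h4 ν
  rcases h.eq_or_lt with h0 | h0
  · rw [← h0, Real.zero_rpow (by norm_num), mul_zero]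
  · rw [Real.sqrt_eq_rpow, ← Real.rpow_add_one h0.ne']
    norm_num

lemma errBound_nonneg (h4 : P.A4) {Jmax : ℝ} {z : ℝ × FiniteMeasure Θ} (hz : z ∈ P.dom Jmax) :
    0 ≤ P.errBound z := by
  have h : 0 ≤ P.gap z.2 := gap_nonneg h4 z.2
  have hτ : 0 < z.1 := hz.1.1
  rw [errBound, gap_rpow h4]
  positivity

lemma isBigO_gap_mul (h4 : P.A4) (Jmax : ℝ) :
    (fun z : ℝ × FiniteMeasure Θ => z.1 * P.gap z.2) =O[𝓟 (P.smallDom Jmax)] P.errBound := by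
  refine isBigO_principal_of_norm_le zero_le_one fun z hz => ?_
  have h : 0 ≤ P.gap z.2 := gap_nonneg h4 z.2
  have hτ : 0 < z.1 := hz.1.1.1
  rw [Real.norm_of_nonneg (by positivity), one_mul, errBound, gap_rpow h4, mul_comm]
  have : 0 ≤ √(P.gap z.2) * P.gap z.2 / z.1 ^ 6 := by positivity
  linarith

/-- A product of a quantity of order `√Δ` with a quantity of order `Δ / τ²` is negligible. -/
lemma isBigO_errBound_of_mul (h4 : P.A4) {Jmax : ℝ} {f g : ℝ × FiniteMeasure Θ → ℝ}
    (hf : f =O[𝓟 (P.smallDom Jmax)] fun z => √(P.gap z.2))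
    (hg : g =O[𝓟 (P.smallDom Jmax)] fun z => P.gap z.2 / z.1 ^ 2) :
    (fun z => f z * g z) =O[𝓟 (P.smallDom Jmax)] P.errBound := by
  refine (hf.mul hg).trans (isBigO_principal_of_norm_le zero_le_one fun z hz => ?_)
  have h : 0 ≤ P.gap z.2 := gap_nonneg h4 z.2
  have hτ : 0 < z.1 := hz.1.1.1
  have hτ1 : z.1 ≤ 1 := hz.1.1.2.1.le
  rw [Real.norm_of_nonneg (by positivity), one_mul, errBound, gap_rpow h4, ← mul_div_assoc]
  have e1 : √(P.gap z.2) * P.gap z.2 / z.1 ^ 2 ≤ √(P.gap z.2) * P.gap z.2 / z.1 ^ 6 := by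
    apply div_le_div_of_nonneg_left (by positivity) (by positivity)
    exact pow_le_pow_of_le_one hτ.le hτ1 (by norm_num)
  have : 0 ≤ P.gap z.2 * z.1 := by positivity
  linarith

lemma isBigO_gap_div (h4 : P.A4) (Jmax : ℝ) :
    (fun z : ℝ × FiniteMeasure Θ => P.gap z.2) =O[𝓟 (P.smallDom Jmax)]
      fun z => P.gap z.2 / z.1 ^ 2 := by
  refine isBigO_principal_of_norm_le zero_le_one fun z hz => ?_
  have h : 0 ≤ P.gap z.2 := gap_nonneg h4 z.2
  have hτ : 0 < z.1 := hz.1.1.1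
  rw [Real.norm_of_nonneg h, one_mul, le_div_iff₀ (by positivity)]
  exact mul_le_of_le_one_right h (pow_le_one₀ hτ.le hz.1.1.2.1.le)

lemma isBigO_gap_div_sqrt (h4 : P.A4) (Jmax : ℝ) :
    (fun z : ℝ × FiniteMeasure Θ => P.gap z.2 / z.1 ^ 2) =O[𝓟 (P.smallDom Jmax)]
      fun z => √(P.gap z.2) := by
  refine isBigO_principal_of_norm_le zero_le_one fun z hz => ?_
  have h : 0 ≤ P.gap z.2 := gap_nonneg h4 z.2
  have hτ : 0 < z.1 := hz.1.1.1
  rw [Real.norm_of_nonneg (by positivity), one_mul]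
  exact gap_div_le h4 hz

lemma isBigO_mul_gap (h4 : P.A4) {l : Filter (ℝ × FiniteMeasure Θ)}
    {f g : ℝ × FiniteMeasure Θ → ℝ} (hf : f =O[l] fun z => √(P.gap z.2))
    (hg : g =O[l] fun z => √(P.gap z.2)) : (fun z => f z * g z) =O[l] fun z => P.gap z.2 :=
  (hf.mul hg).congr_right fun z => by rw [← sq, sq_sqrt_gap h4]

/-- On the set of small excess, an expansion has to be proved; away from it, the error bound is
at least one and a mere bound suffices. -/
lemma isBigO_errBound_of_smallDom (h4 : P.A4) {Jmax : ℝ} {f : ℝ × FiniteMeasure Θ → ℝ}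
    (hf : f =O[𝓟 (P.dom Jmax)] fun _ => (1 : ℝ))
    (hs : f =O[𝓟 (P.smallDom Jmax)] P.errBound) : f =O[𝓟 (P.dom Jmax)] P.errBound := by
  obtain ⟨A, hA, hfA⟩ := hf.exists_nonneg
  obtain ⟨B, hB, hsB⟩ := hs.exists_nonneg
  refine isBigO_principal_of_norm_le (C := A + B) (by positivity) fun z hz => ?_
  have he := errBound_nonneg h4 hz
  by_cases hgap : P.gap z.2 ≤ z.1 ^ 4
  · have := eventually_principal.1 hsB.bound z ⟨hz, hgap⟩
    rw [Real.norm_of_nonneg he] at this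
    nlinarith
  · have hτ : 0 < z.1 := hz.1.1
    have h : 0 ≤ P.gap z.2 := gap_nonneg h4 z.2
    have e1 : z.1 ^ 2 ≤ √(P.gap z.2) := by
      refine Real.le_sqrt_of_sq_le ?_
      calc _ = z.1 ^ 4 := by ring
        _ ≤ _ := (not_le.1 hgap).le
    have e2 : 1 ≤ P.errBound z := by
      rw [errBound, gap_rpow h4]
      have e3 : 1 ≤ √(P.gap z.2) * P.gap z.2 / z.1 ^ 6 := by
        rw [le_div_iff₀ (by positivity)]
        calc 1 * z.1 ^ 6 = z.1 ^ 2 * z.1 ^ 4 := by ring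
          _ ≤ _ := by
            gcongr
            exact (not_le.1 hgap).le
      have : 0 ≤ P.gap z.2 * z.1 := by positivity
      linarith
    have := eventually_principal.1 hfA.bound z hz
    rw [norm_one, mul_one] at this
    nlinarith

section Matrices

lemma H_mulVec_zero (P : SparseProblem d m Θ F) (v : Fin m × Fin (d + 1) → ℝ) (i : Fin m) :
    (P.H *ᵥ v) (i, 0) = 0 := by
  rw [Matrix.mulVec, dotProduct]
  refine Finset.sum_eq_zero fun b _ => ?_
  simp [H]

lemma H_mulVec_succ (P : SparseProblem d m Θ F) (v : Fin m × Fin (d + 1) → ℝ) (i : Fin m)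
    (j : Fin d) : (P.H *ᵥ v) (i, j.succ) = (P.Hloc i *ᵥ fun k => v (i, k.succ)) j := by
  rw [Matrix.mulVec, dotProduct, Fintype.sum_prod_type, Finset.sum_eq_single i]
  · rw [Fin.sum_univ_succ]
    simp [H, Matrix.mulVec, dotProduct]
  · intro i' _ h
    refine Finset.sum_eq_zero fun k _ => ?_
    simp [H, h.symm]
  · simp

lemma H_isSymm (hx : ∀ i, IsNormalChart (P.θ i) (P.ρ i) (P.x i)) (h1 : P.A1) : P.H.IsSymm := by
  refine Matrix.IsSymm.ext fun ⟨i, j⟩ ⟨i', j'⟩ => ?_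
  by_cases h : i = i'
  · subst h
    refine Fin.cases ?_ (fun j => ?_) j <;> refine Fin.cases ?_ (fun j' => ?_) j' <;> simp [H]
    exact (Hloc_isSymm hx h1 i).apply _ _
  · simp [H, h, Ne.symm h]

lemma dotProduct_H_mulVec (P : SparseProblem d m Θ F) (v : Fin m × Fin (d + 1) → ℝ) :
    v ⬝ᵥ (P.H *ᵥ v)
      = ∑ i, (fun k : Fin d => v (i, k.succ)) ⬝ᵥ (P.Hloc i *ᵥ fun k => v (i, k.succ)) := by
  rw [dotProduct, Fintype.sum_prod_type]
  refine Finset.sum_congr rfl fun i _ => ?_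
  rw [Fin.sum_univ_succ, H_mulVec_zero, mul_zero, zero_add]
  simp only [H_mulVec_succ]
  rfl

end Matrices

lemma bias_succ_eq_smul (P : SparseProblem d m Θ F) (τ : ℝ) (ν : FiniteMeasure Θ) (i : Fin m) :
    (fun k : Fin d => P.bias τ ν (i, k.succ))
      = (P.locMass τ ν i / (P.β * P.r i)) • (P.locMean τ ν i).ofLp := rfl

lemma isBigO_locMass_sub (hx : ∀ i, IsNormalChart (P.θ i) (P.ρ i) (P.x i))
    (h1 : P.A1) (h2 : P.A2) (h3 : P.A3) (h4 : P.A4) (h5 : P.A5) (Jmax : ℝ) (i : Fin m) :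
    (fun z : ℝ × FiniteMeasure Θ => P.locMass z.1 z.2 i - P.r i ^ 2) =O[𝓟 (P.smallDom Jmax)]
      fun z => √(P.gap z.2) := by
  simp only [locMass_sub_eq h2 h4]
  exact (isBigO_bias hx h1 h2 h3 h4 h5 Jmax _).const_mul_left _

lemma isBigO_locMass_mul_locMean (hx : ∀ i, IsNormalChart (P.θ i) (P.ρ i) (P.x i))
    (h1 : P.A1) (h2 : P.A2) (h3 : P.A3) (h4 : P.A4) (h5 : P.A5) (Jmax : ℝ) (i : Fin m)
    (j : Fin d) :
    (fun z : ℝ × FiniteMeasure Θ => P.locMass z.1 z.2 i * P.locMean z.1 z.2 i j)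
      =O[𝓟 (P.smallDom Jmax)] fun z => √(P.gap z.2) := by
  simp only [locMass_mul_locMean_eq h2 h4]
  exact (isBigO_bias hx h1 h2 h3 h4 h5 Jmax _).const_mul_left _

/-- Unlike the mean itself, the quadratic moments `ν(Θ_i) ⟨θ̄, M θ̄⟩` are controlled directly by the
second moments. -/
lemma isBigO_locMass_mul_quadratic (hx : ∀ i, IsNormalChart (P.θ i) (P.ρ i) (P.x i))
    (h1 : P.A1) (h2 : P.A2) (h3 : P.A3) (h4 : P.A4) (h5 : P.A5) (Jmax : ℝ) (i : Fin m)
    (M : Matrix (Fin d) (Fin d) ℝ) :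
    (fun z : ℝ × FiniteMeasure Θ => P.locMass z.1 z.2 i *
      ((P.locMean z.1 z.2 i).ofLp ⬝ᵥ (M *ᵥ (P.locMean z.1 z.2 i).ofLp)))
      =O[𝓟 (P.dom Jmax)] fun z => P.gap z.2 := by
  have key : ∀ j k, (fun z : ℝ × FiniteMeasure Θ =>
      P.locMass z.1 z.2 i * (P.locMean z.1 z.2 i j * P.locMean z.1 z.2 i k))
      =O[𝓟 (P.dom Jmax)] fun z => P.gap z.2 := fun j k =>
    (isBigO_principal_of_norm_le zero_le_one fun z hz => by
      rw [one_mul]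
      exact abs_locMass_mul_locMean_le (mem_source_of_mem_cell hx hz.1 i) j k).trans
      (isBigO_secMoment hx h1 h2 h3 h4 h5 Jmax i)
  simp only [dotProduct, Matrix.mulVec, Finset.mul_sum]
  refine IsBigO.fun_sum fun j _ => IsBigO.fun_sum fun k _ => ?_
  refine ((key j k).const_mul_left (M j k)).congr_left fun z => ?_
  ring

/-- The local covariances are of the order of the excess. -/
lemma isBigO_locCov (hx : ∀ i, IsNormalChart (P.θ i) (P.ρ i) (P.x i))
    (h1 : P.A1) (h2 : P.A2) (h3 : P.A3) (h4 : P.A4) (h5 : P.A5) (Jmax : ℝ) (i : Fin m)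
    (j k : Fin d) :
    (fun z : ℝ × FiniteMeasure Θ => P.locCov z.1 z.2 i j k)
      =O[𝓟 (P.smallDom Jmax)] fun z => P.gap z.2 := by
  have hβ := h2.β_pos
  have hr := h4.r_pos i
  have hsub := principal_mono.2 (P.smallDom_subset Jmax)
  have e0 : (fun z : ℝ × FiniteMeasure Θ => P.locMass z.1 z.2 i * P.locCov z.1 z.2 i j k)
      =O[𝓟 (P.smallDom Jmax)] fun z => P.gap z.2 := by
    refine ((isBigO_principal_of_norm_le (g := fun z => P.secMoment z.1 z.2 i)
      (C := (P.β ^ 2)⁻¹ * 2) (by positivity) fun z hz => ?_).trans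
      (isBigO_secMoment hx h1 h2 h3 h4 h5 Jmax i)).mono hsub
    have hc := mem_source_of_mem_cell hx hz.1 i
    have e1 := locMass_mul_locCov (ν := z.2) hc hβ.ne' j k
    have e2 := abs_setIntegral_mul_le (ν := z.2) hc j k
    have e3 := abs_locMass_mul_locMean_le (ν := z.2) hc j k
    have e4 : P.locMass z.1 z.2 i * P.locCov z.1 z.2 i j k = (P.β ^ 2)⁻¹ *
        (P.locMass z.1 z.2 i * (P.β ^ 2 * P.locCov z.1 z.2 i j k)) := by
      field_simp
    rw [e4, e1, Real.norm_eq_abs, abs_mul, abs_of_pos (by positivity), mul_assoc]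
    gcongr
    rw [secMoment]
    exact (abs_sub _ _).trans (by linarith)
  have e1 : (fun z : ℝ × FiniteMeasure Θ => P.locCov z.1 z.2 i j k)
      =O[𝓟 (P.smallDom Jmax)] fun _ => (1 : ℝ) := by
    refine (isBigO_principal_of_norm_le (C := 4 * (P.β ^ 2)⁻¹) (by positivity)
      fun z hz => ?_).mono hsub
    rw [mul_one]
    exact abs_locCov_le (mem_source_of_mem_cell hx hz.1 i) hβ.ne' j k
  have hs := isBigO_locMass_sub hx h1 h2 h3 h4 h5 Jmax i
  -- Each use of the identity `r² Σ = s Σ - (s - r²) Σ`, where `s` is the local mass, improves a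
  -- known order of `Σ` by a factor `√Δ`; the starting point is that `Σ` is bounded.
  have step : ∀ {f : ℝ × FiniteMeasure Θ → ℝ},
      (fun z : ℝ × FiniteMeasure Θ => P.locCov z.1 z.2 i j k) =O[𝓟 (P.smallDom Jmax)] f →
      (fun z => P.gap z.2) =O[𝓟 (P.smallDom Jmax)] (fun z => √(P.gap z.2) * f z) →
      (fun z : ℝ × FiniteMeasure Θ => P.locCov z.1 z.2 i j k) =O[𝓟 (P.smallDom Jmax)]
        fun z => √(P.gap z.2) * f z := fun hf hg =>
    (((e0.trans hg).sub (hs.mul hf)).const_mul_left (P.r i ^ 2)⁻¹).congr_left fun z => by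
      field_simp
      ring
  have e2 := (step e1 (by
    simpa using (isBigO_gap_div h4 Jmax).trans (isBigO_gap_div_sqrt h4 Jmax)))
  simp only [mul_one] at e2
  have hsq : ∀ z : ℝ × FiniteMeasure Θ, √(P.gap z.2) * √(P.gap z.2) = P.gap z.2 := fun z => by
    rw [← sq, sq_sqrt_gap h4]
  have e3 := step e2 (by simpa only [hsq] using isBigO_refl _ _)
  simpa only [hsq] using e3

section Displacement

lemma isBigO_lin_bias (hx : ∀ i, IsNormalChart (P.θ i) (P.ρ i) (P.x i))
    (h1 : P.A1) (h2 : P.A2) (h3 : P.A3) (h4 : P.A4) (h5 : P.A5) (Jmax : ℝ) :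
    (fun z : ℝ × FiniteMeasure Θ => P.lin (P.bias z.1 z.2)) =O[𝓟 (P.smallDom Jmax)]
      fun z => √(P.gap z.2) := by
  unfold lin
  refine IsBigO.fun_sum fun a _ => ?_
  simpa using (isBigO_bias hx h1 h2 h3 h4 h5 Jmax a).smul
    (isBigO_const_const (P.r a.1 • P.gradBar a.1 a.2) (one_ne_zero (α := ℝ)) _)

lemma isBigO_disp (hx : ∀ i, IsNormalChart (P.θ i) (P.ρ i) (P.x i))
    (h1 : P.A1) (h2 : P.A2) (h3 : P.A3) (h4 : P.A4) (h5 : P.A5) (Jmax : ℝ) :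
    (fun z : ℝ × FiniteMeasure Θ => P.disp z.2) =O[𝓟 (P.smallDom Jmax)]
      fun z => √(P.gap z.2) := by
  have hr := ((isBigO_rem hx h1 h2 h3 h4 h5 Jmax).mono
    (principal_mono.2 (P.smallDom_subset Jmax))).trans (isBigO_gap_div_sqrt h4 Jmax)
  refine ((isBigO_lin_bias hx h1 h2 h3 h4 h5 Jmax).add hr).congr_left fun z => ?_
  rw [rem, add_sub_cancel]

/-- First order expansion of the differential of the loss in terms of the biases. -/
lemma isBigO_dvar_sub_hessMap_lin (hlam : 0 < P.lam)
    (hx : ∀ i, IsNormalChart (P.θ i) (P.ρ i) (P.x i))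
    (h1 : P.A1) (h2 : P.A2) (h3 : P.A3) (h4 : P.A4) (h5 : P.A5) (Jmax : ℝ) :
    (fun z : ℝ × FiniteMeasure Θ => P.dvar z.2 - P.hessMap (P.lin (P.bias z.1 z.2)))
      =O[𝓟 (P.smallDom Jmax)] fun z => P.gap z.2 / z.1 ^ 2 := by
  have hsub := principal_mono.2 (P.smallDom_subset Jmax)
  have e1 : (fun z : ℝ × FiniteMeasure Θ => ‖P.disp z.2‖ ^ 2) =O[𝓟 (P.smallDom Jmax)]
      fun z => P.gap z.2 := by
    refine ((isBigO_disp hx h1 h2 h3 h4 h5 Jmax).norm_left.pow 2).congr_right fun z => ?_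
    rw [sq_sqrt_gap h4]
  have e2 := ((isBigO_dvar_sub hlam h1 Jmax).mono hsub).trans (e1.trans (isBigO_gap_div h4 Jmax))
  have e3 := (P.hessMap.isBigO_comp (fun z : ℝ × FiniteMeasure Θ => P.rem z.1 z.2) _).trans
    ((isBigO_rem hx h1 h2 h3 h4 h5 Jmax).mono hsub)
  refine (e2.add e3).congr_left fun z => ?_
  rw [rem, map_sub]
  abel

lemma isBigO_dvar (hlam : 0 < P.lam) (hx : ∀ i, IsNormalChart (P.θ i) (P.ρ i) (P.x i))
    (h1 : P.A1) (h2 : P.A2) (h3 : P.A3) (h4 : P.A4) (h5 : P.A5) (Jmax : ℝ) :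
    (fun z : ℝ × FiniteMeasure Θ => P.dvar z.2) =O[𝓟 (P.smallDom Jmax)]
      fun z => √(P.gap z.2) := by
  have e1 := (isBigO_dvar_sub_hessMap_lin hlam hx h1 h2 h3 h4 h5 Jmax).trans
    (isBigO_gap_div_sqrt h4 Jmax)
  have e2 := (P.hessMap.isBigO_comp (fun z : ℝ × FiniteMeasure Θ => P.lin (P.bias z.1 z.2))
    _).trans (isBigO_lin_bias hx h1 h2 h3 h4 h5 Jmax)
  refine (e1.add e2).congr_left fun z => ?_
  abel

/-- The contribution of the loss to the expansion of the objective. -/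
lemma isBigO_bregman_sub_quadratic (hlam : 0 < P.lam)
    (hx : ∀ i, IsNormalChart (P.θ i) (P.ρ i) (P.x i))
    (h1 : P.A1) (h2 : P.A2) (h3 : P.A3) (h4 : P.A4) (h5 : P.A5) (Jmax : ℝ) :
    (fun z : ℝ × FiniteMeasure Θ => bregman P.R P.fstar (P.disp z.2)
      - 1 / 2 * (P.bias z.1 z.2 ⬝ᵥ (P.K *ᵥ P.bias z.1 z.2)))
      =O[𝓟 (P.smallDom Jmax)] P.errBound := by
  have hsub := principal_mono.2 (P.smallDom_subset Jmax)
  have hd := isBigO_disp hx h1 h2 h3 h4 h5 Jmax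
  have hr := (isBigO_rem hx h1 h2 h3 h4 h5 Jmax).mono hsub
  have hl := isBigO_lin_bias hx h1 h2 h3 h4 h5 Jmax
  have e1 : (fun z : ℝ × FiniteMeasure Θ => ‖P.disp z.2‖ ^ 3) =O[𝓟 (P.smallDom Jmax)]
      P.errBound := by
    refine (isBigO_errBound_of_mul h4 hd.norm_left ((isBigO_mul_gap h4 hd.norm_left
      hd.norm_left).trans (isBigO_gap_div h4 Jmax))).congr_left fun z => ?_
    ring
  have e2 : (fun z : ℝ × FiniteMeasure Θ => P.hessMap (P.rem z.1 z.2) (P.disp z.2))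
      =O[𝓟 (P.smallDom Jmax)] P.errBound := by
    refine (isBigO_clm_apply_apply P.hessMap hr hd).trans ?_
    exact (isBigO_errBound_of_mul h4 (isBigO_refl _ _) (isBigO_refl _ _)).congr_left
      fun z => mul_comm _ _
  have e3 : (fun z : ℝ × FiniteMeasure Θ => P.hessMap (P.lin (P.bias z.1 z.2)) (P.rem z.1 z.2))
      =O[𝓟 (P.smallDom Jmax)] P.errBound :=
    (isBigO_clm_apply_apply P.hessMap hl hr).trans
      (isBigO_errBound_of_mul h4 (isBigO_refl _ _) (isBigO_refl _ _))
  refine ((((isBigO_bregman_sub hlam h1 h3 h4 Jmax).mono hsub).trans e1).add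
    ((e2.add e3).const_mul_left (1 / 2))).congr_left fun z => ?_
  rw [dotProduct_K_mulVec, rem, map_sub, map_sub, sub_apply]
  ring

end Displacement

section Objective

/-- The contribution of a cell to the expansion of the objective. -/
lemma isBigO_setIntegral_J'_sub (hx : ∀ i, IsNormalChart (P.θ i) (P.ρ i) (P.x i))
    (h1 : P.A1) (h2 : P.A2) (h3 : P.A3) (h4 : P.A4) (h5 : P.A5) (Jmax : ℝ) (i : Fin m) :
    (fun z : ℝ × FiniteMeasure Θ => ∫ p in P.cell z.1 i, P.J' P.νstar p ∂(z.2 : Measure Θ)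
      - 1 / 2 * ((fun k : Fin d => P.bias z.1 z.2 (i, k.succ)) ⬝ᵥ
          (P.Hloc i *ᵥ fun k => P.bias z.1 z.2 (i, k.succ)))
      - 1 / 2 * (P.r i ^ 2 * (P.locCov z.1 z.2 i * P.Hloc i).trace))
      =O[𝓟 (P.smallDom Jmax)] P.errBound := by
  have hβ := h2.β_pos
  have hr := h4.r_pos i
  have hsub := principal_mono.2 (P.smallDom_subset Jmax)
  obtain ⟨C, hC, hexp⟩ := exists_cell_expansion hx h1 h4 0 i
  have e1 : (fun z : ℝ × FiniteMeasure Θ =>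
      ∫ p in P.cell z.1 i, P.J' P.νstar p ∂(z.2 : Measure Θ)
      - ∫ p in P.cell z.1 i, 1 / 2 * P.hessJ' i (P.x i p) (P.x i p) ∂(z.2 : Measure Θ))
      =O[𝓟 (P.smallDom Jmax)] P.errBound := by
    refine IsBigO.trans (g := fun z => z.1 * P.secMoment z.1 z.2 i) ?_
      (((isBigO_refl _ _).mul ((isBigO_secMoment hx h1 h2 h3 h4 h5 Jmax i).mono hsub)).trans
        (isBigO_gap_mul h4 Jmax))
    refine isBigO_principal_of_norm_le hC fun z hz => ?_
    have hc := mem_source_of_mem_cell hx hz.1.1 i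
    rw [secMoment, ← integral_const_mul, ← integral_const_mul, ← integral_sub
      (integrable_of_continuous (continuous_J' h1.continuous_φ _) _).integrableOn
      (integrableOn_comp_chart hc (g := fun y => 1 / 2 * P.hessJ' i y y) (by fun_prop))]
    refine norm_integral_le_of_norm_le (integrableOn_comp_chart hc
      (g := fun y => C * (z.1 * ‖y‖ ^ 2)) (by fun_prop)) ?_
    refine (ae_restrict_iff' (P.measurableSet_cell _ _)).2 (Eventually.of_forall fun q hq => ?_)
    refine ((hexp q (hc q hq).1 (hc q hq).2).2.1).trans ?_
    have hn := ((mem_cell_iff hx (hz.1.1.2.2.1 i).le).1 hq).2.le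
    calc C * ‖P.x i q‖ ^ 3 = C * (‖P.x i q‖ * ‖P.x i q‖ ^ 2) := by ring
      _ ≤ _ := by gcongr
  have hs := isBigO_locMass_sub hx h1 h2 h3 h4 h5 Jmax i
  have htr := (isBigO_trace_mul (P.Hloc i) (isBigO_locCov hx h1 h2 h3 h4 h5 Jmax i)).trans
    (isBigO_gap_div h4 Jmax)
  have hq := ((isBigO_locMass_mul_quadratic hx h1 h2 h3 h4 h5 Jmax i (P.Hloc i)).mono hsub).trans
    (isBigO_gap_div h4 Jmax)
  refine ((e1.add ((isBigO_errBound_of_mul h4 hs htr).const_mul_left (1 / 2))).sub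
    ((isBigO_errBound_of_mul h4 hs hq).const_mul_left (1 / 2 * (P.β ^ 2)⁻¹ * (P.r i ^ 2)⁻¹))).congr'
    (eventually_principal.2 fun z hz => ?_) EventuallyEq.rfl
  have hc := mem_source_of_mem_cell hx hz.1.1 i
  have e2 : ∫ p in P.cell z.1 i, 1 / 2 * P.hessJ' i (P.x i p) (P.x i p) ∂(z.2 : Measure Θ)
      = 1 / 2 * ((P.β ^ 2)⁻¹ * (P.locMass z.1 z.2 i *
        (P.β ^ 2 * (P.locCov z.1 z.2 i * P.Hloc i).trace) + P.locMass z.1 z.2 i *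
        ((P.locMean z.1 z.2 i).ofLp ⬝ᵥ (P.Hloc i *ᵥ (P.locMean z.1 z.2 i).ofLp)))) := by
    simp only [hessJ'_eq h2]
    rw [integral_const_mul, integral_const_mul, setIntegral_quadratic hc hβ.ne']
  simp only [e2, bias_succ_eq_smul, Matrix.mulVec_smul, dotProduct_smul, smul_dotProduct,
    smul_eq_mul]
  field_simp
  ring

/-- The expansion of the objective, for a small excess. -/
lemma isBigO_gap_expansion (hlam : 0 < P.lam)
    (hx : ∀ i, IsNormalChart (P.θ i) (P.ρ i) (P.x i))
    (h1 : P.A1) (h2 : P.A2) (h3 : P.A3) (h4 : P.A4) (h5 : P.A5) (Jmax : ℝ) :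
    (fun z : ℝ × FiniteMeasure Θ => P.gap z.2 -
      (1 / 2 * (P.bias z.1 z.2 ⬝ᵥ ((P.K + P.H) *ᵥ P.bias z.1 z.2))
        + 1 / 2 * ∑ i, P.r i ^ 2 * (P.locCov z.1 z.2 i * P.Hloc i).trace
        + ∫ p in P.cell₀ z.1, P.J' P.νstar p ∂(z.2 : Measure Θ)))
      =O[𝓟 (P.smallDom Jmax)] P.errBound := by
  refine ((isBigO_bregman_sub_quadratic hlam hx h1 h2 h3 h4 h5 Jmax).add
    (IsBigO.fun_sum fun i (_ : i ∈ Finset.univ) =>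
      isBigO_setIntegral_J'_sub hx h1 h2 h3 h4 h5 Jmax i)).congr'
    (eventually_principal.2 fun z hz => ?_) EventuallyEq.rfl
  dsimp only
  rw [gap, gap_eq h1.continuous_φ (h1.differentiableAt_R _) h4, ← disp,
    integral_eq_cell₀_add_sum hz.1.1
      (integrable_of_continuous (continuous_J' h1.continuous_φ P.νstar) z.2),
    Matrix.add_mulVec, dotProduct_add, dotProduct_H_mulVec, Finset.sum_sub_distrib,
    Finset.sum_sub_distrib, ← Finset.mul_sum, ← Finset.mul_sum]
  ring

end Objective

end SparseProblem

/-! ### Expansion of the gradient norm -/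

lemma Matrix.IsSymm.dotProduct_mulVec_self {n : Type*} [Fintype n] [DecidableEq n]
    {H : Matrix n n ℝ} (hH : H.IsSymm) (v : n → ℝ) :
    (H *ᵥ v) ⬝ᵥ (H *ᵥ v) = v ⬝ᵥ (H ^ 2 *ᵥ v) := by
  rw [sq, ← Matrix.mulVec_mulVec, Matrix.dotProduct_mulVec v, ← Matrix.mulVec_transpose, hH.eq]

namespace SparseProblem

variable {d m : ℕ} {Θ F : Type*} [EMetricSpace Θ] [CompactSpace Θ] [MeasurableSpace Θ]
  [BorelSpace Θ] [NormedAddCommGroup F] [InnerProductSpace ℝ F] [CompleteSpace F]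
  [ChartedSpace (Eucl d) Θ] [IsManifold 𝓘(ℝ, Eucl d) ∞ Θ]
  [RiemannianBundle (fun p : Θ => TangentSpace 𝓘(ℝ, Eucl d) p)]
  [IsContMDiffRiemannianBundle 𝓘(ℝ, Eucl d) ∞ (Eucl d)
      (fun p : Θ => TangentSpace 𝓘(ℝ, Eucl d) p)]
  {P : SparseProblem d m Θ F}

/-- The coordinates, along the frame of the normal coordinates at `θ i`, of the differential at
the origin of `ℓ ∘ φ`. -/
noncomputable def frameVals (P : SparseProblem d m Θ F) (i : Fin m) (ℓ : F →L[ℝ] ℝ)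
    (j : Fin d) : ℝ :=
  ℓ (P.dφ i (EuclideanSpace.single j 1))

lemma setIntegral_sq_norm_hessJ'_add (hx : ∀ i, IsNormalChart (P.θ i) (P.ρ i) (P.x i))
    (h1 : P.A1) (h2 : P.A2) {τ : ℝ} (hτ : P.Admissible τ) (ν : FiniteMeasure Θ) (i : Fin m)
    (ℓ : F →L[ℝ] ℝ) :
    ∫ p in P.cell τ i, ‖P.hessJ' i (P.x i p) + ℓ.comp (P.dφ i)‖ ^ 2 ∂(ν : Measure Θ)
      = ((P.β ^ 2)⁻¹) ^ 2 * (P.locMass τ ν i * (P.β ^ 2 * (P.locCov τ ν i * P.Hloc i ^ 2).trace)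
          + P.locMass τ ν i *
            ((P.locMean τ ν i).ofLp ⬝ᵥ (P.Hloc i ^ 2 *ᵥ (P.locMean τ ν i).ofLp)))
        + 2 * (P.β ^ 2)⁻¹ * (P.locMass τ ν i *
            (P.frameVals i ℓ ⬝ᵥ (P.Hloc i *ᵥ (P.locMean τ ν i).ofLp)))
        + P.locMass τ ν i * (P.frameVals i ℓ ⬝ᵥ P.frameVals i ℓ) := by
  have hc := mem_source_of_mem_cell hx hτ i
  have hS := Hloc_isSymm hx h1 i
  have e1 : ∀ v : Eucl d, ‖P.hessJ' i v + ℓ.comp (P.dφ i)‖ ^ 2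
      = ((P.β ^ 2)⁻¹) ^ 2 * (v.ofLp ⬝ᵥ (P.Hloc i ^ 2 *ᵥ v.ofLp))
        + 2 * (P.β ^ 2)⁻¹ * ((P.frameVals i ℓ ᵥ* P.Hloc i) ⬝ᵥ v.ofLp)
        + P.frameVals i ℓ ⬝ᵥ P.frameVals i ℓ := fun v => by
    rw [sq_norm_hessJ'_add h2 i hS, ← hS.dotProduct_mulVec_self, ← Matrix.dotProduct_mulVec]
    simp only [dotProduct, Finset.mul_sum]
    rw [← Finset.sum_add_distrib, ← Finset.sum_add_distrib]
    refine Finset.sum_congr rfl fun k _ => ?_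
    rw [frameVals]
    ring
  have e2 : ∫ p in P.cell τ i, (P.frameVals i ℓ ᵥ* P.Hloc i) ⬝ᵥ (P.x i p).ofLp ∂(ν : Measure Θ)
      = P.locMass τ ν i * (P.frameVals i ℓ ⬝ᵥ (P.Hloc i *ᵥ (P.locMean τ ν i).ofLp)) := by
    rw [Matrix.dotProduct_mulVec]
    simp only [dotProduct]
    rw [integral_finsetSum _ fun j _ => integrableOn_comp_chart hc
      (g := fun y => (P.frameVals i ℓ ᵥ* P.Hloc i) j * y j) (by fun_prop), Finset.mul_sum]
    refine Finset.sum_congr rfl fun j _ => ?_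
    rw [integral_const_mul, setIntegral_chart_apply hc]
    ring
  simp only [e1]
  rw [integral_add, integral_add, integral_const_mul, integral_const_mul,
    setIntegral_quadratic hc h2.β_pos.ne', e2, setIntegral_const_cell, smul_eq_mul]
  · exact integrableOn_comp_chart hc
      (g := fun y => ((P.β ^ 2)⁻¹) ^ 2 * (y.ofLp ⬝ᵥ (P.Hloc i ^ 2 *ᵥ y.ofLp))) (by fun_prop)
  · exact integrableOn_comp_chart hc
      (g := fun y => 2 * (P.β ^ 2)⁻¹ * ((P.frameVals i ℓ ᵥ* P.Hloc i) ⬝ᵥ y.ofLp)) (by fun_prop)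
  · exact integrableOn_comp_chart hc
      (g := fun y => ((P.β ^ 2)⁻¹) ^ 2 * (y.ofLp ⬝ᵥ (P.Hloc i ^ 2 *ᵥ y.ofLp))
        + 2 * (P.β ^ 2)⁻¹ * ((P.frameVals i ℓ ᵥ* P.Hloc i) ⬝ᵥ y.ofLp)) (by fun_prop)
  · exact integrable_const _

lemma J'_eq_add_dvar (P : SparseProblem d m Θ F) (ν : FiniteMeasure Θ) (p : Θ) :
    P.J' ν p = P.J' P.νstar p + P.dvar ν (P.φ p) := by
  rw [J'_eq, J'_eq, dvar, sub_apply, fstar]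
  ring

/-- The integrand of the squared norm of the gradient. -/
noncomputable def gradDensity (P : SparseProblem d m Θ F) (ν : FiniteMeasure Θ) (p : Θ) : ℝ :=
  4 * P.α * P.J' ν p ^ 2 + P.β * ‖riemGrad d (P.J' ν) p‖ ^ 2

lemma exists_abs_gradDensity_le (hlam : 0 < P.lam) (h1 : P.A1) (h2 : P.A2) (Jmax : ℝ) :
    ∃ C, 0 ≤ C ∧ ∀ ν, P.J ν ≤ Jmax → ∀ p, |P.gradDensity ν p| ≤ C := by
  obtain ⟨N, hN, hφ⟩ := exists_norm_φ_le h1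
  obtain ⟨M, hM, hR⟩ := exists_norm_fderiv_R_le hlam h1 Jmax
  obtain ⟨G, hG, hgrad⟩ := exists_norm_riemGrad_le h1.φ_reg.contMDiff
  have hα := h2.α_pos
  have hβ := h2.β_pos
  refine ⟨4 * P.α * (M * N + P.lam) ^ 2 + P.β * (G * M) ^ 2, by positivity, fun ν hν p => ?_⟩
  rw [gradDensity, abs_of_nonneg (by positivity)]
  have e1 : P.J' ν p ^ 2 ≤ (M * N + P.lam) ^ 2 := by
    rw [← sq_abs]
    gcongr
    rw [J'_eq]
    refine (abs_add_le _ _).trans ?_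
    rw [abs_of_pos hlam]
    gcongr
    refine ((fderiv ℝ P.R (P.feat ν)).le_opNorm _).trans ?_
    gcongr
    · exact hR ν hν
    · exact hφ p
  have e2 : ‖riemGrad d (P.J' ν) p‖ ≤ G * M := by
    rw [J'_eq]
    exact (hgrad _ _ _).trans (by gcongr; exact hR ν hν)
  gcongr

/-- The density is bounded, and measurable as the norm of the gradient is lower semicontinuous. -/
lemma integrable_gradDensity (h1 : P.A1) (ν μ : FiniteMeasure Θ) :
    Integrable (P.gradDensity ν) (μ : Measure Θ) := by
  obtain ⟨G, hG, hgrad⟩ := exists_norm_riemGrad_le h1.φ_reg.contMDiff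
  have hJ := continuous_J' h1.continuous_φ ν
  refine Integrable.add (integrable_of_continuous (by fun_prop) μ) (Integrable.const_mul ?_ _)
  refine Integrable.of_bound ((lowerSemicontinuous_sq_norm_riemGrad
    ((h1.contMDiff_J' ν).of_le one_le_two)).measurable.aestronglyMeasurable)
    ((G * ‖fderiv ℝ P.R (P.feat ν)‖) ^ 2) (Eventually.of_forall fun p => ?_)
  rw [Real.norm_of_nonneg (by positivity), J'_eq]
  gcongr
  exact hgrad _ _ _

lemma gradSq_univ (h1 : P.A1) {τ : ℝ} (hτ : P.Admissible τ) (ν : FiniteMeasure Θ) :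
    P.gradSq ν Set.univ = P.gradSq ν (P.cell₀ τ) + ∑ i, P.gradSq ν (P.cell τ i) := by
  rw [gradSq, Measure.restrict_univ]
  exact integral_eq_cell₀_add_sum hτ (integrable_gradDensity h1 ν ν)

/-- Near `θ i`, the density of the squared gradient norm is, up to the third order, a quadratic
polynomial in the normal coordinates. -/
lemma exists_gradDensity_sub_le (hx : ∀ i, IsNormalChart (P.θ i) (P.ρ i) (P.x i))
    (h1 : P.A1) (h2 : P.A2) (h4 : P.A4) (M : ℝ) (i : Fin m) :
    ∃ C, 0 ≤ C ∧ ∀ q ∈ (P.x i).source, ‖P.x i q‖ < 1 → ∀ ν : FiniteMeasure Θ, ‖P.dvar ν‖ ≤ M →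
      |P.gradDensity ν q - (4 * P.α * P.dvar ν (P.φ (P.θ i)) ^ 2
        + P.β * ‖P.hessJ' i (P.x i q) + (P.dvar ν).comp (P.dφ i)‖ ^ 2)|
        ≤ C * (‖P.x i q‖ * (‖P.x i q‖ + ‖P.dvar ν‖) ^ 2) := by
  have hα := h2.α_pos
  have hβ := h2.β_pos
  obtain ⟨C, hC, hexp⟩ := exists_cell_expansion hx h1 h4 M i
  set A := C + ‖P.hessJ' i‖ + ‖P.dφ i‖
  have hA : 0 ≤ A := by positivity
  set N := ‖P.φ (P.θ i)‖
  refine ⟨4 * P.α * (A * (A + 2 * N)) + P.β * C, by positivity, fun q hq hq1 ν hν => ?_⟩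
  obtain ⟨a1, a2, a3⟩ := hexp q hq hq1
  set t := ‖P.x i q‖
  set ℓ := P.dvar ν
  have ht : 0 ≤ t := norm_nonneg _
  have b1 : |P.J' P.νstar q| ≤ A * t ^ 2 := by
    have c1 : |P.hessJ' i (P.x i q) (P.x i q)| ≤ ‖P.hessJ' i‖ * t * t :=
      (P.hessJ' i).le_opNorm₂ _ _
    have c2 : C * t ^ 3 ≤ C * t ^ 2 :=
      mul_le_mul_of_nonneg_left (pow_le_pow_of_le_one ht hq1.le (by norm_num)) hC
    have c3 := abs_add_le (P.J' P.νstar q - 1 / 2 * P.hessJ' i (P.x i q) (P.x i q))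
      (1 / 2 * P.hessJ' i (P.x i q) (P.x i q))
    rw [sub_add_cancel, abs_mul (1 / 2), abs_of_pos (by norm_num : (0 : ℝ) < 1 / 2)] at c3
    have c4 : 0 ≤ ‖P.hessJ' i‖ * t ^ 2 := by positivity
    have c5 : 0 ≤ ‖P.dφ i‖ * t ^ 2 := by positivity
    simp only [A]
    linarith
  have b2 : ‖P.φ q - P.φ (P.θ i)‖ ≤ A * t := by
    have c1 := norm_add_le (P.φ q - P.φ (P.θ i) - P.dφ i (P.x i q)) (P.dφ i (P.x i q))
    rw [sub_add_cancel] at c1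
    have c2 : C * t ^ 2 ≤ C * t := by
      gcongr
      exact pow_le_of_le_one ht hq1.le two_ne_zero
    have c3 : ‖P.dφ i (P.x i q)‖ ≤ ‖P.dφ i‖ * t := (P.dφ i).le_opNorm _
    have c4 : 0 ≤ ‖P.hessJ' i‖ * t := by positivity
    simp only [A]
    linarith
  have b3 : |P.J' ν q - ℓ (P.φ (P.θ i))| ≤ A * t * (t + ‖ℓ‖) := by
    have c1 : P.J' ν q - ℓ (P.φ (P.θ i)) = P.J' P.νstar q + ℓ (P.φ q - P.φ (P.θ i)) := by
      rw [J'_eq_add_dvar, map_sub]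
      ring
    have c2 : |ℓ (P.φ q - P.φ (P.θ i))| ≤ ‖ℓ‖ * (A * t) :=
      (ℓ.le_opNorm _).trans (by gcongr)
    rw [c1]
    linarith [abs_add_le (P.J' P.νstar q) (ℓ (P.φ q - P.φ (P.θ i)))]
  have b4 : |P.J' ν q + ℓ (P.φ (P.θ i))| ≤ (A + 2 * N) * (t + ‖ℓ‖) := by
    have c1 : P.J' ν q + ℓ (P.φ (P.θ i))
        = (P.J' ν q - ℓ (P.φ (P.θ i))) + 2 * ℓ (P.φ (P.θ i)) := by ring
    have c2 : |ℓ (P.φ (P.θ i))| ≤ ‖ℓ‖ * N := ℓ.le_opNorm _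
    have c3 : A * t * (t + ‖ℓ‖) ≤ A * (t + ‖ℓ‖) := by
      gcongr
      exact mul_le_of_le_one_right hA hq1.le
    have c4 : 0 ≤ N * t := by positivity
    have c5 := abs_add_le (P.J' ν q - ℓ (P.φ (P.θ i))) (2 * ℓ (P.φ (P.θ i)))
    rw [abs_mul 2, abs_of_pos (by norm_num : (0 : ℝ) < 2)] at c5
    rw [c1]
    linarith
  have b5 : |P.J' ν q ^ 2 - ℓ (P.φ (P.θ i)) ^ 2| ≤ A * (A + 2 * N) * (t * (t + ‖ℓ‖) ^ 2) := by
    rw [sq_sub_sq, abs_mul]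
    calc _ ≤ (A + 2 * N) * (t + ‖ℓ‖) * (A * t * (t + ‖ℓ‖)) := by gcongr
      _ = _ := by ring
  have e : P.gradDensity ν q - (4 * P.α * ℓ (P.φ (P.θ i)) ^ 2
      + P.β * ‖P.hessJ' i (P.x i q) + ℓ.comp (P.dφ i)‖ ^ 2)
      = 4 * P.α * (P.J' ν q ^ 2 - ℓ (P.φ (P.θ i)) ^ 2)
        + P.β * (‖riemGrad d (P.J' ν) q‖ ^ 2
          - ‖P.hessJ' i (P.x i q) + ℓ.comp (P.dφ i)‖ ^ 2) := by
    rw [gradDensity]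
    ring
  rw [e]
  refine (abs_add_le _ _).trans ?_
  rw [abs_mul, abs_mul P.β, abs_of_pos (by positivity : 0 < 4 * P.α), abs_of_pos hβ]
  calc _ ≤ 4 * P.α * (A * (A + 2 * N) * (t * (t + ‖ℓ‖) ^ 2))
        + P.β * (C * (t * (t + ‖ℓ‖) ^ 2)) := by
        gcongr
        exact a3 ν hν
    _ = _ := by ring

/-- The squared gradient norm on a cell is, up to a negligible error, the integral of a quadratic
polynomial in the normal coordinates. -/
lemma isBigO_gradSq_cell_sub (hlam : 0 < P.lam)
    (hx : ∀ i, IsNormalChart (P.θ i) (P.ρ i) (P.x i))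
    (h1 : P.A1) (h2 : P.A2) (h3 : P.A3) (h4 : P.A4) (h5 : P.A5) (Jmax : ℝ) (i : Fin m) :
    (fun z : ℝ × FiniteMeasure Θ => P.gradSq z.2 (P.cell z.1 i)
      - (4 * P.α * (P.locMass z.1 z.2 i * P.dvar z.2 (P.φ (P.θ i)) ^ 2)
        + P.β * ∫ p in P.cell z.1 i, ‖P.hessJ' i (P.x i p) + (P.dvar z.2).comp (P.dφ i)‖ ^ 2
          ∂(z.2 : Measure Θ))) =O[𝓟 (P.smallDom Jmax)] P.errBound := by
  obtain ⟨M, hM, hdv⟩ := exists_norm_dvar_le hlam h1 Jmax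
  obtain ⟨C, hC, hexp⟩ := exists_gradDensity_sub_le hx h1 h2 h4 M i
  have hsub := principal_mono.2 (P.smallDom_subset Jmax)
  have hd := isBigO_dvar hlam hx h1 h2 h3 h4 h5 Jmax
  have hm : (fun z : ℝ × FiniteMeasure Θ => P.locMass z.1 z.2 i) =O[𝓟 (P.smallDom Jmax)]
      fun _ => (1 : ℝ) := by
    refine isBigO_principal_of_norm_le (C := |Jmax / P.lam|) (abs_nonneg _) fun z hz => ?_
    rw [Real.norm_of_nonneg (P.locMass_nonneg _ _ _), mul_one]
    exact ((P.locMass_le_mass _ _ _).trans (mass_le hlam h1 hz.1.2)).trans (le_abs_self _)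
  have e1 : (fun z : ℝ × FiniteMeasure Θ => 2 * P.secMoment z.1 z.2 i
      + 2 * (P.locMass z.1 z.2 i * (‖P.dvar z.2‖ * ‖P.dvar z.2‖))) =O[𝓟 (P.smallDom Jmax)]
      fun z => P.gap z.2 :=
    (((isBigO_secMoment hx h1 h2 h3 h4 h5 Jmax i).mono hsub).const_mul_left 2).add
      (((hm.mul (isBigO_mul_gap h4 hd.norm_left hd.norm_left)).congr_right
        fun z => one_mul _).const_mul_left 2)
  refine IsBigO.trans (isBigO_principal_of_norm_le (g := fun z => z.1 * (2 * P.secMoment z.1 z.2 i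
      + 2 * (P.locMass z.1 z.2 i * (‖P.dvar z.2‖ * ‖P.dvar z.2‖)))) hC fun z hz => ?_)
    (((isBigO_refl _ _).mul e1).trans (isBigO_gap_mul h4 Jmax))
  have hc := mem_source_of_mem_cell hx hz.1.1 i
  set ℓ := P.dvar z.2
  have i1 : IntegrableOn (fun p => ‖P.hessJ' i (P.x i p) + ℓ.comp (P.dφ i)‖ ^ 2) (P.cell z.1 i)
      (z.2 : Measure Θ) := integrableOn_comp_chart hc
    (g := fun y => ‖P.hessJ' i y + ℓ.comp (P.dφ i)‖ ^ 2) (by fun_prop)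
  have e2 : 4 * P.α * (P.locMass z.1 z.2 i * ℓ (P.φ (P.θ i)) ^ 2)
      + P.β * ∫ p in P.cell z.1 i, ‖P.hessJ' i (P.x i p) + ℓ.comp (P.dφ i)‖ ^ 2
        ∂(z.2 : Measure Θ)
      = ∫ p in P.cell z.1 i, (4 * P.α * ℓ (P.φ (P.θ i)) ^ 2
        + P.β * ‖P.hessJ' i (P.x i p) + ℓ.comp (P.dφ i)‖ ^ 2) ∂(z.2 : Measure Θ) := by
    rw [integral_add (integrable_const _) (i1.const_mul _), setIntegral_const_cell,
      integral_const_mul, smul_eq_mul]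
    ring
  have e3 : C * (z.1 * (2 * P.secMoment z.1 z.2 i + 2 * (P.locMass z.1 z.2 i * (‖ℓ‖ * ‖ℓ‖))))
      = ∫ p in P.cell z.1 i, C * (z.1 * (2 * ‖P.x i p‖ ^ 2 + 2 * (‖ℓ‖ * ‖ℓ‖)))
        ∂(z.2 : Measure Θ) := by
    rw [integral_const_mul, integral_const_mul, integral_add
      (integrableOn_comp_chart hc (g := fun y => 2 * ‖y‖ ^ 2) (by fun_prop))
      (integrable_const _), integral_const_mul, setIntegral_const_cell, secMoment, smul_eq_mul]
    ring
  have i2 : IntegrableOn (fun p => 4 * P.α * ℓ (P.φ (P.θ i)) ^ 2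
      + P.β * ‖P.hessJ' i (P.x i p) + ℓ.comp (P.dφ i)‖ ^ 2) (P.cell z.1 i) (z.2 : Measure Θ) :=
    (integrable_const _).add (i1.const_mul _)
  have e4 : P.gradSq z.2 (P.cell z.1 i)
      = ∫ p in P.cell z.1 i, P.gradDensity z.2 p ∂(z.2 : Measure Θ) := rfl
  rw [e2, e3, e4, ← integral_sub (integrable_gradDensity h1 z.2 z.2).integrableOn i2]
  refine norm_integral_le_of_norm_le (integrableOn_comp_chart hc
    (g := fun y => C * (z.1 * (2 * ‖y‖ ^ 2 + 2 * (‖ℓ‖ * ‖ℓ‖)))) (by fun_prop)) ?_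
  refine (ae_restrict_iff' (P.measurableSet_cell _ _)).2 (Eventually.of_forall fun q hq => ?_)
  refine (hexp q (hc q hq).1 (hc q hq).2 z.2 (hdv z.2 hz.1.2)).trans ?_
  have hn := ((mem_cell_iff hx (hz.1.1.2.2.1 i).le).1 hq).2.le
  have hτ := hz.1.1.1.le
  gcongr
  nlinarith [sq_nonneg (‖P.x i q‖ - ‖ℓ‖)]

/-- Replacing the local mass and the variation of the loss by their first order values is
harmless in `ν(Θ_i) (dR(f_ν) u - dR(f⋆) u)²`. -/
lemma isBigO_locMass_mul_sq_dvar_sub (hlam : 0 < P.lam)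
    (hx : ∀ i, IsNormalChart (P.θ i) (P.ρ i) (P.x i))
    (h1 : P.A1) (h2 : P.A2) (h3 : P.A3) (h4 : P.A4) (h5 : P.A5) (Jmax : ℝ) (i : Fin m) (u : F) :
    (fun z : ℝ × FiniteMeasure Θ => P.locMass z.1 z.2 i * P.dvar z.2 u ^ 2
      - P.r i ^ 2 * P.hessMap (P.lin (P.bias z.1 z.2)) u ^ 2)
      =O[𝓟 (P.smallDom Jmax)] P.errBound := by
  have hd := ((ContinuousLinearMap.apply ℝ ℝ u).isBigO_comp
    (fun z : ℝ × FiniteMeasure Θ => P.dvar z.2) _).trans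
    (isBigO_dvar hlam hx h1 h2 h3 h4 h5 Jmax)
  have he := ((ContinuousLinearMap.apply ℝ ℝ u).isBigO_comp
    (fun z : ℝ × FiniteMeasure Θ => P.dvar z.2 - P.hessMap (P.lin (P.bias z.1 z.2))) _).trans
    (isBigO_dvar_sub_hessMap_lin hlam hx h1 h2 h3 h4 h5 Jmax)
  have hk := hd.sub (he.trans (isBigO_gap_div_sqrt h4 Jmax))
  have hs := isBigO_locMass_sub hx h1 h2 h3 h4 h5 Jmax i
  refine ((isBigO_errBound_of_mul h4 hs ((isBigO_mul_gap h4 hd hd).trans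
    (isBigO_gap_div h4 Jmax))).add
    ((isBigO_errBound_of_mul h4 (hd.add hk) he).const_mul_left (P.r i ^ 2))).congr_left fun z => ?_
  simp only [ContinuousLinearMap.apply_apply, sub_apply]
  ring

/-- The same replacement in the cross term between the mean and the variation of the loss. -/
lemma isBigO_locMass_mul_dotProduct (hlam : 0 < P.lam)
    (hx : ∀ i, IsNormalChart (P.θ i) (P.ρ i) (P.x i))
    (h1 : P.A1) (h2 : P.A2) (h3 : P.A3) (h4 : P.A4) (h5 : P.A5) (Jmax : ℝ) (i : Fin m) :
    (fun z : ℝ × FiniteMeasure Θ => P.locMass z.1 z.2 i *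
      ((P.frameVals i (P.dvar z.2) - P.frameVals i (P.hessMap (P.lin (P.bias z.1 z.2)))) ⬝ᵥ
        (P.Hloc i *ᵥ (P.locMean z.1 z.2 i).ofLp)))
      =O[𝓟 (P.smallDom Jmax)] P.errBound := by
  have e1 := isBigO_dotProduct_mulVec (P.Hloc i)
    (v := fun z : ℝ × FiniteMeasure Θ =>
      P.frameVals i (P.dvar z.2) - P.frameVals i (P.hessMap (P.lin (P.bias z.1 z.2))))
    (w := fun z => P.locMass z.1 z.2 i • (P.locMean z.1 z.2 i).ofLp)
    (fun j => ((ContinuousLinearMap.apply ℝ ℝ (P.dφ i (EuclideanSpace.single j 1))).isBigO_comp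
      (fun z : ℝ × FiniteMeasure Θ => P.dvar z.2 - P.hessMap (P.lin (P.bias z.1 z.2))) _).trans
      (isBigO_dvar_sub_hessMap_lin hlam hx h1 h2 h3 h4 h5 Jmax))
    (isBigO_locMass_mul_locMean hx h1 h2 h3 h4 h5 Jmax i)
  refine (e1.trans ((isBigO_errBound_of_mul h4 (isBigO_refl _ _) (isBigO_refl _ _)).congr_left
    fun z => mul_comm _ _)).congr_left fun z => ?_
  rw [Matrix.mulVec_smul, dotProduct_smul, smul_eq_mul]

/-- The contribution of the cell `i` to the quadratic form of the expansion of the gradient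
norm. -/
noncomputable def gradMain (P : SparseProblem d m Θ F) (τ : ℝ) (ν : FiniteMeasure Θ)
    (i : Fin m) : ℝ :=
  P.α⁻¹ * ((P.K + P.H) *ᵥ P.bias τ ν) (i, 0) ^ 2
    + ∑ j : Fin d, P.β⁻¹ * ((P.K + P.H) *ᵥ P.bias τ ν) (i, j.succ) ^ 2

/-- As `K + H` is symmetric and `D` is diagonal, the form `(K + H) D (K + H)` is the sum of the
weighted squares of the components of `(K + H) b`. -/
lemma sum_gradMain (hx : ∀ i, IsNormalChart (P.θ i) (P.ρ i) (P.x i)) (h1 : P.A1) (τ : ℝ)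
    (ν : FiniteMeasure Θ) :
    P.bias τ ν ⬝ᵥ (((P.K + P.H) * P.metricMat * (P.K + P.H)) *ᵥ P.bias τ ν)
      = ∑ i, P.gradMain τ ν i := by
  have hS : (P.K + P.H).IsSymm := (K_isSymm h1).add (H_isSymm hx h1)
  rw [← Matrix.mulVec_mulVec, ← Matrix.mulVec_mulVec, Matrix.dotProduct_mulVec,
    ← Matrix.mulVec_transpose, hS.eq, dotProduct, Fintype.sum_prod_type]
  refine Finset.sum_congr rfl fun i _ => ?_
  rw [Fin.sum_univ_succ, gradMain, metricMat]
  simp only [Matrix.mulVec_diagonal, if_true, Fin.succ_ne_zero, if_false]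
  congr 1
  · ring
  · exact Finset.sum_congr rfl fun j _ => by ring

lemma gradMain_eq (h1 : P.A1) (h2 : P.A2) (h4 : P.A4) (τ : ℝ) (ν : FiniteMeasure Θ) (i : Fin m) :
    P.gradMain τ ν i
      = 4 * P.α * (P.r i ^ 2 * P.hessMap (P.lin (P.bias τ ν)) (P.φ (P.θ i)) ^ 2)
        + P.β * P.r i ^ 2 * (P.frameVals i (P.hessMap (P.lin (P.bias τ ν))) ⬝ᵥ
          P.frameVals i (P.hessMap (P.lin (P.bias τ ν))))
        + 2 * P.β⁻¹ * (P.locMass τ ν i * (P.frameVals i (P.hessMap (P.lin (P.bias τ ν))) ⬝ᵥ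
          (P.Hloc i *ᵥ (P.locMean τ ν i).ofLp)))
        + P.β⁻¹ * (P.locMass τ ν i / (P.β * P.r i)) ^ 2 *
          ((P.Hloc i *ᵥ (P.locMean τ ν i).ofLp) ⬝ᵥ (P.Hloc i *ᵥ (P.locMean τ ν i).ofLp)) := by
  have hα := h2.α_pos.ne'
  have hβ := h2.β_pos.ne'
  have hr := (h4.r_pos i).ne'
  rw [gradMain, Matrix.add_mulVec, Pi.add_apply, K_mulVec_apply, H_mulVec_zero, hessMap_symm h1,
    gradBar_zero, map_smul, map_smul, smul_eq_mul, smul_eq_mul]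
  rw [add_assoc _ (P.β * P.r i ^ 2 * _), add_assoc _ (P.β * P.r i ^ 2 * _ + _)]
  congr 1
  · field_simp
    ring
  · simp only [dotProduct, Finset.mul_sum]
    rw [← Finset.sum_add_distrib, ← Finset.sum_add_distrib]
    refine Finset.sum_congr rfl fun j _ => ?_
    rw [Pi.add_apply, K_mulVec_apply, H_mulVec_succ, hessMap_symm h1, gradBar_succ, map_smul,
      map_smul, smul_eq_mul, smul_eq_mul, bias_succ_eq_smul, Matrix.mulVec_smul, Pi.smul_apply,
      smul_eq_mul]
    simp only [frameVals]
    field_simp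
    ring

/-- The contribution of a cell to the expansion of the squared gradient norm. -/
lemma isBigO_gradSq_cell_sub_main (hlam : 0 < P.lam)
    (hx : ∀ i, IsNormalChart (P.θ i) (P.ρ i) (P.x i))
    (h1 : P.A1) (h2 : P.A2) (h3 : P.A3) (h4 : P.A4) (h5 : P.A5) (Jmax : ℝ) (i : Fin m) :
    (fun z : ℝ × FiniteMeasure Θ => P.gradSq z.2 (P.cell z.1 i) - P.gradMain z.1 z.2 i
      - P.r i ^ 2 * (P.β⁻¹ * (P.locCov z.1 z.2 i * P.Hloc i ^ 2).trace))
      =O[𝓟 (P.smallDom Jmax)] P.errBound := by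
  have hβ := h2.β_pos
  have hr := h4.r_pos i
  have hsub := principal_mono.2 (P.smallDom_subset Jmax)
  have hs := isBigO_locMass_sub hx h1 h2 h3 h4 h5 Jmax i
  have htr := (isBigO_trace_mul (P.Hloc i ^ 2) (isBigO_locCov hx h1 h2 h3 h4 h5 Jmax i)).trans
    (isBigO_gap_div h4 Jmax)
  have hq := ((isBigO_locMass_mul_quadratic hx h1 h2 h3 h4 h5 Jmax i (P.Hloc i ^ 2)).mono
    hsub).trans (isBigO_gap_div h4 Jmax)
  have e0 := (isBigO_locMass_mul_sq_dvar_sub hlam hx h1 h2 h3 h4 h5 Jmax i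
    (P.φ (P.θ i))).const_mul_left (4 * P.α)
  have e1 := (IsBigO.fun_sum fun (k : Fin d) (_ : k ∈ Finset.univ) =>
    isBigO_locMass_mul_sq_dvar_sub hlam hx h1 h2 h3 h4 h5 Jmax i
      (P.dφ i (EuclideanSpace.single k 1))).const_mul_left P.β
  have e2 := (isBigO_locMass_mul_dotProduct hlam hx h1 h2 h3 h4 h5 Jmax i).const_mul_left
    (2 * P.β⁻¹)
  have e3 := (isBigO_errBound_of_mul h4 hs htr).const_mul_left P.β⁻¹
  have e4 := (isBigO_errBound_of_mul h4 hs hq).const_mul_left ((P.β ^ 3)⁻¹ * (P.r i ^ 2)⁻¹)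
  refine (((((isBigO_gradSq_cell_sub hlam hx h1 h2 h3 h4 h5 Jmax i).add e0).add e1).add e2).add
    (e3.sub e4)).congr' (eventually_principal.2 fun z hz => ?_) EventuallyEq.rfl
  dsimp only
  have e5 : ∑ k, (P.locMass z.1 z.2 i * P.dvar z.2 (P.dφ i (EuclideanSpace.single k 1)) ^ 2
      - P.r i ^ 2 * P.hessMap (P.lin (P.bias z.1 z.2)) (P.dφ i (EuclideanSpace.single k 1)) ^ 2)
      = P.locMass z.1 z.2 i * (P.frameVals i (P.dvar z.2) ⬝ᵥ P.frameVals i (P.dvar z.2))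
        - P.r i ^ 2 * (P.frameVals i (P.hessMap (P.lin (P.bias z.1 z.2))) ⬝ᵥ
          P.frameVals i (P.hessMap (P.lin (P.bias z.1 z.2)))) := by
    rw [Finset.sum_sub_distrib, ← Finset.mul_sum, ← Finset.mul_sum]
    simp only [dotProduct, frameVals, sq]
  rw [e5, setIntegral_sq_norm_hessJ'_add hx h1 h2 hz.1.1, gradMain_eq h1 h2 h4,
    (Hloc_isSymm hx h1 i).dotProduct_mulVec_self, sub_dotProduct]
  field_simp
  ring

/-- The expansion of the squared gradient norm, for a small excess. -/
lemma isBigO_gradSq_expansion (hlam : 0 < P.lam)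
    (hx : ∀ i, IsNormalChart (P.θ i) (P.ρ i) (P.x i))
    (h1 : P.A1) (h2 : P.A2) (h3 : P.A3) (h4 : P.A4) (h5 : P.A5) (Jmax : ℝ) :
    (fun z : ℝ × FiniteMeasure Θ => 1 / 2 * P.gradSq z.2 Set.univ -
      (1 / 2 * (P.bias z.1 z.2 ⬝ᵥ
          (((P.K + P.H) * P.metricMat * (P.K + P.H)) *ᵥ P.bias z.1 z.2))
        + 1 / 2 * ∑ i, P.r i ^ 2 * (P.β⁻¹ * (P.locCov z.1 z.2 i * P.Hloc i ^ 2).trace)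
        + 1 / 2 * P.gradSq z.2 (P.cell₀ z.1)))
      =O[𝓟 (P.smallDom Jmax)] P.errBound := by
  refine ((IsBigO.fun_sum fun i (_ : i ∈ Finset.univ) => isBigO_gradSq_cell_sub_main hlam hx h1 h2
    h3 h4 h5 Jmax i).const_mul_left (1 / 2)).congr'
    (eventually_principal.2 fun z hz => ?_) EventuallyEq.rfl
  dsimp only
  rw [gradSq_univ h1 hz.1.1, sum_gradMain hx h1, Finset.sum_sub_distrib, Finset.sum_sub_distrib]
  ring

section Bounds

lemma isBigO_one_gap (h4 : P.A4) (Jmax : ℝ) :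
    (fun z : ℝ × FiniteMeasure Θ => P.gap z.2) =O[𝓟 (P.dom Jmax)] fun _ => (1 : ℝ) := by
  refine isBigO_principal_of_norm_le (C := |Jmax - P.Jstar|) (abs_nonneg _) fun z hz => ?_
  have h : 0 ≤ P.gap z.2 := gap_nonneg h4 z.2
  rw [Real.norm_of_nonneg h, mul_one]
  exact (sub_le_sub_right hz.2 _).trans (le_abs_self _)

lemma isBigO_one_bias (hlam : 0 < P.lam) (hx : ∀ i, IsNormalChart (P.θ i) (P.ρ i) (P.x i))
    (h1 : P.A1) (Jmax : ℝ) (a : Fin m × Fin (d + 1)) :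
    (fun z : ℝ × FiniteMeasure Θ => P.bias z.1 z.2 a) =O[𝓟 (P.dom Jmax)] fun _ => (1 : ℝ) := by
  obtain ⟨i, j⟩ := a
  have hm : (fun z : ℝ × FiniteMeasure Θ => P.locMass z.1 z.2 i) =O[𝓟 (P.dom Jmax)]
      fun _ => (1 : ℝ) := by
    refine isBigO_principal_of_norm_le (C := |Jmax / P.lam|) (abs_nonneg _) fun z hz => ?_
    rw [Real.norm_of_nonneg (P.locMass_nonneg _ _ _), mul_one]
    exact ((P.locMass_le_mass _ _ _).trans (mass_le hlam h1 hz.2)).trans (le_abs_self _)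
  refine Fin.cases ?_ (fun j => ?_) j
  · simp only [bias_zero, div_eq_inv_mul]
    exact (hm.sub (isBigO_const_const _ one_ne_zero _)).const_mul_left _
  · simp only [bias_succ, div_eq_inv_mul]
    have hθ : (fun z : ℝ × FiniteMeasure Θ => P.locMean z.1 z.2 i j) =O[𝓟 (P.dom Jmax)]
        fun _ => (1 : ℝ) :=
      isBigO_principal_of_norm_le zero_le_one fun z hz => by
        rw [mul_one]
        exact abs_locMean_apply_le (mem_source_of_mem_cell hx hz.1 i) j
    simpa using (hm.const_mul_left (P.β * P.r i)⁻¹).mul hθ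

lemma isBigO_one_bias_quadratic (hlam : 0 < P.lam)
    (hx : ∀ i, IsNormalChart (P.θ i) (P.ρ i) (P.x i)) (h1 : P.A1) (Jmax : ℝ)
    (M : Matrix (Fin m × Fin (d + 1)) (Fin m × Fin (d + 1)) ℝ) :
    (fun z : ℝ × FiniteMeasure Θ => P.bias z.1 z.2 ⬝ᵥ (M *ᵥ P.bias z.1 z.2))
      =O[𝓟 (P.dom Jmax)] fun _ => (1 : ℝ) := by
  simpa using isBigO_dotProduct_mulVec M (isBigO_one_bias hlam hx h1 Jmax)
    (isBigO_one_bias hlam hx h1 Jmax)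

lemma isBigO_one_trace (hx : ∀ i, IsNormalChart (P.θ i) (P.ρ i) (P.x i)) (h2 : P.A2) (Jmax : ℝ)
    (i : Fin m) (M : Matrix (Fin d) (Fin d) ℝ) :
    (fun z : ℝ × FiniteMeasure Θ => (P.locCov z.1 z.2 i * M).trace)
      =O[𝓟 (P.dom Jmax)] fun _ => (1 : ℝ) := by
  refine isBigO_trace_mul M fun j k => ?_
  refine isBigO_principal_of_norm_le (C := 4 * (P.β ^ 2)⁻¹) (by positivity) fun z hz => ?_
  rw [mul_one]
  exact abs_locCov_le (mem_source_of_mem_cell hx hz.1 i) h2.β_pos.ne' j k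

lemma isBigO_one_gradSq (hlam : 0 < P.lam) (h1 : P.A1) (h2 : P.A2) (Jmax : ℝ) (A : ℝ → Set Θ) :
    (fun z : ℝ × FiniteMeasure Θ => P.gradSq z.2 (A z.1)) =O[𝓟 (P.dom Jmax)]
      fun _ => (1 : ℝ) := by
  obtain ⟨C, hC, hb⟩ := exists_abs_gradDensity_le hlam h1 h2 Jmax
  refine isBigO_principal_of_norm_le (C := C * |Jmax / P.lam|) (by positivity) fun z hz => ?_
  rw [mul_one, gradSq]
  refine (norm_setIntegral_le_of_norm_le_const (measure_lt_top _ _)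
    fun p _ => hb z.2 hz.2 p).trans ?_
  gcongr
  refine (measureReal_mono (Set.subset_univ _)).trans ?_
  exact (mass_le hlam h1 hz.2).trans (le_abs_self _)

end Bounds

lemma isBigO_gap_expansion_dom (hlam : 0 < P.lam)
    (hx : ∀ i, IsNormalChart (P.θ i) (P.ρ i) (P.x i))
    (h1 : P.A1) (h2 : P.A2) (h3 : P.A3) (h4 : P.A4) (h5 : P.A5) (Jmax : ℝ) :
    (fun z : ℝ × FiniteMeasure Θ => P.gap z.2 -
      (1 / 2 * (P.bias z.1 z.2 ⬝ᵥ ((P.K + P.H) *ᵥ P.bias z.1 z.2))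
        + 1 / 2 * ∑ i, P.r i ^ 2 * (P.locCov z.1 z.2 i * P.Hloc i).trace
        + ∫ p in P.cell₀ z.1, P.J' P.νstar p ∂(z.2 : Measure Θ)))
      =O[𝓟 (P.dom Jmax)] P.errBound := by
  refine isBigO_errBound_of_smallDom h4 ?_ (isBigO_gap_expansion hlam hx h1 h2 h3 h4 h5 Jmax)
  have hg := isBigO_one_gap h4 Jmax
  have e0 : (fun z : ℝ × FiniteMeasure Θ =>
      ∫ p in P.cell₀ z.1, P.J' P.νstar p ∂(z.2 : Measure Θ)) =O[𝓟 (P.dom Jmax)]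
      fun z => P.gap z.2 := isBigO_principal_of_norm_le zero_le_one fun z _ => by
    rw [one_mul, Real.norm_of_nonneg (integral_nonneg fun p => J'_νstar_ge_zero h1 h4 p)]
    exact setIntegral_J'_le_gap h1 h3 h4 z.2 _
  exact hg.sub ((((isBigO_one_bias_quadratic hlam hx h1 Jmax _).const_mul_left _).add
    ((IsBigO.fun_sum fun i _ => (isBigO_one_trace hx h2 Jmax i _).const_mul_left
      _).const_mul_left _)).add (e0.trans hg))

lemma isBigO_gradSq_expansion_dom (hlam : 0 < P.lam)
    (hx : ∀ i, IsNormalChart (P.θ i) (P.ρ i) (P.x i))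
    (h1 : P.A1) (h2 : P.A2) (h3 : P.A3) (h4 : P.A4) (h5 : P.A5) (Jmax : ℝ) :
    (fun z : ℝ × FiniteMeasure Θ => 1 / 2 * P.gradSq z.2 Set.univ -
      (1 / 2 * (P.bias z.1 z.2 ⬝ᵥ
          (((P.K + P.H) * P.metricMat * (P.K + P.H)) *ᵥ P.bias z.1 z.2))
        + 1 / 2 * ∑ i, P.r i ^ 2 * (P.β⁻¹ * (P.locCov z.1 z.2 i * P.Hloc i ^ 2).trace)
        + 1 / 2 * P.gradSq z.2 (P.cell₀ z.1)))
      =O[𝓟 (P.dom Jmax)] P.errBound := by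
  refine isBigO_errBound_of_smallDom h4 ?_ (isBigO_gradSq_expansion hlam hx h1 h2 h3 h4 h5 Jmax)
  exact ((isBigO_one_gradSq hlam h1 h2 Jmax fun _ => Set.univ).const_mul_left _).sub
    ((((isBigO_one_bias_quadratic hlam hx h1 Jmax _).const_mul_left _).add
    ((IsBigO.fun_sum fun i _ => ((isBigO_one_trace hx h2 Jmax i _).const_mul_left
      _).const_mul_left _).const_mul_left _)).add
    ((isBigO_one_gradSq hlam h1 h2 Jmax P.cell₀).const_mul_left _))

end SparseProblem

end LocalExpansion

theorem proposition3p6 (d m : ℕ) {Θ F : Type*}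
    [EMetricSpace Θ] [CompactSpace Θ] [MeasurableSpace Θ] [BorelSpace Θ]
    [ChartedSpace (Eucl d) Θ] [IsManifold 𝓘(ℝ, Eucl d) ∞ Θ]
    [RiemannianBundle (fun p : Θ => TangentSpace 𝓘(ℝ, Eucl d) p)]
    [IsContMDiffRiemannianBundle 𝓘(ℝ, Eucl d) ∞ (Eucl d)
      (fun p : Θ => TangentSpace 𝓘(ℝ, Eucl d) p)]
    [IsRiemannianManifold 𝓘(ℝ, Eucl d) Θ]
    [NormedAddCommGroup F] [InnerProductSpace ℝ F] [CompleteSpace F]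
    (P : SparseProblem d m Θ F) (hlam : 0 < P.lam)
    (hx : ∀ i, IsNormalChart (P.θ i) (P.ρ i) (P.x i))
    (h1 : P.A1) (h2 : P.A2) (h3 : P.A3) (h4 : P.A4) (h5 : P.A5) :
    ∀ Jmax : ℝ, ∃ C : ℝ, ∀ τ : ℝ, P.Admissible τ → ∀ ν : FiniteMeasure Θ, P.J ν ≤ Jmax →
      |(P.J ν - P.Jstar) -
          (1 / 2 * (P.bias τ ν ⬝ᵥ ((P.K + P.H) *ᵥ P.bias τ ν))
            + 1 / 2 * ∑ i, P.r i ^ 2 * (P.locCov τ ν i * P.Hloc i).trace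
            + ∫ p in P.cell₀ τ, P.J' P.νstar p ∂(ν : Measure Θ))|
        ≤ C * ((P.J ν - P.Jstar) * τ + (P.J ν - P.Jstar) ^ (3 / 2 : ℝ) / τ ^ 6) ∧
      |1 / 2 * P.gradSq ν Set.univ -
          (1 / 2 * (P.bias τ ν ⬝ᵥ
                (((P.K + P.H) * P.metricMat * (P.K + P.H)) *ᵥ P.bias τ ν))
            + 1 / 2 * ∑ i, P.r i ^ 2 * (P.β⁻¹ * (P.locCov τ ν i * P.Hloc i ^ 2).trace)
            + 1 / 2 * P.gradSq ν (P.cell₀ τ))|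
        ≤ C * ((P.J ν - P.Jstar) * τ + (P.J ν - P.Jstar) ^ (3 / 2 : ℝ) / τ ^ 6) := by
  intro Jmax
  obtain ⟨A, hA, hEA⟩ :=
    (SparseProblem.isBigO_gap_expansion_dom hlam hx h1 h2 h3 h4 h5 Jmax).exists_nonneg
  obtain ⟨B, hB, hEB⟩ :=
    (SparseProblem.isBigO_gradSq_expansion_dom hlam hx h1 h2 h3 h4 h5 Jmax).exists_nonneg
  refine ⟨max A B, fun τ hτ ν hν => ?_⟩
  have hz : (τ, ν) ∈ P.dom Jmax := ⟨hτ, hν⟩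
  have he := SparseProblem.errBound_nonneg h4 hz
  have hA' := Filter.eventually_principal.1 hEA.bound _ hz
  have hB' := Filter.eventually_principal.1 hEB.bound _ hz
  rw [Real.norm_of_nonneg he] at hA' hB'
  exact ⟨hA'.trans (mul_le_mul_of_nonneg_right (le_max_left A B) he),
    hB'.trans (mul_le_mul_of_nonneg_right (le_max_right A B) he)⟩
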